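/- Identify $\mathbb R^2$ with $\mathbb C$. For a smooth closed immersed plane curve $\gamma$ let $s$ denote arc length, $\tau=\partial_s\gamma$ the unit tangent, $\nu=i\tau$ the unit normal and $k$ the scalar curvature, so that $\partial_s\tau=k\nu$. The ideal flow is the $L^2(ds)$-gradient flow of $\mathcal I[\gamma]=\frac12\int_\gamma k_s^2\,ds$, that is, the evolution with normal velocity $-\nabla\mathcal I[\gamma]=k_{ssss}+k^2k_{ss}-\frac12 k\,k_s^2$ in the direction $\nu$. A homothetic expander (centred at the origin) is a curve $\gamma$ that satisfies $$\nabla\mathcal I[\gamma]=-\sigma\,\langle\gamma,\nu\rangle\qquad\text{for some constant }\sigma>0,$$ so that it evolves under the ideal flow by expanding dilations $\rho(t)\gamma$, $t\ge 0$, with $\rho(0)=1$, $\rho$ strictly increasing and $\rho(t)\to\infty$ as $t\to\infty$. Theorem. There is an $m_0<\infty$ and, for every integer $m>m_0$, a smooth closed immersed plane curve $\gamma^E_m$ (an "epicyclic expander") such that (1) $\gamma^E_m$ is a homothetic expander for the ideal flow; (2) $\gamma^E_m$ has dihedral symmetry of order $m$: up to reparametrisation it is invariant under a dihedral group $D_m$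 (with $2m$ elements) of rotations about the origin and reflections in lines through the origin, and the group of all isometries of the plane that preserve the trace of $\gamma^E_m$ is exactly this $D_m$; (3) if $m\neq\hat m$, no similarity transformation of the plane maps (the trace of) $\gamma^E_m$ onto (that of) $\gamma^E_{\hat m}$. -/

import Mathlib

open Set Filter Topology
open scoped ContDiff ComplexConjugate

noncomputable section

namespace PlaneCurve

/-- `γ`, viewed as a map on the circle `ℝ / Tℤ`, is a smooth closed immersed curve
in the plane `ℝ² = ℂ`. -/
structure IsClosedImmersed (γ : ℝ → ℂ) (T : ℝ) : Prop where
  period_pos : 0 < T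
  periodic : Function.Periodic γ T
  smooth : ContDiff ℝ ∞ γ
  immersed : ∀ u, deriv γ u ≠ 0

/-- The derivative `∂ₛ f = |γ'|⁻¹ f'` with respect to the arc length `s` of `γ`. -/
def arcDeriv {E : Type*} [NormedAddCommGroup E] [NormedSpace ℝ E]
    (γ : ℝ → ℂ) (f : ℝ → E) : ℝ → E :=
  fun u => ‖deriv γ u‖⁻¹ • deriv f u

/-- The unit tangent `τ = ∂ₛ γ`. -/
def tangent (γ : ℝ → ℂ) : ℝ → ℂ := arcDeriv γ γ

/-- The unit normal `ν`, which is `τ` rotated by a right angle counterclockwise. -/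
def normal (γ : ℝ → ℂ) : ℝ → ℂ := fun u => Complex.I * tangent γ u

/-- The scalar curvature `k`, that is, `∂ₛ τ = k ν`. -/
def curvature (γ : ℝ → ℂ) : ℝ → ℝ :=
  fun u => inner ℝ (arcDeriv γ (tangent γ) u) (normal γ u)

/-- The `j`-th arc-length derivative of the curvature. -/
def curvatureJet (γ : ℝ → ℂ) (j : ℕ) : ℝ → ℝ := (arcDeriv γ)^[j] (curvature γ)

/-- The (scalar) `L²(ds)`-gradient of the ideal energy `½ ∫ kₛ² ds`:
`∇I[γ] = -(kₛₛₛₛ + k² kₛₛ - ½ k kₛ²)`. -/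
def idealGradient (γ : ℝ → ℂ) : ℝ → ℝ := fun u =>
  -(curvatureJet γ 4 u + curvature γ u ^ 2 * curvatureJet γ 2 u
      - 1 / 2 * curvature γ u * curvatureJet γ 1 u ^ 2)

/-- `Γ t` (`t ∈ J`) evolves by the ideal flow: its normal velocity is `-∇I[Γ t]`. -/
def IsIdealFlowOn (J : Set ℝ) (Γ : ℝ → ℝ → ℂ) : Prop :=
  ∀ t ∈ J, ∀ u, DifferentiableAt ℝ (fun r => Γ r u) t ∧
    inner ℝ (deriv (fun r => Γ r u) t) (normal (Γ t) u) = -idealGradient (Γ t) u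

/-- `γ` is a homothetic expander for the ideal flow, with centre of homothety `0`: it solves the
profile equation `∇I[γ] = -σ ⟨γ, ν⟩` with some `σ > 0`, and the flow moves it through
increasing dilations of itself. -/
def IsHomotheticExpander (γ : ℝ → ℂ) : Prop :=
  (∃ σ : ℝ, 0 < σ ∧ ∀ u, idealGradient γ u = -σ * inner ℝ (γ u) (normal γ u)) ∧
  ∃ ρ : ℝ → ℝ, ρ 0 = 1 ∧ StrictMonoOn ρ (Ici 0) ∧ Tendsto ρ atTop atTop ∧
    IsIdealFlowOn (Ici 0) (fun t u => ρ t • γ u)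

/-- The isometry `g` of the plane is one of the elements of the dihedral group of order `m`
(it has `2m` elements) that is generated by the rotation about `0` by the angle `2π/m` and the
reflection `z ↦ a z̄`, where `|a| = 1`. -/
def IsDihedral (m : ℕ) (a : ℂ) (g : ℂ ≃ᵢ ℂ) : Prop :=
  ∃ ζ : ℂ, ζ ^ m = 1 ∧ ((∀ z, g z = ζ * z) ∨ (∀ z, g z = ζ * (a * conj z)))

/-- `g` maps the closed curve `γ : ℝ / Tℤ → ℂ` to itself up to a diffeomorphism of `ℝ / Tℤ`,
which is given by its lift `φ` to `ℝ`. -/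
def IsSymmetry (γ : ℝ → ℂ) (T : ℝ) (g : ℂ ≃ᵢ ℂ) : Prop :=
  ∃ φ : ℝ → ℝ, ContDiff ℝ ∞ φ ∧ (∀ u, deriv φ u ≠ 0) ∧
    ((∀ u, φ (u + T) = φ u + T) ∨ (∀ u, φ (u + T) = φ u - T)) ∧
    ∀ u, g (γ u) = γ (φ u)

/-- The closed curve `γ : ℝ / Tℤ → ℂ` has dihedral symmetry of order (exactly) `m` about `0`:
it is invariant under a dihedral group of order `m`, and its trace is invariant under no other
isometry of the plane. -/
def HasDihedralSymmetry (γ : ℝ → ℂ) (T : ℝ) (m : ℕ) : Prop :=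
  ∃ a : ℂ, ‖a‖ = 1 ∧ (∀ g : ℂ ≃ᵢ ℂ, IsDihedral m a g → IsSymmetry γ T g) ∧
    ∀ g : ℂ ≃ᵢ ℂ, g '' range γ = range γ → IsDihedral m a g

/-- Some similarity transformation of the plane maps the trace of `γ` onto that of `η`. -/
def Similar (γ η : ℝ → ℂ) : Prop := ∃ Φ : ℂ ≃ᵈ ℂ, Φ '' range γ = range η

end PlaneCurve

end

/-! Let `θ` be the tangent angle of a unit speed curve and `k = θ'`. With `N = (θ'θ''' - θ''²/2) +
iθ''''`, the profile equation says exactly that the vector `V = e^{iθ} N` satisfies `V' = σ⟨γ,ν⟩ν`.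
Put `θ = bs + u` with `u` odd and of period 1. Then `γ(s+1) = e^{ib} γ(s)`, so for `b = 2π/m` the
curve closes up after `m` congruent lobes. In a frame that rotates with speed `b`, both `bγ` and `V`
are periodic solutions of equations `z' + ibz = bw`. Their solution operator `slowPrim` extends to
`b = 0` in a C¹ way, with value `-i` times the mean of `w`. With `σ = μb²` the unknowns `(u, μ)`
solve `expanderMap (b, u, μ) = 0`, and this map is C¹ near `b = 0`.

At `b = 0` the force is constant. The equations become `u'''' = f sin u` with zero energy, `u'u''' -
u''²/2 + f cos u = 0`. Shooting in the amplitude `A` produces a solution with values in `(0, π/2]`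
on the half period (`exists_simultaneous_zero`, `exists_zero_energy_profile`).

This profile is nondegenerate. On odd functions `∂⁻⁴` preserves positivity on the half period, `cos
u ≥ 0`, and `sin u > u cos u` makes `u` a strict supersolution of the linearized equation. So the
linearization has trivial kernel (`IsProfile.eq_zero_of_fixed`), and compactness makes it onto
(`IsProfile.exists_sub_linOp_eq`). The remaining energy equation is solved by varying the force,
whose coefficient is positive by the same comparison (`IsProfile.exists_linear_solution`). The
implicit function theorem then gives a solution for every small `b > 0`, and `IsSolution.re_force`
recovers the full profile equation.

The distance to the origin along a lobe has its only maximum at the ends of the lobe, for the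
profile and hence for small `b`. An isometry that preserves the trace therefore fixes the origin and
permutes the `m` farthest points, so it belongs to `D_m`. A similarity between two such traces would
conjugate a rotation of order `m` into `D_n`; for `m, n > 2` this forces `m ∣ n` and, by symmetry,
`m = n`. -/

noncomputable section

/-! ### Continuous functions on the circle: mean value and antiderivative. -/

namespace CircleFun

set_option linter.unusedSectionVars false

section Basic

variable {E : Type*} [NormedAddCommGroup E] [NormedSpace ℝ E]

lemma continuous_coe (w : C(UnitAddCircle, E)) : Continuous fun s : ℝ => w (s : UnitAddCircle) :=
  w.continuous.comp (AddCircle.continuous_mk' 1)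

lemma coe_add_one (s : ℝ) : ((s + 1 : ℝ) : UnitAddCircle) = s := AddCircle.coe_add_period 1 s

lemma periodic_coe {F : Type*} (w : UnitAddCircle → F) :
    Function.Periodic (fun s : ℝ => w (s : UnitAddCircle)) 1 := fun s => by
  simp only [coe_add_one]

lemma ext_real {F : Type*} [TopologicalSpace F] {a b : C(UnitAddCircle, F)}
    (h : ∀ s : ℝ, a (s : UnitAddCircle) = b (s : UnitAddCircle)) : a = b := by
  ext x
  induction x using QuotientAddGroup.induction_on with
  | H s => exact h s

/-- The function on the circle induced by a continuous `1`-periodic function. -/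
def ofPeriodic (g : ℝ → E) (hc : Continuous g) (hp : Function.Periodic g 1) :
    C(UnitAddCircle, E) where
  toFun := hp.lift
  continuous_toFun := continuous_coinduced_dom.mpr hc

@[simp] lemma ofPeriodic_coe (g : ℝ → E) (hc : Continuous g) (hp : Function.Periodic g 1) (s : ℝ) :
    ofPeriodic g hc hp (s : UnitAddCircle) = g s := rfl

lemma norm_le_of_real {w : C(UnitAddCircle, E)} {C : ℝ} (hC : 0 ≤ C)
    (h : ∀ s ∈ Icc (0 : ℝ) 1, ‖w (s : UnitAddCircle)‖ ≤ C) : ‖w‖ ≤ C := by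
  refine (ContinuousMap.norm_le w hC).2 fun x => ?_
  obtain ⟨b, hb, rfl⟩ := AddCircle.eq_coe_Ico x
  exact h b ⟨hb.1, hb.2.le⟩

lemma norm_apply_le (w : C(UnitAddCircle, E)) (x : UnitAddCircle) : ‖w x‖ ≤ ‖w‖ :=
  ContinuousMap.norm_coe_le_norm w x

lemma intervalIntegrable (w : C(UnitAddCircle, E)) (a b : ℝ) :
    IntervalIntegrable (fun t : ℝ => w (t : UnitAddCircle)) MeasureTheory.volume a b :=
  (continuous_coe w).intervalIntegrable a b

lemma norm_integral_le (w : C(UnitAddCircle, E)) (a b : ℝ) :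
    ‖∫ t in a..b, w (t : UnitAddCircle)‖ ≤ ‖w‖ * |b - a| :=
  intervalIntegral.norm_integral_le_of_norm_le_const fun _ _ => norm_apply_le w _

/-- The mean value over one period. -/
def mean : C(UnitAddCircle, E) →L[ℝ] E :=
  LinearMap.mkContinuous
    { toFun := fun w => ∫ t in (0 : ℝ)..1, w (t : UnitAddCircle)
      map_add' := fun a b => by
        simp only [ContinuousMap.add_apply]
        exact intervalIntegral.integral_add (intervalIntegrable a 0 1) (intervalIntegrable b 0 1)
      map_smul' := fun c a => by
        simp only [ContinuousMap.smul_apply, RingHom.id_apply]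
        exact intervalIntegral.integral_smul c _ } 1
    fun w => by
      have := norm_integral_le w 0 1
      simpa using this

lemma mean_def (w : C(UnitAddCircle, E)) : mean w = ∫ t in (0 : ℝ)..1, w (t : UnitAddCircle) := rfl

lemma integral_add_one_sub [CompleteSpace E] (w : C(UnitAddCircle, E)) (s : ℝ) :
    ∫ t in s..s + 1, w (t : UnitAddCircle) = mean w := by
  have := (periodic_coe w).intervalIntegral_add_eq s 0
  rw [this, mean_def, zero_add]

lemma norm_mean_le (w : C(UnitAddCircle, E)) : ‖mean w‖ ≤ ‖w‖ := by
  have := norm_integral_le w 0 1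
  simpa [mean_def] using this

@[simp] lemma mean_const [CompleteSpace E] (c : E) : mean (ContinuousMap.const UnitAddCircle c) = c := by
  simp [mean_def]

/-- An antiderivative of `w` minus its mean. -/
def rawPrim [CompleteSpace E] (w : C(UnitAddCircle, E)) : C(UnitAddCircle, E) :=
  ofPeriodic (fun s => (∫ t in (0 : ℝ)..s, w (t : UnitAddCircle)) - s • mean w)
    ((intervalIntegral.continuous_primitive (fun a b => intervalIntegrable w a b) 0).sub
      (continuous_id.smul continuous_const))
    (fun s => by
      beta_reduce
      rw [← intervalIntegral.integral_add_adjacent_intervals (intervalIntegrable w 0 s)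
        (intervalIntegrable w s (s + 1)), integral_add_one_sub]
      module)

variable [CompleteSpace E]

lemma rawPrim_coe (w : C(UnitAddCircle, E)) (s : ℝ) : rawPrim w (s : UnitAddCircle) =
    (∫ t in (0 : ℝ)..s, w (t : UnitAddCircle)) - s • mean w := rfl

lemma norm_rawPrim_le (w : C(UnitAddCircle, E)) : ‖rawPrim w‖ ≤ 2 * ‖w‖ := by
  refine norm_le_of_real (by positivity) fun s hs => ?_
  rw [rawPrim_coe]
  have h1 := norm_integral_le w 0 s
  have h2 : ‖s • mean w‖ ≤ ‖w‖ := by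
    rw [norm_smul, Real.norm_of_nonneg hs.1]
    have := norm_mean_le w
    have := norm_nonneg (mean w)
    nlinarith [hs.2, hs.1]
  have h3 : ‖w‖ * |s - 0| ≤ ‖w‖ := by
    rw [sub_zero, abs_of_nonneg hs.1]
    nlinarith [hs.2, norm_nonneg w]
  calc _ ≤ _ := norm_sub_le _ _
    _ ≤ 2 * ‖w‖ := by linarith

/-- The antiderivative of `w - mean w` with mean zero. -/
def prim : C(UnitAddCircle, E) →L[ℝ] C(UnitAddCircle, E) :=
  LinearMap.mkContinuous
    { toFun := fun w => rawPrim w - ContinuousMap.const _ (mean (rawPrim w))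
      map_add' := fun a b => by
        have : rawPrim (a + b) = rawPrim a + rawPrim b := by
          refine ext_real fun s => ?_
          rw [ContinuousMap.add_apply]
          simp only [rawPrim_coe, map_add, ContinuousMap.add_apply]
          rw [intervalIntegral.integral_add (intervalIntegrable a 0 s) (intervalIntegrable b 0 s)]
          module
        rw [this, map_add]
        ext x
        simp only [ContinuousMap.add_apply, ContinuousMap.sub_apply, ContinuousMap.const_apply]
        abel
      map_smul' := fun c a => by
        have : rawPrim (c • a) = c • rawPrim a := by
          refine ext_real fun s => ?_
          rw [ContinuousMap.smul_apply]
          simp only [rawPrim_coe, map_smul, ContinuousMap.smul_apply]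
          rw [intervalIntegral.integral_smul]
          module
        rw [this, map_smul]
        ext x
        simp only [ContinuousMap.smul_apply, ContinuousMap.sub_apply, ContinuousMap.const_apply,
          RingHom.id_apply, smul_sub] } 4
    fun w => by
      have h1 := norm_rawPrim_le w
      have h2 := norm_mean_le (rawPrim w)
      have h3 : ‖ContinuousMap.const UnitAddCircle (mean (rawPrim w))‖ ≤ ‖mean (rawPrim w)‖ :=
        (ContinuousMap.norm_le _ (norm_nonneg _)).2 fun x => le_rfl
      calc _ ≤ _ := norm_sub_le _ _
        _ ≤ 4 * ‖w‖ := by linarith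

lemma prim_apply (w : C(UnitAddCircle, E)) :
    prim w = rawPrim w - ContinuousMap.const _ (mean (rawPrim w)) := rfl

@[simp] lemma mean_prim (w : C(UnitAddCircle, E)) : mean (prim w) = 0 := by
  rw [prim_apply, map_sub, mean_const, sub_self]

lemma hasDerivAt_prim (w : C(UnitAddCircle, E)) (s : ℝ) :
    HasDerivAt (fun s : ℝ => prim w (s : UnitAddCircle)) (w (s : UnitAddCircle) - mean w) s := by
  have h1 : HasDerivAt (fun s : ℝ => ∫ t in (0 : ℝ)..s, w (t : UnitAddCircle))
      (w (s : UnitAddCircle)) s :=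
    intervalIntegral.integral_hasDerivAt_right (intervalIntegrable w 0 s)
      (continuous_coe w).aestronglyMeasurable.stronglyMeasurableAtFilter
      (continuous_coe w).continuousAt
  have h2 : HasDerivAt (fun s : ℝ => s • mean w) ((1 : ℝ) • mean w) s :=
    (hasDerivAt_id s).smul_const _
  have := (h1.sub h2).sub_const (mean (rawPrim w))
  rw [one_smul] at this
  exact this

lemma eq_of_hasDerivAt_zero {g : ℝ → E} (h : ∀ s, HasDerivAt g 0 s) (s t : ℝ) : g s = g t :=
  is_const_of_deriv_eq_zero (fun s => (h s).differentiableAt) (fun s => (h s).deriv) s t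

lemma mean_eq_zero_of_hasDerivAt {z w : C(UnitAddCircle, E)}
    (h : ∀ s : ℝ, HasDerivAt (fun s : ℝ => z (s : UnitAddCircle)) (w (s : UnitAddCircle)) s) :
    mean w = 0 := by
  rw [mean_def, intervalIntegral.integral_eq_sub_of_hasDerivAt (fun s _ => h s)
    (intervalIntegrable w 0 1)]
  have := periodic_coe z 0
  simp only [zero_add] at this
  rw [this, sub_self]

/-- Two periodic antiderivatives differ by a constant, which the mean detects. This is how functions
given by differential equations are recognised as values of `prim`. -/
lemma prim_eq_of_hasDerivAt {z w : C(UnitAddCircle, E)}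
    (h : ∀ s : ℝ, HasDerivAt (fun s : ℝ => z (s : UnitAddCircle)) (w (s : UnitAddCircle)) s) :
    prim w = z - ContinuousMap.const _ (mean z) := by
  have h0 := mean_eq_zero_of_hasDerivAt h
  have h1 : ∀ s : ℝ, HasDerivAt (fun s : ℝ => prim w (s : UnitAddCircle) - z (s : UnitAddCircle))
      0 s := fun s => by
    have := (hasDerivAt_prim w s).sub (h s)
    rwa [h0, sub_zero, sub_self] at this
  have h2 : prim w - z = ContinuousMap.const _ (prim w (0 : ℝ) - z (0 : ℝ)) :=
    ext_real fun s => eq_of_hasDerivAt_zero h1 s 0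
  have h3 : - mean z = prim w (0 : ℝ) - z (0 : ℝ) := by
    have := congrArg mean h2
    rwa [map_sub, mean_prim, mean_const, zero_sub] at this
  have h4 : prim w = (prim w - z) + z := by abel
  rw [h4, h2, ← h3]
  ext x
  simp only [ContinuousMap.add_apply, ContinuousMap.sub_apply, ContinuousMap.const_apply]
  abel

/-- Composition with the reflection `x ↦ -x`. -/
def refl : C(UnitAddCircle, E) →L[ℝ] C(UnitAddCircle, E) :=
  LinearMap.mkContinuous
    { toFun := fun w => w.comp ⟨fun x => -x, continuous_neg⟩
      map_add' := fun _ _ => rfl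
      map_smul' := fun _ _ => rfl } 1
    fun w => by
      rw [one_mul]
      exact (ContinuousMap.norm_le _ (norm_nonneg _)).2 fun x => norm_apply_le w _

@[simp] lemma refl_apply (w : C(UnitAddCircle, E)) (x : UnitAddCircle) : refl w x = w (-x) := rfl

@[simp] lemma refl_refl (w : C(UnitAddCircle, E)) : refl (refl w) = w := by
  ext x; simp

@[simp] lemma mean_refl (w : C(UnitAddCircle, E)) : mean (refl w) = mean w := by
  have h : ∀ t : ℝ, refl w (t : UnitAddCircle) = (fun s : ℝ => w (s : UnitAddCircle)) (-t) :=
    fun t => by simp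
  rw [mean_def]
  simp only [h]
  rw [intervalIntegral.integral_comp_neg (fun s : ℝ => w (s : UnitAddCircle)), neg_zero]
  have := integral_add_one_sub w (-1)
  rwa [neg_add_cancel] at this

/-- Reversing the parameter changes the sign of a derivative, and mean zero is preserved. -/
lemma prim_refl (w : C(UnitAddCircle, E)) : prim (refl w) = - refl (prim w) := by
  have h : ∀ s : ℝ, HasDerivAt (fun s : ℝ => (- refl (prim w)) (s : UnitAddCircle))
      ((refl w - ContinuousMap.const UnitAddCircle (mean w) : C(UnitAddCircle, E))
        (s : UnitAddCircle)) s := fun s => by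
    have h1 := (hasDerivAt_prim w (-s)).scomp s (hasDerivAt_neg s)
    have h2 := h1.neg
    simp only [neg_smul, one_smul, neg_neg] at h2
    exact h2
  have h1 := prim_eq_of_hasDerivAt h
  have h2 : prim (ContinuousMap.const UnitAddCircle (mean w)) = 0 := by
    have := prim_eq_of_hasDerivAt (z := (0 : C(UnitAddCircle, E))) (w := 0)
      (fun s => by simpa using hasDerivAt_const s (0 : E))
    rw [prim_apply]
    have h3 : rawPrim (ContinuousMap.const UnitAddCircle (mean w)) = 0 := by
      refine ext_real fun s => ?_
      simp [rawPrim_coe]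
    rw [h3, map_zero]
    ext x
    simp
  rw [map_sub, h2, sub_zero, map_neg, mean_refl, mean_prim] at h1
  rw [h1]
  ext x
  simp

end Basic

/-- Integration by parts. The means of `a` and `b` drop out because `prim a` and `prim b` have mean
zero. -/
lemma mean_mul_prim (a b : C(UnitAddCircle, ℝ)) :
    mean (a * prim b) = - mean (prim a * b) := by
  have h := mean_eq_zero_of_hasDerivAt (z := prim a * prim b)
    (w := (a - ContinuousMap.const _ (mean a)) * prim b +
      prim a * (b - ContinuousMap.const _ (mean b))) fun s =>
      (hasDerivAt_prim a s).mul (hasDerivAt_prim b s)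
  have hc : ∀ (c : ℝ) (w : C(UnitAddCircle, ℝ)), mean w = 0 →
      mean (ContinuousMap.const _ c * w) = 0 := fun c w hw => by
    rw [mean_def]
    simp only [ContinuousMap.mul_apply, ContinuousMap.const_apply]
    rw [intervalIntegral.integral_const_mul, ← mean_def, hw, mul_zero]
  have h2 := hc (mean a) (prim b) (mean_prim b)
  have h3 := hc (mean b) (prim a) (mean_prim a)
  have h4 : (a - ContinuousMap.const _ (mean a)) * prim b +
      prim a * (b - ContinuousMap.const _ (mean b)) = a * prim b + prim a * b
        - ContinuousMap.const _ (mean a) * prim b - ContinuousMap.const _ (mean b) * prim a := by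
    ring
  rw [h4, map_sub, map_sub, map_add, h2, h3, sub_zero, sub_zero] at h
  exact eq_neg_of_add_eq_zero_left h

/-- The Lipschitz constant is uniform on the unit ball, which is the equicontinuity needed for
Arzelà–Ascoli. -/
lemma norm_prim_sub_le {E : Type*} [NormedAddCommGroup E] [NormedSpace ℝ E] [CompleteSpace E]
    (w : C(UnitAddCircle, E)) (s t : ℝ) :
    ‖prim w (s : UnitAddCircle) - prim w (t : UnitAddCircle)‖ ≤ 2 * ‖w‖ * ‖s - t‖ := by
  refine Convex.norm_image_sub_le_of_norm_hasDerivWithin_le (s := univ)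
    (fun x _ => (hasDerivAt_prim w x).hasDerivWithinAt) (fun x _ => ?_) convex_univ trivial trivial
  have h1 := norm_sub_le (w (x : UnitAddCircle)) (mean w)
  have h2 := norm_apply_le w (x : UnitAddCircle)
  have h3 := norm_mean_le w
  linarith

/-- `prim` is a compact operator. -/
lemma isCompactOperator_prim :
    IsCompactOperator (prim : C(UnitAddCircle, ℝ) →L[ℝ] C(UnitAddCircle, ℝ)) := by
  rw [isCompactOperator_iff_exists_mem_nhds_image_subset_compact]
  refine ⟨Metric.closedBall 0 1, Metric.closedBall_mem_nhds _ zero_lt_one, ?_⟩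
  set e := ContinuousMap.isometryEquivBoundedOfCompact UnitAddCircle ℝ
  set A := e '' (prim '' Metric.closedBall 0 1)
  have hA : IsCompact (closure A) := by
    refine BoundedContinuousFunction.arzela_ascoli (Metric.closedBall (0 : ℝ) (‖prim (E := ℝ)‖))
      (isCompact_closedBall _ _) A ?_ ?_
    · rintro _ x ⟨_, ⟨w, hw, rfl⟩, rfl⟩
      rw [mem_closedBall_zero_iff] at hw ⊢
      change ‖prim w x‖ ≤ _
      calc _ ≤ ‖prim w‖ := norm_apply_le _ x
        _ ≤ ‖prim (E := ℝ)‖ * ‖w‖ := prim.le_opNorm w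
        _ ≤ _ := mul_le_of_le_one_right (ContinuousLinearMap.opNorm_nonneg _) hw
    · intro x
      induction x using QuotientAddGroup.induction_on with
      | H s =>
      rw [Metric.equicontinuousAt_iff_right]
      intro ε hε
      have hn : 𝓝 ((s : ℝ) : UnitAddCircle) = Filter.map (↑) (𝓝 s) := QuotientAddGroup.nhds_eq _ s
      refine (hn ▸ ?_ : ∀ᶠ x in 𝓝 ((s : ℝ) : UnitAddCircle), ∀ i : A,
        dist ((i : BoundedContinuousFunction UnitAddCircle ℝ) (s : UnitAddCircle))
          ((i : BoundedContinuousFunction UnitAddCircle ℝ) x) < ε)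
      rw [Filter.eventually_map]
      filter_upwards [Metric.ball_mem_nhds s (show 0 < ε / 2 by positivity)] with t ht
      rintro ⟨_, _, ⟨w, hw, rfl⟩, rfl⟩
      rw [mem_closedBall_zero_iff] at hw
      change dist (prim w (s : UnitAddCircle)) (prim w (t : UnitAddCircle)) < ε
      rw [dist_eq_norm]
      rw [Metric.mem_ball, dist_comm, dist_eq_norm] at ht
      have := norm_prim_sub_le w s t
      nlinarith [norm_nonneg (s - t)]
  refine ⟨e.symm '' closure A, hA.image e.symm.continuous, ?_⟩
  rintro _ ⟨w, hw, rfl⟩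
  exact ⟨e (prim w), subset_closure ⟨_, ⟨w, hw, rfl⟩, rfl⟩, e.symm_apply_apply _⟩

end CircleFun

/-! ### Global solutions of `ψ'''' = sin ψ` that are continuous in the initial data. -/

namespace WeightedPrim

open BoundedContinuousFunction

/-- The exponential weight. -/
def wt (s : ℝ) : ℝ := Real.exp (2 * |s|)

lemma wt_pos (s : ℝ) : 0 < wt s := Real.exp_pos _

lemma continuous_wt : Continuous wt := by unfold wt; fun_prop

lemma wt_neg (s : ℝ) : wt (-s) = wt s := by simp [wt]

lemma one_le_wt (s : ℝ) : 1 ≤ wt s := Real.one_le_exp (by positivity)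

/-- The weight `e^{2t}` has the primitive `e^{2t}/2`, so each integration gains a factor `1/2` in
the weighted norm on the whole line. -/
lemma abs_integral_le_of_nonneg {h : ℝ → ℝ} (hc : Continuous h) {C : ℝ} (hC : 0 ≤ C)
    (hb : ∀ t, |h t| ≤ C * wt t) {s : ℝ} (hs : 0 ≤ s) :
    |∫ t in (0 : ℝ)..s, h t| ≤ C / 2 * wt s := by
  have h1 : |∫ t in (0 : ℝ)..s, h t| ≤ ∫ t in (0 : ℝ)..s, |h t| :=
    intervalIntegral.abs_integral_le_integral_abs hs
  have h2 : ∫ t in (0 : ℝ)..s, |h t| ≤ ∫ t in (0 : ℝ)..s, C * Real.exp (2 * t) := by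
    refine intervalIntegral.integral_mono_on hs (hc.abs.intervalIntegrable _ _)
      (Continuous.intervalIntegrable (by fun_prop) _ _) fun t ht => ?_
    have := hb t
    rwa [wt, abs_of_nonneg ht.1] at this
  have h3 : ∫ t in (0 : ℝ)..s, C * Real.exp (2 * t) = C / 2 * Real.exp (2 * s) - C / 2 := by
    have hd : ∀ t ∈ uIcc 0 s, HasDerivAt (fun t => C / 2 * Real.exp (2 * t))
        (C * Real.exp (2 * t)) t := fun t _ => by
      have h := (((hasDerivAt_id' t).const_mul 2).exp).const_mul (C / 2)
      exact h.congr_deriv (by ring)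
    rw [intervalIntegral.integral_eq_sub_of_hasDerivAt hd
      (Continuous.intervalIntegrable (by fun_prop) _ _)]
    simp
  rw [wt, abs_of_nonneg hs]
  linarith

lemma abs_integral_le {h : ℝ → ℝ} (hc : Continuous h) {C : ℝ} (hC : 0 ≤ C)
    (hb : ∀ t, |h t| ≤ C * wt t) (s : ℝ) : |∫ t in (0 : ℝ)..s, h t| ≤ C / 2 * wt s := by
  rcases le_total 0 s with hs | hs
  · exact abs_integral_le_of_nonneg hc hC hb hs
  · have h1 := abs_integral_le_of_nonneg (h := fun t => h (-t)) (by fun_prop) hC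
      (fun t => by rw [← wt_neg t]; exact hb (-t)) (s := -s) (by linarith)
    rw [intervalIntegral.integral_comp_neg (fun t => h t), neg_neg, neg_zero,
      intervalIntegral.integral_symm, abs_neg, wt_neg] at h1
    exact h1

/-- The primitive `v ↦ ∫₀ v`, conjugated with the weight. -/
def wprim : (ℝ →ᵇ ℝ) →ₗ[ℝ] (ℝ →ᵇ ℝ) where
  toFun v := BoundedContinuousFunction.ofNormedAddCommGroup
    (fun s => (wt s)⁻¹ * ∫ t in (0 : ℝ)..s, wt t * v t)
    ((continuous_wt.inv₀ fun s => (wt_pos s).ne').mul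
      (intervalIntegral.continuous_primitive
        (fun a b => (continuous_wt.mul v.continuous).intervalIntegrable a b) 0))
    (‖v‖ / 2) fun s => by
      have := abs_integral_le (continuous_wt.mul v.continuous) (norm_nonneg v) (fun t => by
        rw [Pi.mul_apply, abs_mul, abs_of_pos (wt_pos t), mul_comm]
        exact mul_le_mul_of_nonneg_right (v.norm_coe_le_norm t) (wt_pos t).le) s
      rw [norm_mul, norm_inv, Real.norm_of_nonneg (wt_pos s).le, inv_mul_le_iff₀ (wt_pos s),
        mul_comm]
      exact this
  map_add' a b := by
    ext s
    simp only [coe_ofNormedAddCommGroup, BoundedContinuousFunction.add_apply]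
    have : ∀ t, wt t * (a t + b t) = wt t * a t + wt t * b t := fun t => by ring
    simp only [this]
    have h := intervalIntegral.integral_add (a := 0) (b := s) (μ := MeasureTheory.volume)
      ((continuous_wt.mul a.continuous).intervalIntegrable _ _)
      ((continuous_wt.mul b.continuous).intervalIntegrable _ _)
    simp only [Pi.mul_apply] at h
    rw [h]
    ring
  map_smul' c a := by
    ext s
    simp only [coe_ofNormedAddCommGroup, BoundedContinuousFunction.smul_apply, smul_eq_mul,
      RingHom.id_apply]
    have : ∀ t, wt t * (c * a t) = c * (wt t * a t) := fun t => by ring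
    simp only [this]
    rw [intervalIntegral.integral_const_mul]
    ring

lemma wt_mul_wprim (v : ℝ →ᵇ ℝ) (s : ℝ) :
    wt s * wprim v s = ∫ t in (0 : ℝ)..s, wt t * v t := by
  change wt s * ((wt s)⁻¹ * _) = _
  rw [mul_inv_cancel_left₀ (wt_pos s).ne']

lemma norm_wprim_le (v : ℝ →ᵇ ℝ) : ‖wprim v‖ ≤ ‖v‖ / 2 := by
  refine (BoundedContinuousFunction.norm_le (by positivity)).2 fun s => ?_
  have := abs_integral_le (continuous_wt.mul v.continuous) (norm_nonneg v) (fun t => by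
    rw [Pi.mul_apply, abs_mul, abs_of_pos (wt_pos t), mul_comm]
    exact mul_le_mul_of_nonneg_right (v.norm_coe_le_norm t) (wt_pos t).le) s
  simp only [Pi.mul_apply] at this
  rw [← wt_mul_wprim, abs_mul, abs_of_pos (wt_pos s), mul_comm] at this
  exact le_of_mul_le_mul_right this (wt_pos s)

/-- The sine, conjugated with the weight. -/
def wsin (v : ℝ →ᵇ ℝ) : ℝ →ᵇ ℝ := BoundedContinuousFunction.ofNormedAddCommGroup
    (fun s => (wt s)⁻¹ * Real.sin (wt s * v s))
    ((continuous_wt.inv₀ fun s => (wt_pos s).ne').mul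
      (Real.continuous_sin.comp (continuous_wt.mul v.continuous))) 1 fun s => by
      rw [norm_mul, norm_inv, Real.norm_of_nonneg (wt_pos s).le, inv_mul_le_iff₀ (wt_pos s),
        mul_one]
      exact (Real.abs_sin_le_one _).trans (one_le_wt s)

lemma wt_mul_wsin (v : ℝ →ᵇ ℝ) (s : ℝ) : wt s * wsin v s = Real.sin (wt s * v s) := by
  change wt s * ((wt s)⁻¹ * _) = _
  rw [mul_inv_cancel_left₀ (wt_pos s).ne']

lemma abs_sin_sub_sin_le (x y : ℝ) : |Real.sin x - Real.sin y| ≤ |x - y| := by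
  have := Real.lipschitzWith_sin.dist_le_mul x y
  simpa [Real.dist_eq] using this

lemma dist_wsin_le (v w : ℝ →ᵇ ℝ) : dist (wsin v) (wsin w) ≤ dist v w := by
  refine (BoundedContinuousFunction.dist_le dist_nonneg).2 fun s => ?_
  have h1 : wsin v s - wsin w s =
      (wt s)⁻¹ * (Real.sin (wt s * v s) - Real.sin (wt s * w s)) := by
    rw [← wt_mul_wsin, ← wt_mul_wsin, ← mul_sub, inv_mul_cancel_left₀ (wt_pos s).ne']
  have h2 := abs_sin_sub_sin_le (wt s * v s) (wt s * w s)
  rw [← mul_sub, abs_mul, abs_of_pos (wt_pos s)] at h2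
  rw [Real.dist_eq, h1, abs_mul, abs_inv, abs_of_pos (wt_pos s), inv_mul_le_iff₀ (wt_pos s)]
  refine h2.trans ?_
  have h3 : |v s - w s| ≤ dist v w := BoundedContinuousFunction.dist_coe_le_dist (f := v) (g := w) s
  exact mul_le_mul_of_nonneg_left h3 (wt_pos s).le

/-- The Volterra operator of `ψ'''' = sin ψ`. -/
def volterra (v : ℝ →ᵇ ℝ) : ℝ →ᵇ ℝ := wprim (wprim (wprim (wprim (wsin v))))

/-- Four primitives contribute `1/2` each, and the sine is 1-Lipschitz in the weighted norm. -/
lemma dist_volterra_le (v w : ℝ →ᵇ ℝ) : dist (volterra v) (volterra w) ≤ 1 / 16 * dist v w := by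
  have h := dist_wsin_le v w
  rw [dist_eq_norm] at h ⊢
  unfold volterra
  simp only [← map_sub]
  have h1 := norm_wprim_le (wprim (wprim (wprim (wsin v - wsin w))))
  have h2 := norm_wprim_le (wprim (wprim (wsin v - wsin w)))
  have h3 := norm_wprim_le (wprim (wsin v - wsin w))
  have h4 := norm_wprim_le (wsin v - wsin w)
  linarith

/-- Banach's fixed point theorem on the whole line. The fixed point is Lipschitz in `p` because
`1/(1 - 1/16) ≤ 2`. -/
lemma exists_fixed : ∃ F : (ℝ →ᵇ ℝ) → (ℝ →ᵇ ℝ), Continuous F ∧ ∀ p, F p = p + volterra (F p) := by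
  have hc : ∀ p : ℝ →ᵇ ℝ, ContractingWith (1 / 16 : NNReal) fun v => p + volterra v := fun p =>
    ⟨by rw [← NNReal.coe_lt_coe]; norm_num, LipschitzWith.of_dist_le_mul fun v w => by
      rw [dist_add_left]
      simpa using dist_volterra_le v w⟩
  refine ⟨fun p => (hc p).fixedPoint, ?_, fun p => (hc p).fixedPoint_isFixedPt.symm⟩
  refine (LipschitzWith.of_dist_le_mul (K := 2) fun p q => ?_).continuous
  have hp := (hc p).fixedPoint_isFixedPt
  have hq := (hc q).fixedPoint_isFixedPt
  set v := (hc p).fixedPoint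
  set w := (hc q).fixedPoint
  have h1 : dist v w ≤ dist p q + dist (volterra v) (volterra w) := by
    nth_rw 1 [← hp.eq, ← hq.eq]
    exact dist_add_add_le _ _ _ _
  have h2 := dist_volterra_le v w
  have : (0 : ℝ) ≤ dist v w := dist_nonneg
  push_cast
  linarith

/-- The bounded function `wt⁻¹ * g`. -/
def weigh (g : ℝ → ℝ) (hg : Continuous g) (hb : ∀ s, |g s| ≤ wt s) : ℝ →ᵇ ℝ :=
  BoundedContinuousFunction.ofNormedAddCommGroup (fun s => (wt s)⁻¹ * g s)
    ((continuous_wt.inv₀ fun s => (wt_pos s).ne').mul hg) 1 fun s => by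
      rw [norm_mul, norm_inv, Real.norm_of_nonneg (wt_pos s).le, inv_mul_le_iff₀ (wt_pos s),
        mul_one]
      exact hb s

lemma wt_mul_weigh (g : ℝ → ℝ) (hg : Continuous g) (hb : ∀ s, |g s| ≤ wt s) (s : ℝ) :
    wt s * weigh g hg hb s = g s := by
  change wt s * ((wt s)⁻¹ * _) = _
  rw [mul_inv_cancel_left₀ (wt_pos s).ne']

lemma sq_le_wt (s : ℝ) : |s ^ 2| ≤ wt s := by
  have := Real.quadratic_le_exp_of_nonneg (x := 2 * |s|) (by positivity)
  rw [abs_of_nonneg (sq_nonneg s), wt]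
  nlinarith [sq_abs s, abs_nonneg s]

end WeightedPrim

open WeightedPrim in
/-- The solutions of `ψ'''' = sin ψ` with `ψ = A`, `ψ' = 0`, `ψ'' = -B A`, `ψ''' = 0` at `0`, as
functions that are continuous in the parameter `A`. -/
theorem exists_sine_flow (B : ℝ → ℝ) (hB : Continuous B) :
    ∃ p p₁ p₂ p₃ : ℝ → ℝ → ℝ,
      (∀ A s, HasDerivAt (p A) (p₁ A s) s) ∧ (∀ A s, HasDerivAt (p₁ A) (p₂ A s) s) ∧
      (∀ A s, HasDerivAt (p₂ A) (p₃ A s) s) ∧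
      (∀ A s, HasDerivAt (p₃ A) (Real.sin (p A s)) s) ∧
      (∀ A, p A 0 = A ∧ p₁ A 0 = 0 ∧ p₂ A 0 = - B A ∧ p₃ A 0 = 0) ∧
      Continuous (fun x : ℝ × ℝ => p x.1 x.2) ∧ Continuous (fun x : ℝ × ℝ => p₂ x.1 x.2) := by
  obtain ⟨F, hF, hfix⟩ := exists_fixed
  -- The initial data enter through the Taylor polynomial `A - (B A/2) s²`; `ψ` is this polynomial
  -- plus the fourfold primitive of `sin ψ`.
  let e0 := weigh (fun _ => 1) continuous_const (fun s => by simpa using one_le_wt s)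
  let e2 := weigh (fun s => s ^ 2) (by fun_prop) sq_le_wt
  let v : ℝ → BoundedContinuousFunction ℝ ℝ := fun A => F (A • e0 - (B A / 2) • e2)
  have hv : Continuous v := hF.comp (by fun_prop)
  let p : ℝ → ℝ → ℝ := fun A s => wt s * v A s
  have hpc : Continuous (fun x : ℝ × ℝ => p x.1 x.2) :=
    (continuous_wt.comp continuous_snd).mul
      ((hv.comp continuous_fst).eval continuous_snd)
  let q₃ : ℝ → ℝ → ℝ := fun A s => ∫ t in (0 : ℝ)..s, Real.sin (p A t)
  let q₂ : ℝ → ℝ → ℝ := fun A s => ∫ t in (0 : ℝ)..s, q₃ A t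
  let q₁ : ℝ → ℝ → ℝ := fun A s => ∫ t in (0 : ℝ)..s, q₂ A t
  let q₀ : ℝ → ℝ → ℝ := fun A s => ∫ t in (0 : ℝ)..s, q₁ A t
  have step : ∀ f : ℝ → ℝ → ℝ, Continuous (fun x : ℝ × ℝ => f x.1 x.2) →
      Continuous (fun x : ℝ × ℝ => ∫ t in (0 : ℝ)..x.2, f x.1 t) := fun f hf =>
    intervalIntegral.continuous_parametric_primitive_of_continuous (f := f) hf
  have c3 : Continuous (fun x : ℝ × ℝ => q₃ x.1 x.2) := step (fun A s => Real.sin (p A s)) (Real.continuous_sin.comp hpc)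
  have c2 : Continuous (fun x : ℝ × ℝ => q₂ x.1 x.2) := step q₃ c3
  have c1 : Continuous (fun x : ℝ × ℝ => q₁ x.1 x.2) := step q₂ c2
  have hder : ∀ f : ℝ → ℝ → ℝ, Continuous (fun x : ℝ × ℝ => f x.1 x.2) →
      ∀ A s, HasDerivAt (fun s => ∫ t in (0 : ℝ)..s, f A t) (f A s) s := fun f hf A s => by
    have hc : Continuous (f A) := hf.comp (continuous_const.prodMk continuous_id)
    exact intervalIntegral.integral_hasDerivAt_right (hc.intervalIntegrable _ _)
      hc.aestronglyMeasurable.stronglyMeasurableAtFilter hc.continuousAt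
  have d3 : ∀ A s, HasDerivAt (q₃ A) (Real.sin (p A s)) s :=
    hder (fun A s => Real.sin (p A s)) (Real.continuous_sin.comp hpc)
  have d2 : ∀ A s, HasDerivAt (q₂ A) (q₃ A s) s := hder q₃ c3
  have d1 : ∀ A s, HasDerivAt (q₁ A) (q₂ A s) s := hder q₂ c2
  have d0 : ∀ A s, HasDerivAt (q₀ A) (q₁ A s) s := hder q₁ c1
  have hp : ∀ A s, p A s = A - B A / 2 * s ^ 2 + q₀ A s := fun A s => by
    have h1 : v A = (A • e0 - (B A / 2) • e2) + volterra (v A) := hfix _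
    have h2 : wt s * volterra (v A) s = q₀ A s := by
      simp only [volterra, wt_mul_wprim, wt_mul_wsin]
      rfl
    change wt s * v A s = _
    rw [h1, BoundedContinuousFunction.add_apply, mul_add, h2,
      BoundedContinuousFunction.sub_apply, BoundedContinuousFunction.smul_apply,
      BoundedContinuousFunction.smul_apply, mul_sub, smul_eq_mul, smul_eq_mul, mul_left_comm,
      mul_left_comm (wt s) (B A / 2), wt_mul_weigh, wt_mul_weigh, mul_one]
  refine ⟨p, fun A s => - B A * s + q₁ A s, fun A s => - B A + q₂ A s, q₃, ?_, ?_, ?_, d3, ?_,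
    hpc, ?_⟩
  · intro A s
    have : p A = fun s => A - B A / 2 * s ^ 2 + q₀ A s := funext (hp A)
    rw [this]
    have h := ((((hasDerivAt_id' s).fun_pow 2).const_mul (B A / 2)).const_sub A).add (d0 A s)
    exact h.congr_deriv (by norm_num; ring)
  · intro A s
    have h := ((hasDerivAt_id' s).const_mul (-B A)).add (d1 A s)
    exact h.congr_deriv (by ring)
  · intro A s
    exact (d2 A s).const_add _
  · intro A
    refine ⟨?_, ?_, ?_, ?_⟩
    · rw [hp]; simp [q₀]
    · simp [q₁]
    · simp [q₂]
    · simp [q₃]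
  · exact ((hB.comp continuous_fst).neg).add c2

/-! ### Shooting for a periodic solution of zero energy. -/

namespace SineFlow

lemma lt_of_deriv_neg {g g' : ℝ → ℝ} (hg : ∀ s, HasDerivAt g (g' s) s) {a b : ℝ} (hab : a < b)
    (h : ∀ s ∈ Ioo a b, g' s < 0) : g b < g a := by
  have hc : ContinuousOn g (Icc a b) := fun s _ => (hg s).continuousAt.continuousWithinAt
  refine strictAntiOn_of_deriv_neg (convex_Icc a b) hc (fun s hs => ?_)
    (left_mem_Icc.2 hab.le) (right_mem_Icc.2 hab.le) hab
  rw [interior_Icc] at hs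
  rw [(hg s).deriv]
  exact h s hs

lemma lt_of_deriv_pos {g g' : ℝ → ℝ} (hg : ∀ s, HasDerivAt g (g' s) s) {a b : ℝ} (hab : a < b)
    (h : ∀ s ∈ Ioo a b, 0 < g' s) : g a < g b := by
  have := lt_of_deriv_neg (g := fun s => -g s) (fun s => (hg s).neg) hab
    (fun s hs => neg_neg_of_pos (h s hs))
  linarith

/-- A solution of `ψ'''' = sin ψ` together with its derivatives. -/
structure IsSol (p p₁ p₂ p₃ : ℝ → ℝ) : Prop where
  d0 : ∀ s, HasDerivAt p (p₁ s) s
  d1 : ∀ s, HasDerivAt p₁ (p₂ s) s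
  d2 : ∀ s, HasDerivAt p₂ (p₃ s) s
  d3 : ∀ s, HasDerivAt p₃ (Real.sin (p s)) s

/-- The first-order system is globally 1-Lipschitz in the sup norm. Uniqueness is what turns initial
data with a symmetry into symmetric solutions. -/
lemma IsSol.unique {p p₁ p₂ p₃ q q₁ q₂ q₃ : ℝ → ℝ} (hp : IsSol p p₁ p₂ p₃) (hq : IsSol q q₁ q₂ q₃)
    {t : ℝ} (h0 : p t = q t) (h1 : p₁ t = q₁ t) (h2 : p₂ t = q₂ t) (h3 : p₃ t = q₃ t) : p = q := by
  let v : ℝ → ℝ × ℝ × ℝ × ℝ → ℝ × ℝ × ℝ × ℝ := fun _ x => (x.2.1, x.2.2.1, x.2.2.2, Real.sin x.1)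
  have hv : ∀ t, LipschitzOnWith 1 (v t) univ := fun t => by
    refine (LipschitzWith.of_dist_le_mul fun x y => ?_).lipschitzOnWith
    have h := WeightedPrim.abs_sin_sub_sin_le x.1 y.1
    have h0 : dist x.1 y.1 ≤ dist x y := le_max_left _ _
    have h1 : dist x.2 y.2 ≤ dist x y := le_max_right _ _
    have h2 : dist x.2.1 y.2.1 ≤ dist x.2 y.2 := le_max_left _ _
    have h3 : dist x.2.2 y.2.2 ≤ dist x.2 y.2 := le_max_right _ _
    have h4 : dist x.2.2.1 y.2.2.1 ≤ dist x.2.2 y.2.2 := le_max_left _ _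
    have h5 : dist x.2.2.2 y.2.2.2 ≤ dist x.2.2 y.2.2 := le_max_right _ _
    rw [NNReal.coe_one, one_mul]
    refine max_le (by linarith) (max_le (by linarith) (max_le (by linarith) ?_))
    change dist (Real.sin x.1) (Real.sin y.1) ≤ _
    rw [Real.dist_eq] at h0 ⊢
    linarith
  have := ODE_solution_unique_univ (v := v) (K := 1) (s := fun _ => univ) (t₀ := t)
    (f := fun s => (p s, p₁ s, p₂ s, p₃ s)) (g := fun s => (q s, q₁ s, q₂ s, q₃ s))
    hv (fun s => ⟨(hp.d0 s).prodMk ((hp.d1 s).prodMk ((hp.d2 s).prodMk (hp.d3 s))), trivial⟩)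
    (fun s => ⟨(hq.d0 s).prodMk ((hq.d1 s).prodMk ((hq.d2 s).prodMk (hq.d3 s))), trivial⟩)
    (by simp only [h0, h1, h2, h3])
  funext s
  exact congrArg Prod.fst (congrFun this s)

lemma IsSol.reflect {p p₁ p₂ p₃ : ℝ → ℝ} (hp : IsSol p p₁ p₂ p₃) (c : ℝ) :
    IsSol (fun s => p (c - s)) (fun s => - p₁ (c - s)) (fun s => p₂ (c - s))
      (fun s => - p₃ (c - s)) where
  d0 s := (hp.d0 (c - s)).comp_const_sub c s
  d1 s := ((hp.d1 (c - s)).comp_const_sub c s).neg.congr_deriv (neg_neg _)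
  d2 s := (hp.d2 (c - s)).comp_const_sub c s
  d3 s := ((hp.d3 (c - s)).comp_const_sub c s).neg.congr_deriv (neg_neg _)

lemma IsSol.neg {p p₁ p₂ p₃ : ℝ → ℝ} (hp : IsSol p p₁ p₂ p₃) :
    IsSol (fun s => - p s) (fun s => - p₁ s) (fun s => - p₂ s) (fun s => - p₃ s) where
  d0 s := (hp.d0 s).neg
  d1 s := (hp.d1 s).neg
  d2 s := (hp.d2 s).neg
  d3 s := (hp.d3 s).neg.congr_deriv (Real.sin_neg _).symm

lemma exists_Icc_of_eventually {P : ℝ → Prop} {a : ℝ} (h : ∀ᶠ s in 𝓝 a, P s) :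
    ∃ b > a, ∀ s ∈ Icc a b, P s := by
  obtain ⟨ε, hε, h⟩ := Metric.eventually_nhds_iff.1 h
  refine ⟨a + ε / 2, by linarith, fun s hs => h ?_⟩
  rw [Real.dist_eq, abs_lt]
  constructor <;> linarith [hs.1, hs.2]

/-- The first time at which a positive concave solution reaches zero or stops to be concave. -/
lemma IsSol.exists_first {p p₁ p₂ p₃ : ℝ → ℝ} (hp : IsSol p p₁ p₂ p₃) (h0 : 0 < p 0)
    (h1 : p₁ 0 = 0) (h2 : p₂ 0 < 0) :
    ∃ T > 0, (∀ s ∈ Ico 0 T, 0 < p s ∧ p₂ s < 0) ∧ 0 ≤ p T ∧ p₂ T ≤ 0 ∧ (p T = 0 ∨ p₂ T = 0) := by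
  have c0 : Continuous p := continuous_iff_continuousAt.2 fun s => (hp.d0 s).continuousAt
  have c2 : Continuous p₂ := continuous_iff_continuousAt.2 fun s => (hp.d2 s).continuousAt
  let S : Set ℝ := {t | 0 ≤ t ∧ (p t ≤ 0 ∨ 0 ≤ p₂ t)}
  have hS : IsClosed S := by
    refine isClosed_Ici.inter ((isClosed_le c0 continuous_const).union
      (isClosed_le continuous_const c2))
  have hne : S.Nonempty := by
    by_contra hemp
    have hall : ∀ t, 0 ≤ t → 0 < p t ∧ p₂ t < 0 := fun t ht => by
      by_contra hcon
      refine hemp ⟨t, ht, ?_⟩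
      by_contra hcon2
      push Not at hcon2
      exact hcon hcon2
    have hneg : p₁ 1 < 0 := by
      have := lt_of_deriv_neg hp.d1 zero_lt_one fun s hs => (hall s hs.1.le).2
      linarith
    -- The tangent at time 1 reaches zero at `1 + p 1 / (-p₁ 1)`, and a concave function lies below
    -- it; one more unit of time makes the value negative.
    set b := 1 + p 1 / (- p₁ 1) + 1
    have hq : 0 < p 1 / (- p₁ 1) := div_pos (hall 1 zero_le_one).1 (by linarith)
    have hb : 1 < b := by simp only [b]; linarith
    have hlt := lt_of_deriv_neg (g := fun s => p s - p₁ 1 * s) (g' := fun s => p₁ s - p₁ 1)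
      (fun s => by
        have := (hp.d0 s).sub ((hasDerivAt_id' s).const_mul (p₁ 1))
        exact this.congr_deriv (by ring)) hb (fun s hs => by
        have := lt_of_deriv_neg hp.d1 hs.1 fun r hr => (hall r (by linarith [hr.1])).2
        linarith)
    have hpb := (hall b (by linarith)).1
    have hne : (- p₁ 1) ≠ 0 := by linarith
    have e1 : (b - 2) * (- p₁ 1) = p 1 := by
      have : b - 2 = p 1 / (- p₁ 1) := by simp only [b]; ring
      rw [this, div_mul_cancel₀ _ hne]
    nlinarith
  have hbdd : BddBelow S := ⟨0, fun t ht => ht.1⟩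
  have hT : sInf S ∈ S := hS.csInf_mem hne hbdd
  set T := sInf S
  have hlt : ∀ s ∈ Ico 0 T, 0 < p s ∧ p₂ s < 0 := fun s hs => by
    have hns : s ∉ S := fun h => (csInf_le hbdd h).not_gt hs.2
    by_contra hcon
    refine hns ⟨hs.1, ?_⟩
    by_contra hcon2
    push Not at hcon2
    exact hcon hcon2
  have hT0 : 0 < T := by
    rcases hT.1.lt_or_eq with h | h
    · exact h
    · exfalso
      have := hT.2
      rw [← h] at this
      rcases this with h | h <;> linarith
  have hcl : T ∈ closure (Ico 0 T) := by rw [closure_Ico hT0.ne]; exact right_mem_Icc.2 hT0.le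
  have h3 : 0 ≤ p T := closure_minimal (fun s hs => (hlt s hs).1.le)
    (isClosed_le continuous_const c0) hcl
  have h4 : p₂ T ≤ 0 := closure_minimal (fun s hs => (hlt s hs).2.le)
    (isClosed_le c2 continuous_const) hcl
  refine ⟨T, hT0, hlt, h3, h4, ?_⟩
  rcases hT.2 with h | h
  · exact Or.inl (le_antisymm h h3)
  · exact Or.inr (le_antisymm h4 h)

/-- There is an amplitude `A` for which `ψ` and `ψ''` vanish simultaneously. -/
lemma exists_simultaneous_zero : ∃ (A T : ℝ) (p p₁ p₂ p₃ : ℝ → ℝ), IsSol p p₁ p₂ p₃ ∧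
    0 < A ∧ A < Real.pi / 2 ∧ 0 < T ∧ p 0 = A ∧ p₁ 0 = 0 ∧ p₂ 0 = - √(2 * Real.cos A) ∧ p₃ 0 = 0 ∧
    (∀ s ∈ Ico 0 T, 0 < p s ∧ p₂ s < 0) ∧ p T = 0 ∧ p₂ T = 0 := by
  obtain ⟨p, p₁, p₂, p₃, d0, d1, d2, d3, hin, cp, cp2⟩ :=
    exists_sine_flow (fun A => √(2 * Real.cos A)) (by fun_prop)
  have hsol : ∀ A, IsSol (p A) (p₁ A) (p₂ A) (p₃ A) := fun A => ⟨d0 A, d1 A, d2 A, d3 A⟩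
  have cA : ∀ A, Continuous (p A) := fun A => cp.comp (continuous_const.prodMk continuous_id)
  have cA2 : ∀ A, Continuous (p₂ A) := fun A => cp2.comp (continuous_const.prodMk continuous_id)
  -- `U1` collects the amplitudes for which `ψ` changes sign while still concave, `U2` those for
  -- which concavity is lost while `ψ` is still positive. The closed time intervals make both
  -- conditions open in `A`.
  let U1 : Set ℝ := {A | ∃ t, 0 ≤ t ∧ p A t < 0 ∧ ∀ s ∈ Icc 0 t, p₂ A s < 0}
  let U2 : Set ℝ := {A | ∃ t, 0 ≤ t ∧ 0 < p₂ A t ∧ ∀ s ∈ Icc 0 t, 0 < p A s}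
  have hU1 : IsOpen U1 := by
    rw [isOpen_iff_mem_nhds]
    rintro A ⟨t, ht, h1, h2⟩
    have e1 : ∀ᶠ A' in 𝓝 A, p A' t < 0 :=
      (cp.comp (continuous_id.prodMk continuous_const)).continuousAt.eventually_lt_const h1
    have e2 : ∀ᶠ A' in 𝓝 A, ∀ s ∈ Icc 0 t, p₂ A' s < 0 :=
      isCompact_Icc.eventually_forall_of_forall_eventually fun s hs =>
        cp2.continuousAt.eventually_lt_const (h2 s hs)
    filter_upwards [e1, e2] with A' h1 h2 using ⟨t, ht, h1, h2⟩
  have hU2 : IsOpen U2 := by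
    rw [isOpen_iff_mem_nhds]
    rintro A ⟨t, ht, h1, h2⟩
    have e1 : ∀ᶠ A' in 𝓝 A, 0 < p₂ A' t :=
      (cp2.comp (continuous_id.prodMk continuous_const)).continuousAt.eventually_const_lt h1
    have e2 : ∀ᶠ A' in 𝓝 A, ∀ s ∈ Icc 0 t, 0 < p A' s :=
      isCompact_Icc.eventually_forall_of_forall_eventually fun s hs =>
        cp.continuousAt.eventually_const_lt (h2 s hs)
    filter_upwards [e1, e2] with A' h1 h2 using ⟨t, ht, h1, h2⟩
  have hdisj : ∀ A, A ∈ U1 → A ∈ U2 → False := by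
    rintro A ⟨t, ht, h1, h2⟩ ⟨r, hr, h3, h4⟩
    rcases le_total t r with h | h
    · exact (h4 t ⟨ht, h⟩).not_gt h1
    · exact (h2 r ⟨hr, h⟩).not_gt h3
  have hpi := Real.pi_pos
  have h0 : (0 : ℝ) ∈ U1 := by
    obtain ⟨i0, i1, i2, i3⟩ := hin 0
    have hneg : p₂ 0 0 < 0 := by
      rw [i2, neg_lt_zero]
      exact Real.sqrt_pos.2 (by simp)
    obtain ⟨b, hb, hb2⟩ := exists_Icc_of_eventually ((cA2 0).continuousAt.eventually_lt_const hneg)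
    refine ⟨b, hb.le, ?_, hb2⟩
    have := lt_of_deriv_neg (d0 0) hb fun s hs => by
      have := lt_of_deriv_neg (d1 0) hs.1 fun r hr => hb2 r ⟨hr.1.le, by linarith [hr.2, hs.2]⟩
      linarith
    linarith
  -- Here `ψ''` starts at zero, and `ψ'''' = sin ψ > 0` makes it positive at once.
  have hpi2 : Real.pi / 2 ∈ U2 := by
    obtain ⟨i0, i1, i2, i3⟩ := hin (Real.pi / 2)
    rw [Real.cos_pi_div_two, mul_zero, Real.sqrt_zero, neg_zero] at i2
    have hp0 : 0 < p (Real.pi / 2) 0 := by rw [i0]; positivity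
    have hp1 : p (Real.pi / 2) 0 < Real.pi := by rw [i0]; linarith
    obtain ⟨b, hb, hb2⟩ := exists_Icc_of_eventually
      (((cA _).continuousAt.eventually_const_lt hp0).and
        ((cA _).continuousAt.eventually_lt_const hp1))
    refine ⟨b, hb.le, ?_, fun s hs => (hb2 s hs).1⟩
    have := lt_of_deriv_pos (d2 (Real.pi / 2)) hb fun s hs => by
      have := lt_of_deriv_pos (d3 (Real.pi / 2)) hs.1 fun r hr => by
        have := hb2 r ⟨hr.1.le, by linarith [hr.2, hs.2]⟩
        exact Real.sin_pos_of_pos_of_lt_pi this.1 this.2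
      linarith
    linarith
  -- The interval is connected, and its ends lie in disjoint open sets, so some amplitude lies in
  -- neither.
  obtain ⟨A, hA, hA1, hA2⟩ : ∃ A ∈ Icc 0 (Real.pi / 2), A ∉ U1 ∧ A ∉ U2 := by
    by_contra hcon
    push Not at hcon
    obtain ⟨A, -, hA⟩ := (isPreconnected_Icc (a := (0 : ℝ)) (b := Real.pi / 2)) U1 U2 hU1 hU2
      (fun A hA => by
        by_cases h : A ∈ U1
        · exact Or.inl h
        · exact Or.inr (hcon A hA h))
      ⟨0, left_mem_Icc.2 (by positivity), h0⟩ ⟨_, right_mem_Icc.2 (by positivity), hpi2⟩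
    exact hdisj A hA.1 hA.2
  have hApos : 0 < A := hA.1.lt_of_ne fun h => hA1 (h ▸ h0)
  have hAlt : A < Real.pi / 2 := hA.2.lt_of_ne fun h => hA2 (h ▸ hpi2)
  obtain ⟨i0, i1, i2, i3⟩ := hin A
  have hcos : 0 < Real.cos A := Real.cos_pos_of_mem_Ioo ⟨by linarith, hAlt⟩
  have hneg : p₂ A 0 < 0 := by
    rw [i2, neg_lt_zero]
    exact Real.sqrt_pos.2 (by positivity)
  obtain ⟨T, hT, hlt, hT0, hT2, hor⟩ := (hsol A).exists_first (by rwa [i0]) i1 hneg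
  have hp1 : ∀ s, 0 < s → s ≤ T → p₁ A s < 0 := fun s hs hsT => by
    have := lt_of_deriv_neg (d1 A) hs fun r hr => (hlt r ⟨hr.1.le, by linarith [hr.2]⟩).2
    linarith
  have hple : ∀ s ∈ Ioo 0 T, p A s < A := fun s hs => by
    have := lt_of_deriv_neg (d0 A) hs.1 fun r hr => hp1 r hr.1 (by linarith [hr.2, hs.2])
    linarith
  -- Otherwise `ψ` would be zero and still concave at `T`, hence negative just after it: `A ∈ U1`.
  have hTz : p₂ A T = 0 := by
    by_contra hne
    have hneg : p₂ A T < 0 := lt_of_le_of_ne hT2 hne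
    have hpT : p A T = 0 := hor.resolve_right hne
    obtain ⟨b, hb, hb2⟩ := exists_Icc_of_eventually ((cA2 A).continuousAt.eventually_lt_const hneg)
    have hall : ∀ s ∈ Icc 0 b, p₂ A s < 0 := fun s hs => by
      rcases lt_or_ge s T with h | h
      · exact (hlt s ⟨hs.1, h⟩).2
      · exact hb2 s ⟨h, hs.2⟩
    refine hA1 ⟨b, by linarith, ?_, hall⟩
    have := lt_of_deriv_neg (d0 A) hb fun s hs => by
      have := lt_of_deriv_neg (d1 A) hs.1 fun r hr => hb2 r ⟨hr.1.le, by linarith [hr.2, hs.2]⟩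
      linarith [hp1 T hT le_rfl]
    linarith
  -- Otherwise `ψ'''(T) > 0`, because `sin ψ > 0` before `T`, so `ψ''` would become positive while
  -- `ψ > 0`: `A ∈ U2`.
  have hTz0 : p A T = 0 := by
    by_contra hne
    have hpos : 0 < p A T := lt_of_le_of_ne hT0 (Ne.symm hne)
    have h3 : 0 < p₃ A T := by
      have := lt_of_deriv_pos (d3 A) hT fun r hr =>
        Real.sin_pos_of_pos_of_lt_pi (hlt r ⟨hr.1.le, hr.2⟩).1 (by linarith [hple r hr])
      linarith
    have c3 : ContinuousAt (p₃ A) T := (d3 A T).continuousAt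
    obtain ⟨b, hb, hb2⟩ := exists_Icc_of_eventually
      (((cA A).continuousAt.eventually_const_lt hpos).and (c3.eventually_const_lt h3))
    refine hA2 ⟨b, by linarith, ?_, fun s hs => ?_⟩
    · have := lt_of_deriv_pos (d2 A) hb fun r hr => (hb2 r ⟨hr.1.le, hr.2.le⟩).2
      linarith
    · rcases lt_or_ge s T with h | h
      · exact (hlt s ⟨hs.1, h⟩).1
      · exact (hb2 s ⟨h, hs.2⟩).1
  exact ⟨A, T, p A, p₁ A, p₂ A, p₃ A, hsol A, hApos, hAlt, hT, i0, i1, i2, i3, hlt, hTz0, hTz⟩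

end SineFlow

open SineFlow in
/-- There is a nontrivial odd periodic solution of `u'''' = f sin u` with zero energy, which is
the tangent angle of an infinitely long critical point of the ideal energy. -/
theorem exists_zero_energy_profile : ∃ (f : ℝ) (u u₁ u₂ u₃ : ℝ → ℝ), 0 < f ∧
    (∀ x, HasDerivAt u (u₁ x) x) ∧ (∀ x, HasDerivAt u₁ (u₂ x) x) ∧
    (∀ x, HasDerivAt u₂ (u₃ x) x) ∧ (∀ x, HasDerivAt u₃ (f * Real.sin (u x)) x) ∧
    Function.Periodic u 1 ∧ (∀ x, u (-x) = - u x) ∧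
    (∀ x ∈ Ioo (0 : ℝ) (1 / 2), 0 < u x ∧ u x ≤ Real.pi / 2) ∧ 0 < u₁ 0 ∧
    ∀ x, u₁ x * u₃ x - u₂ x ^ 2 / 2 + f * Real.cos (u x) = 0 := by
  obtain ⟨A, T, p, p₁, p₂, p₃, hp, hA, hA2, hT, i0, i1, i2, i3, hlt, hT0, hT2⟩ :=
    exists_simultaneous_zero
  -- The odd derivatives vanish at `0` and the even ones at `T`, so `ψ` is even about `0` and odd
  -- about `T`; the composition of the two reflections gives antiperiod `2T`.
  have heven : ∀ s, p (-s) = p s := fun s => by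
    have := (hp.reflect 0).unique hp (t := 0) (by simp) (by simp [i1]) (by simp) (by simp [i3])
    simpa using congrFun this s
  have hodd : ∀ s, p (2 * T - s) = - p s := fun s => by
    have e : 2 * T - T = T := by ring
    have := (hp.reflect (2 * T)).unique hp.neg (t := T) (by simp [e, hT0]) (by simp [e])
      (by simp [e, hT2]) (by simp [e])
    exact congrFun this s
  have hanti : ∀ s, p (s + 2 * T) = - p s := fun s => by
    rw [← heven s, ← hodd (-s)]
    congr 1
    ring
  have hp1 : ∀ s, 0 < s → s ≤ T → p₁ s < 0 := fun s hs hsT => by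
    have := lt_of_deriv_neg hp.d1 hs fun r hr => (hlt r ⟨hr.1.le, by linarith [hr.2]⟩).2
    linarith
  have hple : ∀ s ∈ Ico 0 T, p s ≤ A := fun s hs => by
    rcases hs.1.lt_or_eq with h | h
    · have := lt_of_deriv_neg hp.d0 h fun r hr => hp1 r hr.1 (by linarith [hr.2, hs.2])
      linarith
    · rw [← h, i0]
  have hp1odd : p₁ (-T) = - p₁ T := by
    have h1 := (hp.reflect 0).d0 T
    have h2 : (fun s => p (0 - s)) = p := funext fun s => by rw [zero_sub, heven]
    rw [h2, zero_sub] at h1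
    linarith [h1.unique (hp.d0 T)]
  have hE : ∀ s, p₁ s * p₃ s - p₂ s ^ 2 / 2 + Real.cos (p s) = 0 := fun s => by
    have hd : ∀ s, HasDerivAt (fun s => p₁ s * p₃ s - p₂ s ^ 2 / 2 + Real.cos (p s)) 0 s :=
      fun s => by
        have := (((hp.d1 s).mul (hp.d3 s)).sub (((hp.d2 s).fun_pow 2).div_const 2)).add (hp.d0 s).cos
        exact this.congr_deriv (by push_cast; ring)
    -- The energy is conserved, and the choice `ψ''(0)² = 2 cos A` makes it vanish at time `0`.
    rw [CircleFun.eq_of_hasDerivAt_zero hd s 0, i0, i1, i2, i3, neg_sq, Real.sq_sqrt]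
    · ring
    · have := Real.cos_nonneg_of_mem_Icc (x := A) ⟨by linarith [Real.pi_pos], hA2.le⟩
      positivity
  -- The period `4T` is scaled to 1, which gives `f = (4T)⁴`; the shift by `T` moves the zero of `ψ`
  -- at `-T` to the origin, so that `u` is odd and increasing there.
  set c := 4 * T with hc
  have hsc : ∀ (g g' : ℝ → ℝ) (n : ℕ), (∀ s, HasDerivAt g (g' s) s) → ∀ x,
      HasDerivAt (fun x => c ^ n * g (c * x - T)) (c ^ (n + 1) * g' (c * x - T)) x :=
    fun g g' n hg x => by
      have h1 : HasDerivAt (fun x => c * x - T) c x :=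
        (((hasDerivAt_id' x).const_mul c).sub_const T).congr_deriv (by ring)
      have h2 := ((hg (c * x - T)).comp x h1).const_mul (c ^ n)
      exact h2.congr_deriv (by ring)
  refine ⟨c ^ 4, fun x => c ^ 0 * p (c * x - T), fun x => c ^ 1 * p₁ (c * x - T),
    fun x => c ^ 2 * p₂ (c * x - T), fun x => c ^ 3 * p₃ (c * x - T), by positivity,
    hsc _ _ 0 hp.d0, hsc _ _ 1 hp.d1, hsc _ _ 2 hp.d2, ?_, ?_, ?_, ?_, ?_, ?_⟩
  · intro x
    have := hsc _ _ 3 hp.d3 x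
    simpa using this
  · intro x
    have : c * (x + 1) - T = (c * x - T + 2 * T) + 2 * T := by simp only [c]; ring
    simp only [this, hanti, neg_neg]
  · intro x
    have : c * x - T = - (c * -x - T + 2 * T) := by ring
    beta_reduce
    rw [this, heven, hanti]
    ring
  · intro x hx
    have key : ∀ s ∈ Ico 0 T, 0 < p s ∧ p s ≤ Real.pi / 2 := fun s hs =>
      ⟨(hlt s hs).1, by linarith [hple s hs]⟩
    beta_reduce
    rw [pow_zero, one_mul]
    rcases le_total 0 (c * x - T) with h | h
    · exact key _ ⟨h, by simp only [c]; nlinarith [hx.2]⟩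
    · rw [← heven]
      exact key _ ⟨by linarith, by simp only [c]; nlinarith [hx.1]⟩
  · have : c * 0 - T = -T := by ring
    beta_reduce
    rw [this, hp1odd]
    have := hp1 T hT le_rfl
    have : 0 < - p₁ T := by linarith
    positivity
  · intro x
    have := hE (c * x - T)
    beta_reduce
    rw [pow_zero, one_mul]
    linear_combination c ^ 4 * this

/-! ### Odd functions, positivity of `∂⁻⁴`, and the profile on the circle. -/

namespace CircleFun

/-- Odd functions on the circle. -/
def IsOdd (w : C(UnitAddCircle, ℝ)) : Prop := refl w = -w

/-- The projection to the odd functions. -/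
def odd : C(UnitAddCircle, ℝ) →L[ℝ] C(UnitAddCircle, ℝ) :=
  (1 / 2 : ℝ) • (ContinuousLinearMap.id ℝ _ - refl)

lemma odd_apply (w : C(UnitAddCircle, ℝ)) : odd w = (1 / 2 : ℝ) • (w - refl w) := rfl

lemma isOdd_odd (w : C(UnitAddCircle, ℝ)) : IsOdd (odd w) := by
  rw [IsOdd, odd_apply, map_smul, map_sub, refl_refl, ← smul_neg, neg_sub]

lemma IsOdd.odd_eq {w : C(UnitAddCircle, ℝ)} (h : IsOdd w) : odd w = w := by
  rw [odd_apply, h, sub_neg_eq_add, ← two_smul ℝ w, smul_smul]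
  norm_num

lemma IsOdd.apply_neg {w : C(UnitAddCircle, ℝ)} (h : IsOdd w) (x : UnitAddCircle) :
    w (-x) = - w x := by
  have := congrArg (fun g : C(UnitAddCircle, ℝ) => g x) h
  simpa using this

lemma isOdd_of_real {w : C(UnitAddCircle, ℝ)}
    (h : ∀ s : ℝ, w ((-s : ℝ) : UnitAddCircle) = - w (s : UnitAddCircle)) : IsOdd w :=
  ext_real fun s => by
    have := h s
    rw [AddCircle.coe_neg] at this
    simpa using this

lemma IsOdd.add {a b : C(UnitAddCircle, ℝ)} (ha : IsOdd a) (hb : IsOdd b) : IsOdd (a + b) := by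
  rw [IsOdd, map_add, ha, hb]; abel

lemma IsOdd.sub {a b : C(UnitAddCircle, ℝ)} (ha : IsOdd a) (hb : IsOdd b) : IsOdd (a - b) := by
  rw [IsOdd, map_sub, ha, hb]; abel

lemma IsOdd.neg {a : C(UnitAddCircle, ℝ)} (ha : IsOdd a) : IsOdd (-a) := by
  rw [IsOdd, map_neg, ha]

lemma IsOdd.smul {a : C(UnitAddCircle, ℝ)} (ha : IsOdd a) (c : ℝ) : IsOdd (c • a) := by
  rw [IsOdd, map_smul, ha, smul_neg]

lemma IsOdd.mean_eq_zero {w : C(UnitAddCircle, ℝ)} (h : IsOdd w) : mean w = 0 := by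
  have := mean_refl w
  rw [h, map_neg] at this
  linarith

lemma IsOdd.apply_zero {w : C(UnitAddCircle, ℝ)} (h : IsOdd w) : w ((0 : ℝ) : UnitAddCircle) = 0 := by
  have := h.apply_neg ((0 : ℝ) : UnitAddCircle)
  rw [← AddCircle.coe_neg, neg_zero] at this
  linarith

lemma coe_neg_half : ((-(1 / 2) : ℝ) : UnitAddCircle) = ((1 / 2 : ℝ) : UnitAddCircle) := by
  rw [← coe_add_one]
  norm_num

lemma IsOdd.apply_half {w : C(UnitAddCircle, ℝ)} (h : IsOdd w) :
    w ((1 / 2 : ℝ) : UnitAddCircle) = 0 := by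
  have := h.apply_neg ((1 / 2 : ℝ) : UnitAddCircle)
  rw [← AddCircle.coe_neg, coe_neg_half] at this
  linarith

lemma IsOdd.prim_prim {w : C(UnitAddCircle, ℝ)} (h : IsOdd w) : IsOdd (prim (prim w)) := by
  have h2 : refl (prim (prim w)) = prim (prim (refl w)) := by
    rw [prim_refl, map_neg, prim_refl, neg_neg]
  rw [IsOdd, h2, h, map_neg, map_neg]

/-- The inverse of `∂⁴` on functions of mean zero. -/
def prim4 : C(UnitAddCircle, ℝ) →L[ℝ] C(UnitAddCircle, ℝ) := prim ∘L prim ∘L prim ∘L prim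

lemma prim4_apply (w : C(UnitAddCircle, ℝ)) : prim4 w = prim (prim (prim (prim w))) := rfl

lemma IsOdd.prim4 {w : C(UnitAddCircle, ℝ)} (h : IsOdd w) : IsOdd (prim4 w) :=
  h.prim_prim.prim_prim

/-- Four integrations by parts; the signs cancel. -/
lemma mean_mul_prim4 (a b : C(UnitAddCircle, ℝ)) : mean (a * prim4 b) = mean (prim4 a * b) := by
  simp only [prim4_apply, mean_mul_prim, neg_neg]

/-- An odd function that is nonnegative on the half period `[0, 1/2]`. -/
def HalfNonneg (w : C(UnitAddCircle, ℝ)) : Prop :=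
  ∀ s ∈ Icc (0 : ℝ) (1 / 2), 0 ≤ w (s : UnitAddCircle)

/-- The double antiderivative is convex on `[0, 1/2]` and, being odd and periodic, vanishes at both
ends. Oddness plays the part of a Dirichlet condition, and applying this twice gives positivity of
`∂⁻⁴`. -/
lemma IsOdd.prim_prim_nonpos {w : C(UnitAddCircle, ℝ)} (h : IsOdd w) (hw : HalfNonneg w) :
    HalfNonneg (-prim (prim w)) := by
  intro s hs
  have d1 : ∀ s : ℝ, HasDerivAt (fun s : ℝ => prim (prim w) (s : UnitAddCircle))
      (prim w (s : UnitAddCircle)) s := fun s => by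
    simpa using hasDerivAt_prim (prim w) s
  have d2 : ∀ s : ℝ, HasDerivAt (fun s : ℝ => prim w (s : UnitAddCircle))
      (w (s : UnitAddCircle)) s := fun s => by
    simpa [h.mean_eq_zero] using hasDerivAt_prim w s
  have hder : deriv (fun s : ℝ => prim (prim w) (s : UnitAddCircle)) =
      fun s : ℝ => prim w (s : UnitAddCircle) := funext fun s => (d1 s).deriv
  have hmono : MonotoneOn (fun s : ℝ => prim w (s : UnitAddCircle)) (interior (Icc 0 (1 / 2))) := by
    refine (monotoneOn_of_deriv_nonneg (convex_Icc 0 (1 / 2)) (continuous_coe _).continuousOn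
      (fun x _ => (d2 x).differentiableAt.differentiableWithinAt) fun x hx => ?_).mono
        interior_subset
    rw [(d2 x).deriv]
    exact hw x (interior_subset hx)
  have hconv : ConvexOn ℝ (Icc 0 (1 / 2)) (fun s : ℝ => prim (prim w) (s : UnitAddCircle)) := by
    refine MonotoneOn.convexOn_of_deriv (convex_Icc _ _) (continuous_coe _).continuousOn
      (fun x _ => (d1 x).differentiableAt.differentiableWithinAt) ?_
    rw [hder]
    exact hmono
  have hle := hconv.le_max_of_mem_Icc (left_mem_Icc.2 (by norm_num))
    (right_mem_Icc.2 (by norm_num)) hs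
  have h0 := h.prim_prim.apply_zero
  have h1 := h.prim_prim.apply_half
  rw [h0, h1, max_self] at hle
  rw [ContinuousMap.neg_apply]
  linarith

lemma IsOdd.halfNonneg_prim4 {w : C(UnitAddCircle, ℝ)} (h : IsOdd w) (hw : HalfNonneg w) :
    HalfNonneg (CircleFun.prim4 w) := by
  have := h.prim_prim.neg.prim_prim_nonpos (h.prim_prim_nonpos hw)
  simpa [prim4_apply] using this

/-- The odd continuation from the half period replaces the pointwise composition, which need not be
odd. It supplies absolute values and negative parts inside the space of odd functions. -/
lemma exists_odd_comp (φ : ℝ → ℝ) (hφ : Continuous φ) (h0 : φ 0 = 0) {h : C(UnitAddCircle, ℝ)}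
    (hh : IsOdd h) : ∃ z : C(UnitAddCircle, ℝ), IsOdd z ∧
      ∀ s ∈ Icc (0 : ℝ) (1 / 2), z (s : UnitAddCircle) = φ (h (s : UnitAddCircle)) := by
  let g : ℝ → ℝ := fun s => if s ≤ 0 then - φ (h ((-s : ℝ) : UnitAddCircle)) else
    φ (h (s : UnitAddCircle))
  have hg : Continuous g := by
    refine Continuous.if_le ?_ ?_ continuous_id continuous_const ?_
    · exact (hφ.comp ((continuous_coe h).comp continuous_neg)).neg
    · exact hφ.comp (continuous_coe h)
    · rintro s hs
      rw [hs, neg_zero, hh.apply_zero, h0, neg_zero]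
  have hend : g (-(1 / 2)) = g (-(1 / 2) + 1) := by
    have e : (-(1 / 2) + 1 : ℝ) = 1 / 2 := by norm_num
    rw [e]
    simp only [g]
    rw [if_pos (by norm_num), if_neg (by norm_num), neg_neg, hh.apply_half, h0, neg_zero]
  let z : C(UnitAddCircle, ℝ) := ⟨AddCircle.liftIco 1 (-(1 / 2)) g,
    AddCircle.liftIco_continuous hend hg.continuousOn⟩
  have hz : ∀ s ∈ Icc (-(1 / 2) : ℝ) (1 / 2), z (s : UnitAddCircle) = g s := fun s hs => by
    have e : (-(1 / 2) + 1 : ℝ) = 1 / 2 := by norm_num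
    rcases hs.2.lt_or_eq with h | h
    · have hm : s ∈ Ico (-(1 / 2) : ℝ) (-(1 / 2) + 1) := ⟨hs.1, by rwa [e]⟩
      exact AddCircle.liftIco_coe_apply (f := g) hm
    · have hm : (-(1 / 2) : ℝ) ∈ Ico (-(1 / 2) : ℝ) (-(1 / 2) + 1) := ⟨le_rfl, by norm_num⟩
      rw [h, ← coe_neg_half]
      rw [e] at hend
      rw [← hend]
      exact AddCircle.liftIco_coe_apply (f := g) hm
  have hval : ∀ s ∈ Icc (0 : ℝ) (1 / 2), z (s : UnitAddCircle) = φ (h (s : UnitAddCircle)) :=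
    fun s hs => by
      rw [hz s ⟨by linarith [hs.1], hs.2⟩]
      rcases hs.1.lt_or_eq with h' | h'
      · simp only [g]
        rw [if_neg (by linarith)]
      · rw [← h']
        simp only [g]
        rw [if_pos le_rfl, neg_zero, hh.apply_zero, h0, neg_zero]
  have hneg : ∀ s ∈ Icc (0 : ℝ) (1 / 2), z ((-s : ℝ) : UnitAddCircle) = - z (s : UnitAddCircle) :=
    fun s hs => by
      rw [hval s hs, hz (-s) ⟨by linarith [hs.2], by linarith [hs.1]⟩]
      simp only [g]
      rw [if_pos (by linarith [hs.1]), neg_neg]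
  refine ⟨z, ?_, hval⟩
  refine ContinuousMap.ext fun x => ?_
  obtain ⟨s, hs, rfl⟩ : x ∈ ((↑) : ℝ → UnitAddCircle) '' Icc (-(1 / 2)) (-(1 / 2) + 1) := by
    rw [AddCircle.coe_image_Icc_eq]; trivial
  have e : (-(1 / 2) + 1 : ℝ) = 1 / 2 := by norm_num
  rw [e] at hs
  rw [refl_apply, ContinuousMap.neg_apply, ← AddCircle.coe_neg]
  rcases le_total 0 s with h' | h'
  · exact hneg s ⟨h', hs.2⟩
  · have := hneg (-s) ⟨by linarith, by linarith [hs.1]⟩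
    rw [neg_neg] at this
    linarith

lemma nonneg_of_half {w : C(UnitAddCircle, ℝ)} (he : ∀ x, w (-x) = w x) (hw : HalfNonneg w)
    (x : UnitAddCircle) : 0 ≤ w x := by
  obtain ⟨s, hs, rfl⟩ : x ∈ ((↑) : ℝ → UnitAddCircle) '' Icc (-(1 / 2)) (-(1 / 2) + 1) := by
    rw [AddCircle.coe_image_Icc_eq]; trivial
  have e : (-(1 / 2) + 1 : ℝ) = 1 / 2 := by norm_num
  rw [e] at hs
  rcases le_total 0 s with h' | h'
  · exact hw s ⟨h', hs.2⟩
  · rw [← he, ← AddCircle.coe_neg]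
    exact hw (-s) ⟨by linarith, by linarith [hs.1]⟩

lemma mean_nonneg {w : C(UnitAddCircle, ℝ)} (hw : ∀ x, 0 ≤ w x) : 0 ≤ mean w :=
  intervalIntegral.integral_nonneg zero_le_one fun s _ => hw s

lemma mean_pos {w : C(UnitAddCircle, ℝ)} (hw : ∀ x, 0 ≤ w x) {x : UnitAddCircle} (hx : 0 < w x) :
    0 < mean w := by
  obtain ⟨s, hs, rfl⟩ := AddCircle.eq_coe_Ico x
  exact intervalIntegral.integral_pos zero_lt_one (continuous_coe w).continuousOn
    (fun s _ => hw s) ⟨s, ⟨hs.1, hs.2.le⟩, hx⟩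

/-- The sine of a function on the circle. -/
def sinC (u : C(UnitAddCircle, ℝ)) : C(UnitAddCircle, ℝ) := ⟨fun x => Real.sin (u x), by fun_prop⟩

/-- The cosine of a function on the circle. -/
def cosC (u : C(UnitAddCircle, ℝ)) : C(UnitAddCircle, ℝ) := ⟨fun x => Real.cos (u x), by fun_prop⟩

@[simp] lemma sinC_apply (u : C(UnitAddCircle, ℝ)) (x : UnitAddCircle) :
    sinC u x = Real.sin (u x) := rfl

@[simp] lemma cosC_apply (u : C(UnitAddCircle, ℝ)) (x : UnitAddCircle) :
    cosC u x = Real.cos (u x) := rfl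

lemma IsOdd.sinC {u : C(UnitAddCircle, ℝ)} (h : IsOdd u) : IsOdd (sinC u) := by
  ext x
  simp [h.apply_neg]

lemma IsOdd.cosC_mul {u w : C(UnitAddCircle, ℝ)} (h : IsOdd u) (hw : IsOdd w) :
    IsOdd (cosC u * w) := by
  ext x
  simp [h.apply_neg, hw.apply_neg]

/-- An odd solution of `u'''' = f sin u` with values in `(0, π/2]` on the half period and with
zero energy. -/
structure IsProfile (f : ℝ) (u : C(UnitAddCircle, ℝ)) : Prop where
  pos : 0 < f
  isOdd : IsOdd u
  eq_prim4 : u = prim4 (f • sinC u)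
  bound : ∀ s ∈ Ioo (0 : ℝ) (1 / 2), 0 < u (s : UnitAddCircle) ∧ u (s : UnitAddCircle) ≤ Real.pi / 2
  energy : mean (cosC u) = 3 / 2 * mean (u * sinC u)
  slope : 0 < prim (prim (prim (f • sinC u))) ((0 : ℝ) : UnitAddCircle)

theorem exists_isProfile : ∃ f u, IsProfile f u := by
  obtain ⟨f, u, u₁, u₂, u₃, hf, d0, d1, d2, d3, hper, hodd, hb, hs, hE⟩ :=
    exists_zero_energy_profile
  have hcont : ∀ {g g' : ℝ → ℝ}, (∀ x, HasDerivAt g (g' x) x) → Continuous g := fun h =>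
    continuous_iff_continuousAt.2 fun s => (h s).continuousAt
  have hperd : ∀ {g g' : ℝ → ℝ}, (∀ x, HasDerivAt g (g' x) x) → Function.Periodic g 1 →
      Function.Periodic g' 1 := fun {g g'} h hp x => by
    have h1 := (h (x + 1)).comp_add_const x 1
    have h2 : (fun x => g (x + 1)) = g := funext hp
    rw [h2] at h1
    exact h1.unique (h x)
  have p1 := hperd d0 hper
  have p2 := hperd d1 p1
  have p3 := hperd d2 p2
  let U := ofPeriodic u (hcont d0) hper
  let U1 := ofPeriodic u₁ (hcont d1) p1
  let U2 := ofPeriodic u₂ (hcont d2) p2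
  let U3 := ofPeriodic u₃ (hcont d3) p3
  have hU : IsOdd U := isOdd_of_real hodd
  have e0 : prim U1 = U := by
    rw [prim_eq_of_hasDerivAt (z := U) (w := U1) d0, hU.mean_eq_zero]
    ext x; simp
  have e1 : prim U2 = U1 := by
    rw [prim_eq_of_hasDerivAt (z := U1) (w := U2) d1,
      mean_eq_zero_of_hasDerivAt (z := U) (w := U1) d0]
    ext x; simp
  have e2 : prim U3 = U2 := by
    rw [prim_eq_of_hasDerivAt (z := U2) (w := U3) d2,
      mean_eq_zero_of_hasDerivAt (z := U1) (w := U2) d1]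
    ext x; simp
  have e3 : prim (f • sinC U) = U3 := by
    rw [prim_eq_of_hasDerivAt (z := U3) (w := f • sinC U) d3,
      mean_eq_zero_of_hasDerivAt (z := U2) (w := U3) d2]
    ext x; simp
  refine ⟨f, U, hf, hU, ?_, hb, ?_, ?_⟩
  · rw [prim4_apply, e3, e2, e1, e0]
  · have h1 : U1 * U3 - (1 / 2 : ℝ) • (U2 * U2) + f • cosC U = 0 := by
      refine ext_real fun x => ?_
      have := hE x
      simp only [U, U1, U2, U3, ContinuousMap.add_apply, ContinuousMap.sub_apply,
        ContinuousMap.mul_apply, ContinuousMap.smul_apply, ofPeriodic_coe, cosC_apply,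
        ContinuousMap.zero_apply, smul_eq_mul]
      linarith
    have h2 : mean (U1 * U3) = - mean (U2 * U2) := by
      have := mean_mul_prim U3 U2
      rw [e1, e2, mul_comm] at this
      exact this
    have h3 : mean (U2 * U2) = f * mean (U * sinC U) := by
      have := mean_mul_prim U2 U3
      rw [e2, e1] at this
      have h' := mean_mul_prim U1 (f • sinC U)
      rw [e3, e0, mul_smul_comm, map_smul, smul_eq_mul] at h'
      rw [this, h', neg_neg]
    have h4 := congrArg mean h1
    rw [map_add, map_sub, map_smul, map_smul, h2, h3, map_zero, smul_eq_mul, smul_eq_mul] at h4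
    have h5 : f * mean (cosC U) = f * (3 / 2 * mean (U * sinC U)) := by linarith
    exact mul_left_cancel₀ hf.ne' h5
  · rw [e3, e2, e1]
    exact hs

end CircleFun

/-! ### Nondegeneracy of the profile. -/

namespace CircleFun

/-- This is `x < tan x`. It makes the profile a strict supersolution of its own linearization. -/
lemma sub_mul_cos_pos {x : ℝ} (h0 : 0 < x) (h1 : x ≤ Real.pi / 2) : 0 < Real.sin x - x * Real.cos x := by
  rcases h1.lt_or_eq with h | h
  · have hc : 0 < Real.cos x := Real.cos_pos_of_mem_Ioo ⟨by linarith, h⟩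
    have ht := Real.lt_tan h0 h
    rw [Real.tan_eq_sin_div_cos, lt_div_iff₀ hc] at ht
    linarith
  · rw [h, Real.sin_pi_div_two, Real.cos_pi_div_two]
    norm_num

section Profile

variable {f : ℝ} {u : C(UnitAddCircle, ℝ)}

lemma IsProfile.cos_nonneg (h : IsProfile f u) {s : ℝ} (hs : s ∈ Icc (0 : ℝ) (1 / 2)) :
    0 ≤ Real.cos (u (s : UnitAddCircle)) := by
  have hpi := Real.pi_pos
  rcases hs.1.lt_or_eq with h0 | h0
  · rcases hs.2.lt_or_eq with h1 | h1
    · have := h.bound s ⟨h0, h1⟩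
      exact Real.cos_nonneg_of_mem_Icc ⟨by linarith, this.2⟩
    · rw [h1, h.isOdd.apply_half, Real.cos_zero]; exact zero_le_one
  · rw [← h0, h.isOdd.apply_zero, Real.cos_zero]; exact zero_le_one

/-- The linearization `w ↦ ∂⁻⁴ (f cos u · w)`. -/
def linT (f : ℝ) (u : C(UnitAddCircle, ℝ)) (w : C(UnitAddCircle, ℝ)) : C(UnitAddCircle, ℝ) :=
  prim4 (f • (cosC u * w))

lemma linT_add (w z : C(UnitAddCircle, ℝ)) : linT f u (w + z) = linT f u w + linT f u z := by
  rw [linT, mul_add, smul_add, map_add]; rfl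

lemma linT_neg (w : C(UnitAddCircle, ℝ)) : linT f u (-w) = - linT f u w := by
  rw [linT, mul_neg, smul_neg, map_neg]; rfl

lemma linT_sub (w z : C(UnitAddCircle, ℝ)) : linT f u (w - z) = linT f u w - linT f u z := by
  rw [sub_eq_add_neg, linT_add, linT_neg, ← sub_eq_add_neg]

lemma IsProfile.halfNonneg_linT (h : IsProfile f u) {w : C(UnitAddCircle, ℝ)} (hw : IsOdd w)
    (hn : HalfNonneg w) : HalfNonneg (linT f u w) := by
  refine ((h.isOdd.cosC_mul hw).smul f).halfNonneg_prim4 fun s hs => ?_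
  have := h.cos_nonneg hs
  have := hn s hs
  have := h.pos
  rw [ContinuousMap.smul_apply, ContinuousMap.mul_apply, cosC_apply, smul_eq_mul]
  positivity

/-- Comparison with the strict supersolution `u` of the linearized equation. -/
lemma IsProfile.eq_zero_of_le (h : IsProfile f u) {z : C(UnitAddCircle, ℝ)} (hz : IsOdd z)
    (hn : HalfNonneg z) (hle : HalfNonneg (linT f u z - z)) : z = 0 := by
  have hf := h.pos
  have hpi := Real.pi_pos
  have hsin : ∀ s ∈ Icc (0 : ℝ) (1 / 2), 0 ≤ Real.sin (u (s : UnitAddCircle)) := fun s hs => by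
    rcases hs.1.lt_or_eq with h0 | h0
    · rcases hs.2.lt_or_eq with h1 | h1
      · have := h.bound s ⟨h0, h1⟩
        exact Real.sin_nonneg_of_nonneg_of_le_pi this.1.le (by linarith)
      · rw [h1, h.isOdd.apply_half, Real.sin_zero]
    · rw [← h0, h.isOdd.apply_zero, Real.sin_zero]
  -- The inequality `z ≤ linT z` is tested with `sin u`. By self-adjointness of `∂⁻⁴` and `u = ∂⁻⁴(f
  -- sin u)` it becomes `mean ((sin u - u cos u) z) ≤ 0`, although the integrand is nonnegative.
  have h1 : 0 ≤ mean (sinC u * (linT f u z - z)) := by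
    refine mean_nonneg (nonneg_of_half (fun x => ?_) fun s hs => ?_)
    · have e := ((h.isOdd.cosC_mul hz).smul f).prim4.apply_neg x
      change linT f u z (-x) = - linT f u z x at e
      simp [h.isOdd.apply_neg, hz.apply_neg, e]
      ring
    · exact mul_nonneg (hsin s hs) (hle s hs)
  have h2 : f * mean (sinC u * linT f u z) = f * mean (u * (cosC u * z)) := by
    have h3 := mean_mul_prim4 (f • sinC u) (f • (cosC u * z))
    rw [← h.eq_prim4] at h3
    change mean (f • sinC u * linT f u z) = _ at h3
    rw [smul_mul_assoc, map_smul, mul_smul_comm, map_smul] at h3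
    exact h3
  have h2' := mul_left_cancel₀ hf.ne' h2
  set D := sinC u * z - u * (cosC u * z) with hD
  have h4 : mean D ≤ 0 := by
    rw [mul_sub, map_sub, h2'] at h1
    rw [hD, map_sub]
    linarith
  have hDval : ∀ x, D x = (Real.sin (u x) - u x * Real.cos (u x)) * z x := fun x => by
    simp [hD]; ring
  have hDn : ∀ x, 0 ≤ D x := by
    refine nonneg_of_half (fun x => ?_) fun s hs => ?_
    · simp [hDval, h.isOdd.apply_neg, hz.apply_neg]; ring
    · rw [hDval]
      refine mul_nonneg ?_ (hn s hs)
      rcases hs.1.lt_or_eq with h0 | h0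
      · rcases hs.2.lt_or_eq with h1 | h1
        · have := h.bound s ⟨h0, h1⟩
          exact (sub_mul_cos_pos this.1 this.2).le
        · rw [h1, h.isOdd.apply_half]; simp
      · rw [← h0, h.isOdd.apply_zero]; simp
  have hzero : ∀ s ∈ Icc (0 : ℝ) (1 / 2), z (s : UnitAddCircle) = 0 := fun s hs => by
    rcases hs.1.lt_or_eq with h0 | h0
    · rcases hs.2.lt_or_eq with h1 | h1
      · have hb := h.bound s ⟨h0, h1⟩
        have hp := sub_mul_cos_pos hb.1 hb.2
        by_contra hne
        have hzp : 0 < z (s : UnitAddCircle) := lt_of_le_of_ne (hn s hs) (Ne.symm hne)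
        have : 0 < D (s : UnitAddCircle) := by rw [hDval]; positivity
        exact (mean_pos hDn this).not_ge h4
      · rw [h1, hz.apply_half]
    · rw [← h0, hz.apply_zero]
  -- The square is even, so vanishing on the half period passes to the whole circle.
  have e1 : ∀ x, 0 ≤ (z * z) x ∧ 0 ≤ (-(z * z)) x := fun x =>
    ⟨mul_self_nonneg (z x), nonneg_of_half (w := -(z * z)) (fun x => by simp [hz.apply_neg])
      (fun s hs => by simp [hzero s hs]) x⟩
  ext x
  have := e1 x
  simp only [ContinuousMap.mul_apply, ContinuousMap.neg_apply] at this
  have h0 : z x * z x = 0 := le_antisymm (by linarith [this.2]) this.1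
  simpa using mul_self_eq_zero.1 h0

/-- By positivity of `linT`, the absolute value on the half period is a subsolution, and the
comparison with `u` kills it. -/
lemma IsProfile.eq_zero_of_fixed (h : IsProfile f u) {w : C(UnitAddCircle, ℝ)} (hw : IsOdd w)
    (hfix : w = linT f u w) : w = 0 := by
  obtain ⟨z, hz, hzv⟩ := exists_odd_comp (fun x => |x|) continuous_abs abs_zero hw
  have h1 := h.halfNonneg_linT (hz.sub hw) fun s hs => by
    rw [ContinuousMap.sub_apply, hzv s hs]; linarith [le_abs_self (w (s : UnitAddCircle))]
  have h2 := h.halfNonneg_linT (hz.add hw) fun s hs => by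
    rw [ContinuousMap.add_apply, hzv s hs]; linarith [neg_abs_le (w (s : UnitAddCircle))]
  rw [linT_sub, ← hfix] at h1
  rw [linT_add, ← hfix] at h2
  have hz0 := h.eq_zero_of_le hz (fun s hs => by rw [hzv s hs]; exact abs_nonneg _) fun s hs => by
    have h1 := h1 s hs
    have h2 := h2 s hs
    rw [ContinuousMap.sub_apply] at h1 ⊢
    rw [ContinuousMap.add_apply] at h2
    rw [hzv s hs, sub_nonneg]
    exact abs_le.2 ⟨by linarith, by linarith⟩
  have hzero : ∀ s ∈ Icc (0 : ℝ) (1 / 2), w (s : UnitAddCircle) = 0 := fun s hs => by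
    have := hzv s hs
    rw [hz0, ContinuousMap.zero_apply] at this
    exact abs_eq_zero.1 this.symm
  ext x
  have h3 := nonneg_of_half (w := -(w * w)) (fun x => by simp [hw.apply_neg])
    (fun s hs => by simp [hzero s hs]) x
  simp only [ContinuousMap.mul_apply, ContinuousMap.neg_apply] at h3
  have h0 : w x * w x = 0 := le_antisymm (by linarith) (mul_self_nonneg _)
  simpa using mul_self_eq_zero.1 h0

/-- A maximum principle: the negative part of `w` is a subsolution of the homogeneous equation,
hence zero. -/
lemma IsProfile.halfNonneg_of_eq (h : IsProfile f u) {w q : C(UnitAddCircle, ℝ)} (hw : IsOdd w)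
    (hq : HalfNonneg q) (heq : w = linT f u w + q) : HalfNonneg w := by
  obtain ⟨z, hz, hzv⟩ := exists_odd_comp (fun x => max (-x) 0) (by fun_prop) (by simp) hw
  have hzn : HalfNonneg z := fun s hs => by rw [hzv s hs]; exact le_max_right _ _
  have h1 := h.halfNonneg_linT (hz.add hw) fun s hs => by
    rw [ContinuousMap.add_apply, hzv s hs]; linarith [le_max_left (-w (s : UnitAddCircle)) 0]
  have h2 := h.halfNonneg_linT hz hzn
  rw [linT_add] at h1
  have hz0 := h.eq_zero_of_le hz hzn fun s hs => by
    have h1 := h1 s hs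
    have h2 := h2 s hs
    have h3 := hq s hs
    have h4 : w (s : UnitAddCircle) = linT f u w (s : UnitAddCircle) + q (s : UnitAddCircle) := by
      nth_rw 1 [heq]; rfl
    rw [ContinuousMap.add_apply] at h1
    rw [ContinuousMap.sub_apply, hzv s hs, sub_nonneg]
    exact max_le (by linarith) h2
  intro s hs
  have := hzv s hs
  rw [hz0, ContinuousMap.zero_apply] at this
  linarith [le_max_left (-w (s : UnitAddCircle)) 0]

/-- The linearization as a compact operator on all continuous functions. -/
def linOp (f : ℝ) (u : C(UnitAddCircle, ℝ)) : C(UnitAddCircle, ℝ) →L[ℝ] C(UnitAddCircle, ℝ) :=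
  prim4 ∘L (f • ContinuousLinearMap.mul ℝ C(UnitAddCircle, ℝ) (cosC u)) ∘L odd

lemma linOp_apply (w : C(UnitAddCircle, ℝ)) : linOp f u w = linT f u (odd w) := rfl

lemma isCompactOperator_linOp : IsCompactOperator (linOp f u) :=
  isCompactOperator_prim.comp_clm
    (prim ∘L prim ∘L prim ∘L (f • ContinuousLinearMap.mul ℝ C(UnitAddCircle, ℝ) (cosC u)) ∘L odd)

/-- Fredholm alternative. An eigenvector for the eigenvalue 1 lies in the range of `linOp`, so it is
odd, and odd fixed points vanish. -/
lemma IsProfile.exists_sub_linOp_eq (h : IsProfile f u) (y : C(UnitAddCircle, ℝ)) :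
    ∃ w, w - linT f u (odd w) = y := by
  have hodd : ∀ w, IsOdd (linT f u (odd w)) := fun w =>
    ((h.isOdd.cosC_mul (isOdd_odd w)).smul f).prim4
  rcases (isCompactOperator_linOp (f := f) (u := u)).hasEigenvalue_or_mem_resolventSet
    (one_ne_zero (α := ℝ)) with he | hr
  · exfalso
    obtain ⟨w, hw⟩ := he.exists_hasEigenvector
    have h1 : linOp f u w = w := by simpa using hw.apply_eq_smul
    rw [linOp_apply] at h1
    have h2 : IsOdd w := h1 ▸ hodd w
    rw [h2.odd_eq] at h1
    exact hw.2 (h.eq_zero_of_fixed h2 h1.symm)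
  · rw [resolventSet, mem_ofPred_eq, map_one] at hr
    obtain ⟨v, hv⟩ := hr
    refine ⟨(↑v⁻¹ : C(UnitAddCircle, ℝ) →L[ℝ] C(UnitAddCircle, ℝ)) y, ?_⟩
    have := congrArg (fun L : C(UnitAddCircle, ℝ) →L[ℝ] C(UnitAddCircle, ℝ) => L y) v.mul_inv
    rw [hv] at this
    exact this

/-- The linearized system is solvable: in the unknowns `w` and `g` (the variation of the force). -/
theorem IsProfile.exists_linear_solution (h : IsProfile f u) (y : C(UnitAddCircle, ℝ)) (r : ℝ) :
    ∃ (w : C(UnitAddCircle, ℝ)) (g : ℝ),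
      w - prim4 (g • sinC u + f • (cosC u * odd w)) = y ∧
      -(g * mean (cosC u)) + f * mean (sinC u * odd w) +
        3 / 2 * (mean (odd w * (f • sinC u)) +
          mean (u * (g • sinC u + f • (cosC u * odd w)))) = r := by
  have hf := h.pos
  have hpi := Real.pi_pos
  obtain ⟨w₀, hw₀⟩ := h.exists_sub_linOp_eq y
  -- `w₁` is the response of the angle to a unit change of the force, so the general candidate is
  -- `w₀ + g w₁` with `g` fixed by the scalar equation.
  obtain ⟨w₁, hw₁⟩ := h.exists_sub_linOp_eq (prim4 (sinC u))
  have hw₁odd : IsOdd w₁ := by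
    rw [sub_eq_iff_eq_add] at hw₁
    rw [hw₁]
    exact h.isOdd.sinC.prim4.add ((h.isOdd.cosC_mul (isOdd_odd _)).smul f).prim4
  have hsin : HalfNonneg (sinC u) := fun s hs => by
    rcases hs.1.lt_or_eq with h0 | h0
    · rcases hs.2.lt_or_eq with h1 | h1
      · have := h.bound s ⟨h0, h1⟩
        exact Real.sin_nonneg_of_nonneg_of_le_pi this.1.le (by linarith)
      · rw [h1, h.isOdd.sinC.apply_half]
    · rw [← h0, h.isOdd.sinC.apply_zero]
  have hun : HalfNonneg u := by
    rw [h.eq_prim4]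
    refine (h.isOdd.sinC.smul f).halfNonneg_prim4 fun s hs => ?_
    rw [ContinuousMap.smul_apply, smul_eq_mul]
    exact mul_nonneg hf.le (hsin s hs)
  rw [hw₁odd.odd_eq] at hw₁
  have hw₁n : HalfNonneg w₁ := h.halfNonneg_of_eq hw₁odd (h.isOdd.sinC.halfNonneg_prim4 hsin)
    (by rw [← hw₁]; abel)
  have hw₁' : w₁ = prim4 (f • (cosC u * w₁) + sinC u) := by
    rw [map_add, ← hw₁, linT]; abel
  have hid : f * mean (sinC u * w₁) = mean (u * sinC u) + f * mean (u * (cosC u * w₁)) := by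
    have := mean_mul_prim4 (f • sinC u) (f • (cosC u * w₁) + sinC u)
    rw [← h.eq_prim4, ← hw₁', smul_mul_assoc, map_smul, smul_eq_mul, mul_add, map_add,
      mul_smul_comm, map_smul, smul_eq_mul] at this
    linarith
  have hA : 0 ≤ mean (u * (cosC u * w₁)) := by
    refine mean_nonneg (nonneg_of_half (fun x => ?_) fun s hs => ?_)
    · simp [h.isOdd.apply_neg, hw₁odd.apply_neg]
    · exact mul_nonneg (hun s hs) (mul_nonneg (h.cos_nonneg hs) (hw₁n s hs))
  have hB : 0 < mean (u * sinC u) := by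
    have hb := h.bound (1 / 4) ⟨by norm_num, by norm_num⟩
    refine mean_pos (nonneg_of_half (fun x => ?_) fun s hs => ?_)
      (x := ((1 / 4 : ℝ) : UnitAddCircle)) ?_
    · simp [h.isOdd.apply_neg]
    · exact mul_nonneg (hun s hs) (hsin s hs)
    · exact mul_pos hb.1 (Real.sin_pos_of_pos_of_lt_pi hb.1 (by linarith))
  -- By `hid` and the energy relation the coefficient of `g` is `4 f mean (w₁ sin u) - (3/2) mean (u
  -- sin u)`. It is positive since `f mean (w₁ sin u) ≥ mean (u sin u) > 0`.
  have hκ : -mean (cosC u) + f * mean (sinC u * w₁) + 3 / 2 * (f * mean (sinC u * w₁) +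
      (mean (u * sinC u) + f * mean (u * (cosC u * w₁)))) ≠ 0 := by
    rw [← hid, h.energy]
    have : mean (u * sinC u) ≤ f * mean (sinC u * w₁) := by
      rw [hid]
      have := mul_nonneg hf.le hA
      linarith
    refine ne_of_gt ?_
    linarith
  set κ := -mean (cosC u) + f * mean (sinC u * w₁) + 3 / 2 * (f * mean (sinC u * w₁) +
      (mean (u * sinC u) + f * mean (u * (cosC u * w₁)))) with hκd
  set ℓ := f * mean (sinC u * odd w₀) + 3 / 2 * (f * mean (sinC u * odd w₀) +
    f * mean (u * (cosC u * odd w₀))) with hℓ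
  set g := (r - ℓ) / κ with hg
  have hgκ : g * κ = r - ℓ := div_mul_cancel₀ _ hκ
  refine ⟨w₀ + g • w₁, g, ?_, ?_⟩
  · have e : odd (w₀ + g • w₁) = odd w₀ + g • w₁ := by rw [map_add, map_smul, hw₁odd.odd_eq]
    rw [e, ← hw₀, linT]
    simp only [map_add, map_smul, mul_add, smul_add, mul_smul_comm]
    rw [← hw₁, linT, map_smul]
    module
  · have e : odd (w₀ + g • w₁) = odd w₀ + g • w₁ := by rw [map_add, map_smul, hw₁odd.odd_eq]
    rw [e]
    simp only [map_add, map_smul, mul_add, smul_add, mul_smul_comm, add_mul, smul_mul_assoc,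
      smul_eq_mul]
    rw [mul_comm (odd w₀) (sinC u), mul_comm w₁ (sinC u)]
    rw [hκd] at hgκ
    rw [hℓ] at hgκ
    linear_combination hgκ

end Profile

end CircleFun

/-! ### The expander equations as a C¹ map up to `b = 0`. -/

namespace CircleFun

/-- The embedding of the real functions. -/
def ofRealC : C(UnitAddCircle, ℝ) →L[ℝ] C(UnitAddCircle, ℂ) :=
  Complex.ofRealCLM.compLeftContinuous ℝ UnitAddCircle

/-- The real part. -/
def reC : C(UnitAddCircle, ℂ) →L[ℝ] C(UnitAddCircle, ℝ) :=
  Complex.reCLM.compLeftContinuous ℝ UnitAddCircle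

/-- The imaginary part. -/
def imC : C(UnitAddCircle, ℂ) →L[ℝ] C(UnitAddCircle, ℝ) :=
  Complex.imCLM.compLeftContinuous ℝ UnitAddCircle

/-- The constant functions. -/
def constC : ℂ →L[ℝ] C(UnitAddCircle, ℂ) :=
  LinearMap.mkContinuous
    { toFun := fun c => ContinuousMap.const _ c
      map_add' := fun _ _ => rfl
      map_smul' := fun _ _ => rfl } 1
    fun c => by
      rw [one_mul]
      exact (ContinuousMap.norm_le _ (norm_nonneg _)).2 fun x => le_rfl

@[simp] lemma ofRealC_apply (w : C(UnitAddCircle, ℝ)) (x : UnitAddCircle) :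
    ofRealC w x = (w x : ℂ) := rfl

@[simp] lemma reC_apply (w : C(UnitAddCircle, ℂ)) (x : UnitAddCircle) : reC w x = (w x).re := rfl

@[simp] lemma imC_apply (w : C(UnitAddCircle, ℂ)) (x : UnitAddCircle) : imC w x = (w x).im := rfl

/-- Multiplication by the imaginary unit. -/
def mulI : C(UnitAddCircle, ℂ) →L[ℝ] C(UnitAddCircle, ℂ) :=
  ContinuousLinearMap.mul ℝ C(UnitAddCircle, ℂ) (constC Complex.I)

@[simp] lemma mulI_apply (w : C(UnitAddCircle, ℂ)) (x : UnitAddCircle) :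
    mulI w x = Complex.I * w x := rfl

lemma mean_mulI (w : C(UnitAddCircle, ℂ)) : mean (mulI w) = Complex.I * mean w := by
  rw [mean_def, mean_def]
  exact intervalIntegral.integral_const_mul Complex.I _

/-- The function `e^{iu}`. -/
def expi (u : C(UnitAddCircle, ℝ)) : C(UnitAddCircle, ℂ) := NormedSpace.exp (mulI (ofRealC u))

@[simp] lemma expi_apply (u : C(UnitAddCircle, ℝ)) (x : UnitAddCircle) :
    expi u x = Complex.exp (Complex.I * u x) := by
  have h := NormedSpace.map_exp (ContinuousMap.evalAlgHom ℂ ℂ x)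
    (continuous_eval_const x) (mulI (ofRealC u))
  rw [Complex.exp_eq_exp_ℂ]
  exact h

lemma reC_expi (u : C(UnitAddCircle, ℝ)) : reC (expi u) = cosC u := by
  ext x
  simp [mul_comm Complex.I, Complex.exp_ofReal_mul_I_re]

lemma imC_expi (u : C(UnitAddCircle, ℝ)) : imC (expi u) = sinC u := by
  ext x
  simp [mul_comm Complex.I, Complex.exp_ofReal_mul_I_im]

lemma contDiff_expi : ContDiff ℝ 1 expi := by
  have h1 : ContDiff ℝ 1 (NormedSpace.exp : C(UnitAddCircle, ℂ) → C(UnitAddCircle, ℂ)) :=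
    contDiff_iff_contDiffAt.2 fun x => (NormedSpace.exp_analytic (𝕂 := ℝ) x).contDiffAt
  exact h1.comp (mulI.contDiff.comp ofRealC.contDiff)

lemma hasDerivAt_exp_smul_mul {A : Type*} [NormedCommRing A] [NormedAlgebra ℝ A] [CompleteSpace A]
    (x c : A) : HasDerivAt (fun t : ℝ => NormedSpace.exp (t • x) * c) (x * c) 0 :=
  ((hasDerivAt_exp_smul_const (𝕂 := ℝ) x 0).mul_const c).congr_deriv
    (by rw [zero_smul, NormedSpace.exp_zero, one_mul])

lemma hasDerivAt_expi (u w : C(UnitAddCircle, ℝ)) :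
    HasDerivAt (fun t : ℝ => expi (u + t • w)) (mulI (ofRealC w) * expi u) 0 := by
  have h1 := hasDerivAt_exp_smul_mul (mulI (ofRealC w)) (expi u)
  have h2 : (fun t : ℝ => expi (u + t • w)) =
      fun t : ℝ => NormedSpace.exp (t • mulI (ofRealC w)) * expi u := by
    funext t
    rw [expi, expi, ← NormedSpace.exp_add]
    congr 1
    rw [map_add, map_smul, map_add, map_smul, add_comm]
  rw [h2]
  exact h1

lemma hasDerivAt_sinC (u w : C(UnitAddCircle, ℝ)) :
    HasDerivAt (fun t : ℝ => sinC (u + t • w)) (cosC u * w) 0 := by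
  have h := imC.hasFDerivAt.comp_hasDerivAt (0 : ℝ) (hasDerivAt_expi u w)
  have h1 : (fun t : ℝ => sinC (u + t • w)) = imC ∘ fun t : ℝ => expi (u + t • w) := by
    funext t
    exact (imC_expi _).symm
  rw [h1]
  refine h.congr_deriv ?_
  ext x
  simp [mul_comm Complex.I, Complex.exp_ofReal_mul_I_re, Complex.exp_ofReal_mul_I_im]
  ring

lemma hasDerivAt_cosC (u w : C(UnitAddCircle, ℝ)) :
    HasDerivAt (fun t : ℝ => cosC (u + t • w)) (-(sinC u * w)) 0 := by
  have h := reC.hasFDerivAt.comp_hasDerivAt (0 : ℝ) (hasDerivAt_expi u w)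
  have h1 : (fun t : ℝ => cosC (u + t • w)) = reC ∘ fun t : ℝ => expi (u + t • w) := by
    funext t
    exact (reC_expi _).symm
  rw [h1]
  refine h.congr_deriv ?_
  ext x
  simp [mul_comm Complex.I, Complex.exp_ofReal_mul_I_re, Complex.exp_ofReal_mul_I_im]
  ring

/-- The operator `w ↦ w + i b ∂⁻¹ w`. -/
def phaseOp (b : ℝ) : C(UnitAddCircle, ℂ) →L[ℝ] C(UnitAddCircle, ℂ) :=
  1 + b • (mulI ∘L prim)

/-- The solution operator of `z' + i b z = b w`, continued to `b = 0`. -/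
def slowPrim (b : ℝ) : C(UnitAddCircle, ℂ) →L[ℝ] C(UnitAddCircle, ℂ) :=
  -(mulI ∘L constC ∘L mean) + b • (prim ∘L Ring.inverse (phaseOp b))

lemma contDiff_line {F : Type*} [NormedAddCommGroup F] [NormedSpace ℝ F] (a c : F) :
    ContDiff ℝ 1 fun b : ℝ => a + b • c :=
  contDiff_const.add (contDiff_id.smul contDiff_const)

/-- Inversion of operators is smooth near the identity, so the singular limit `b → 0` becomes a
regular one. -/
lemma contDiffAt_resolvent {F : Type*} [NormedAddCommGroup F] [NormedSpace ℝ F] [CompleteSpace F]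
    (A P Q : F →L[ℝ] F) :
    ContDiffAt ℝ 1 (fun b : ℝ => A + b • (P ∘L Ring.inverse (1 + b • Q))) 0 := by
  have h1 : ContDiffAt ℝ 1 (fun b : ℝ => Ring.inverse (1 + b • Q)) 0 := by
    have h2 : 1 + (0 : ℝ) • Q = ((1 : (F →L[ℝ] F)ˣ) : F →L[ℝ] F) := by simp
    refine ContDiffAt.comp (g := Ring.inverse) (0 : ℝ) ?_ (contDiff_line 1 Q).contDiffAt
    rw [h2]
    exact contDiffAt_ringInverse ℝ _
  exact contDiffAt_const.add (contDiffAt_id.smul (contDiffAt_const.clm_comp h1))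

lemma eventually_isUnit_resolvent {F : Type*} [NormedAddCommGroup F] [NormedSpace ℝ F]
    [CompleteSpace F] (Q : F →L[ℝ] F) : ∀ᶠ b in 𝓝 (0 : ℝ), IsUnit (1 + b • Q) := by
  have h1 : IsUnit (1 + (0 : ℝ) • Q) := by simp
  exact (contDiff_line 1 Q).continuous.continuousAt.eventually (Units.isOpen.mem_nhds h1)

lemma contDiffAt_slowPrim : ContDiffAt ℝ 1 slowPrim 0 :=
  contDiffAt_resolvent (-(mulI ∘L constC ∘L mean)) prim (mulI ∘L prim)

lemma eventually_isUnit_phaseOp : ∀ᶠ b in 𝓝 (0 : ℝ), IsUnit (phaseOp b) :=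
  eventually_isUnit_resolvent (mulI ∘L prim)

lemma slowPrim_zero_apply (w : C(UnitAddCircle, ℂ)) (x : UnitAddCircle) :
    slowPrim 0 w x = -(Complex.I * mean w) := by
  rw [slowPrim, zero_smul, add_zero]
  rfl

/-- The mean of `z' + ibz = bw` forces the constant part `-i mean w`; dividing the oscillating part
by `b` leaves an equation that is uniformly solvable for small `b`. -/
lemma exists_slowPrim_apply {b : ℝ} (hb : IsUnit (phaseOp b)) (w : C(UnitAddCircle, ℂ)) :
    ∃ z, z + b • mulI (prim z) = w ∧
      ∀ x, slowPrim b w x = -(Complex.I * mean w) + b * prim z x := by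
  refine ⟨Ring.inverse (phaseOp b) w, ?_, fun x => ?_⟩
  · have := congrArg (fun L : C(UnitAddCircle, ℂ) →L[ℝ] C(UnitAddCircle, ℂ) => L w)
      (Ring.mul_inverse_cancel _ hb)
    exact this
  · change -(Complex.I * mean w) + b • prim (Ring.inverse (phaseOp b) w) x = _
    rw [Complex.real_smul]

lemma mean_add_smul_prim {b : ℝ} {z w : C(UnitAddCircle, ℂ)} (h : z + b • mulI (prim z) = w) :
    mean z = mean w := by
  rw [← h, map_add, map_smul, mean_mulI, mean_prim, mul_zero, smul_zero, add_zero]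

/-- The defining equation of `slowPrim`. -/
lemma hasDerivAt_slowPrim {b : ℝ} (hb : IsUnit (phaseOp b)) (w : C(UnitAddCircle, ℂ)) (s : ℝ) :
    HasDerivAt (fun s : ℝ => slowPrim b w (s : UnitAddCircle))
      (b * w (s : UnitAddCircle) - Complex.I * b * slowPrim b w (s : UnitAddCircle)) s := by
  obtain ⟨z, hz, hd⟩ := exists_slowPrim_apply hb w
  have hm := mean_add_smul_prim hz
  have h1 := ((hasDerivAt_prim z s).const_mul (b : ℂ)).const_add (-(Complex.I * mean w))
  simp only [hd]
  refine h1.congr_deriv ?_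
  have h2 : w (s : UnitAddCircle) = z (s : UnitAddCircle) +
      b * (Complex.I * prim z (s : UnitAddCircle)) := by
    rw [← hz, ContinuousMap.add_apply, ContinuousMap.smul_apply, Complex.real_smul, mulI_apply]
  rw [hm, h2]
  have hI := Complex.I_mul_I
  linear_combination (-(b : ℂ) * mean w) * hI

/-- The slowly rotating position vector, multiplied with `b`. -/
def pos (b : ℝ) (u : C(UnitAddCircle, ℝ)) : C(UnitAddCircle, ℂ) := slowPrim b (expi u)

/-- The normal component of `pos`. -/
def normalPart (b : ℝ) (u : C(UnitAddCircle, ℝ)) : C(UnitAddCircle, ℝ) :=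
  imC (expi (-u) * pos b u)

/-- The force, in the moving frame. -/
def force (b : ℝ) (u : C(UnitAddCircle, ℝ)) (μ : ℝ) : C(UnitAddCircle, ℂ) :=
  μ • mulI (expi (-u) * slowPrim b (ofRealC (normalPart b u) * expi u))

/-- The equations for the angle and the energy, for a given force. -/
def residual (v : C(UnitAddCircle, ℝ)) (N : C(UnitAddCircle, ℂ)) : C(UnitAddCircle, ℝ) × ℝ :=
  (v - prim4 (odd (imC N)), mean (reC N) + 3 / 2 * mean (odd v * imC N))

lemma residual_eq (v : C(UnitAddCircle, ℝ)) (N : C(UnitAddCircle, ℂ)) : residual v N =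
    (v - prim4 (odd (imC N)), mean (reC N) + 3 / 2 * mean (odd v * imC N)) := by
  rw [residual]

/-- The map whose zeros are the expanders. -/
def expanderMap (x : ℝ × C(UnitAddCircle, ℝ) × ℝ) : C(UnitAddCircle, ℝ) × ℝ :=
  residual x.2.1 (force x.1 (odd x.2.1) x.2.2)

section Smooth

variable (v₀ : C(UnitAddCircle, ℝ)) (μ₀ : ℝ)

lemma contDiffAt_pos : ContDiffAt ℝ 1
    (fun x : ℝ × C(UnitAddCircle, ℝ) × ℝ => pos x.1 (odd x.2.1)) (0, v₀, μ₀) := by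
  have h1 : ContDiffAt ℝ 1 (fun x : ℝ × C(UnitAddCircle, ℝ) × ℝ => slowPrim x.1) (0, v₀, μ₀) :=
    ContDiffAt.comp (g := slowPrim) _ contDiffAt_slowPrim contDiffAt_fst
  have h2 : ContDiff ℝ 1 (fun x : ℝ × C(UnitAddCircle, ℝ) × ℝ => odd x.2.1) :=
    odd.contDiff.comp contDiff_snd.fst
  exact h1.clm_apply (contDiff_expi.comp h2).contDiffAt

lemma contDiffAt_frame : ContDiffAt ℝ 1
    (fun x : ℝ × C(UnitAddCircle, ℝ) × ℝ => expi (-odd x.2.1) * pos x.1 (odd x.2.1))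
    (0, v₀, μ₀) := by
  have h2 : ContDiff ℝ 1 (fun x : ℝ × C(UnitAddCircle, ℝ) × ℝ => odd x.2.1) :=
    odd.contDiff.comp contDiff_snd.fst
  exact (contDiff_expi.comp h2.neg).contDiffAt.mul (contDiffAt_pos v₀ μ₀)

lemma contDiffAt_force : ContDiffAt ℝ 1
    (fun x : ℝ × C(UnitAddCircle, ℝ) × ℝ => force x.1 (odd x.2.1) x.2.2) (0, v₀, μ₀) := by
  have h1 : ContDiffAt ℝ 1 (fun x : ℝ × C(UnitAddCircle, ℝ) × ℝ => slowPrim x.1) (0, v₀, μ₀) :=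
    ContDiffAt.comp (g := slowPrim) _ contDiffAt_slowPrim contDiffAt_fst
  have h2 : ContDiff ℝ 1 (fun x : ℝ × C(UnitAddCircle, ℝ) × ℝ => odd x.2.1) :=
    odd.contDiff.comp contDiff_snd.fst
  have h3 : ContDiffAt ℝ 1
      (fun x : ℝ × C(UnitAddCircle, ℝ) × ℝ => ofRealC (normalPart x.1 (odd x.2.1)))
      (0, v₀, μ₀) :=
    (ofRealC.contDiff.comp imC.contDiff).contDiffAt.comp _ (contDiffAt_frame v₀ μ₀)
  have h4 := h1.clm_apply (h3.mul (contDiff_expi.comp h2).contDiffAt)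
  have h5 := (contDiff_expi.comp h2.neg).contDiffAt.mul h4
  have h6 : ContDiffAt ℝ 1 (fun x : ℝ × C(UnitAddCircle, ℝ) × ℝ => x.2.2) (0, v₀, μ₀) :=
    contDiff_snd.snd.contDiffAt
  exact h6.smul (mulI.contDiff.contDiffAt.comp _ h5)

lemma contDiff_residual_aux {A B : Type*} [NormedCommRing A] [NormedAlgebra ℝ A]
    [NormedAddCommGroup B] [NormedSpace ℝ B] (p o : A →L[ℝ] A) (i r : B →L[ℝ] A) (M : A →L[ℝ] ℝ) :
    ContDiff ℝ 1 (fun x : A × B =>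
      (x.1 - p (o (i x.2)), M (r x.2) + 3 / 2 * M (o x.1 * i x.2))) := by
  fun_prop

lemma contDiff_residual : ContDiff ℝ 1
    (fun x : C(UnitAddCircle, ℝ) × C(UnitAddCircle, ℂ) => residual x.1 x.2) := by
  convert contDiff_residual_aux prim4 odd imC reC mean using 2
  rw [residual_eq]

lemma contDiffAt_expanderMap : ContDiffAt ℝ 1 expanderMap (0, v₀, μ₀) := by
  have h8 : ContDiffAt ℝ 1 (fun x : ℝ × C(UnitAddCircle, ℝ) × ℝ => x.2.1) (0, v₀, μ₀) :=
    contDiff_snd.fst.contDiffAt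
  have h9 := (contDiff_residual.contDiffAt (x := (v₀, force 0 (odd v₀) μ₀))).comp
    ((0 : ℝ), v₀, μ₀) (h8.prodMk (contDiffAt_force v₀ μ₀))
  convert h9 using 2
  funext x
  rw [Function.comp_apply, expanderMap]

end Smooth

lemma mean_re (w : C(UnitAddCircle, ℂ)) : (mean w).re = mean (reC w) := by
  rw [mean_def, mean_def]
  exact (Complex.reCLM.intervalIntegral_comp_comm (intervalIntegrable w 0 1)).symm

lemma mean_im (w : C(UnitAddCircle, ℂ)) : (mean w).im = mean (imC w) := by
  rw [mean_def, mean_def]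
  exact (Complex.imCLM.intervalIntegral_comp_comm (intervalIntegrable w 0 1)).symm

lemma mean_expi_of_isOdd {u : C(UnitAddCircle, ℝ)} (hu : IsOdd u) :
    mean (expi u) = ((mean (cosC u) : ℝ) : ℂ) := by
  apply Complex.ext
  · rw [mean_re, reC_expi, Complex.ofReal_re]
  · rw [mean_im, imC_expi, Complex.ofReal_im, hu.sinC.mean_eq_zero]

lemma expi_apply_eq (u : C(UnitAddCircle, ℝ)) (x : UnitAddCircle) :
    expi u x = (Real.cos (u x) : ℂ) + (Real.sin (u x) : ℂ) * Complex.I := by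
  rw [expi_apply, mul_comm, Complex.exp_mul_I, Complex.ofReal_cos, Complex.ofReal_sin]

lemma frame_zero {u : C(UnitAddCircle, ℝ)} (hu : IsOdd u) (x : UnitAddCircle) :
    (expi (-u) * pos 0 u) x =
      ((-(mean (cosC u) * Real.sin (u x)) : ℝ) : ℂ) +
        ((-(mean (cosC u) * Real.cos (u x)) : ℝ) : ℂ) * Complex.I := by
  rw [ContinuousMap.mul_apply, pos, slowPrim_zero_apply, mean_expi_of_isOdd hu, expi_apply_eq,
    ContinuousMap.neg_apply, Real.cos_neg, Real.sin_neg]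
  set m : ℝ := mean (cosC u)
  push_cast
  have hI := Complex.I_mul_I
  linear_combination (m * Complex.sin (u x)) * hI

lemma normalPart_zero {u : C(UnitAddCircle, ℝ)} (hu : IsOdd u) :
    normalPart 0 u = -(mean (cosC u)) • cosC u := by
  ext x
  rw [normalPart, imC_apply, frame_zero hu, Complex.add_im, Complex.ofReal_im, Complex.im_ofReal_mul,
    Complex.I_im, ContinuousMap.smul_apply, cosC_apply, smul_eq_mul]
  ring

/-- In the limit the force is a constant real vector, and `e^{-iu}` expresses it in the moving
frame. The imaginary part of the averaged integrand vanishes because `cos u sin u` is odd. -/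
lemma force_zero {u : C(UnitAddCircle, ℝ)} (hu : IsOdd u) (μ : ℝ) :
    force 0 u μ = -((μ * (mean (cosC u) * mean (cosC u * cosC u))) • expi (-u)) := by
  have e (x : UnitAddCircle) : (ofRealC (normalPart 0 u) * expi u) x =
      ((-(mean (cosC u)) * (Real.cos (u x) * Real.cos (u x)) : ℝ) : ℂ) +
        ((-(mean (cosC u)) * (Real.cos (u x) * Real.sin (u x)) : ℝ) : ℂ) * Complex.I := by
    rw [normalPart_zero hu, ContinuousMap.mul_apply, ofRealC_apply, ContinuousMap.smul_apply,
      cosC_apply, smul_eq_mul, expi_apply_eq]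
    push_cast
    ring
  have h1 : mean (ofRealC (normalPart 0 u) * expi u) =
      ((-(mean (cosC u) * mean (cosC u * cosC u)) : ℝ) : ℂ) := by
    apply Complex.ext
    · have : reC (ofRealC (normalPart 0 u) * expi u) = -(mean (cosC u)) • (cosC u * cosC u) := by
        ext x
        rw [reC_apply, e, Complex.add_re, Complex.re_ofReal_mul, Complex.I_re, mul_zero, add_zero,
          Complex.ofReal_re]
        rfl
      rw [mean_re, Complex.ofReal_re, this, map_smul, smul_eq_mul, neg_mul]
    · have : imC (ofRealC (normalPart 0 u) * expi u) = -(mean (cosC u)) • (cosC u * sinC u) := by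
        ext x
        rw [imC_apply, e, Complex.add_im, Complex.im_ofReal_mul, Complex.I_im, mul_one,
          Complex.ofReal_im, zero_add]
        rfl
      rw [mean_im, Complex.ofReal_im, this]
      exact ((hu.cosC_mul hu.sinC).smul _).mean_eq_zero
  set m : ℝ := mean (cosC u)
  set k : ℝ := mean (cosC u * cosC u)
  ext x
  rw [force, ContinuousMap.smul_apply, mulI_apply, ContinuousMap.mul_apply, slowPrim_zero_apply, h1,
    ContinuousMap.neg_apply, ContinuousMap.smul_apply, Complex.real_smul, Complex.real_smul]
  push_cast
  have hI := Complex.I_mul_I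
  linear_combination (μ * m * k * expi (-u) x) * hI

lemma expanderMap_zero (v : C(UnitAddCircle, ℝ)) (μ : ℝ) :
    expanderMap (0, v, μ) =
      (v - prim4 ((μ * (mean (cosC (odd v)) * mean (cosC (odd v) * cosC (odd v)))) • sinC (odd v)),
        (μ * (mean (cosC (odd v)) * mean (cosC (odd v) * cosC (odd v)))) *
          (-mean (cosC (odd v)) + 3 / 2 * mean (odd v * sinC (odd v)))) := by
  have hu := isOdd_odd v
  set u := odd v with hud
  set F : ℝ := μ * (mean (cosC u) * mean (cosC u * cosC u)) with hF
  have h1 : force 0 u μ = -(F • expi (-u)) := by rw [force_zero hu]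
  have h2 : imC (-(F • expi (-u))) = F • sinC u := by
    rw [map_neg, map_smul, imC_expi]
    ext x
    simp
  have h3 : reC (-(F • expi (-u))) = -(F • cosC u) := by
    rw [map_neg, map_smul, reC_expi]
    ext x
    simp
  have h4 : mean (u * F • sinC u) = F * mean (u * sinC u) := by
    rw [mul_smul_comm, map_smul, smul_eq_mul]
  have h5 : mean (-(F • cosC u)) = -(F * mean (cosC u)) := by
    rw [map_neg, map_smul, smul_eq_mul]
  have h6 : expanderMap (0, v, μ) = residual v (-(F • expi (-u))) := by
    rw [expanderMap, ← h1]
  rw [h6, residual, h2, h3, (hu.sinC.smul F).odd_eq, ← hud, h4, h5]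
  refine Prod.ext rfl ?_
  change -(F * mean (cosC u)) + 3 / 2 * (F * mean (u * sinC u)) = _
  ring

end CircleFun

/-! ### Continuation of the profile to small `b`. -/

/-- The implicit function theorem for a surjective partial derivative. -/
lemma exists_zero_near_of_partial_surj {X Y : Type*} [NormedAddCommGroup X] [NormedSpace ℝ X]
    [CompleteSpace X] [NormedAddCommGroup Y] [NormedSpace ℝ Y] [CompleteSpace Y]
    {Φ : ℝ × X → Y} {x₀ : X} (hΦ : ContDiffAt ℝ 1 Φ (0, x₀)) (h0 : Φ (0, x₀) = 0)
    (hsurj : ∀ y, ∃ η, HasDerivAt (fun t : ℝ => Φ (0, x₀ + t • η)) y 0)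
    {W : Set (ℝ × X)} (hW : W ∈ 𝓝 ((0 : ℝ), x₀)) :
    ∀ᶠ b in 𝓝 (0 : ℝ), ∃ x, (b, x) ∈ W ∧ Φ (b, x) = 0 := by
  have hd := hΦ.hasStrictFDerivAt one_ne_zero
  set L := fderiv ℝ Φ (0, x₀) with hL
  -- Recording the parameter beside the value makes the whole derivative onto; local openness then
  -- gives a zero for every nearby parameter, with no complement of the kernel required.
  have hG : HasStrictFDerivAt (fun p : ℝ × X => (p.1, Φ p))
      ((ContinuousLinearMap.fst ℝ ℝ X).prod L) (0, x₀) :=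
    hasStrictFDerivAt_fst.prodMk hd
  have hpart : ∀ y, ∃ η, L (0, η) = y := fun y => by
    obtain ⟨η, hη⟩ := hsurj y
    refine ⟨η, ?_⟩
    have hline : HasDerivAt (fun t : ℝ => ((0 : ℝ), x₀ + t • η)) ((0 : ℝ), η) 0 := by
      have h1 : HasDerivAt (fun t : ℝ => x₀ + t • η) η 0 := by
        simpa using ((hasDerivAt_id (0 : ℝ)).smul_const η).const_add x₀
      exact (hasDerivAt_const (0 : ℝ) (0 : ℝ)).prodMk h1
    have h2 : HasFDerivAt Φ L ((fun t : ℝ => ((0 : ℝ), x₀ + t • η)) 0) := by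
      simpa using hd.hasFDerivAt
    exact (h2.comp_hasDerivAt (0 : ℝ) hline).unique hη
  have hs : ((ContinuousLinearMap.fst ℝ ℝ X).prod L).range = ⊤ := by
    refine LinearMap.range_eq_top.2 fun ⟨c, y⟩ => ?_
    obtain ⟨η, hη⟩ := hpart (y - L (c, 0))
    refine ⟨(c, η), Prod.ext rfl ?_⟩
    have : ((c, η) : ℝ × X) = (c, 0) + (0, η) := by simp
    change L (c, η) = y
    rw [this, map_add, hη, add_sub_cancel]
  have hmap := hG.map_nhds_eq_of_surj hs
  have h3 : (fun p : ℝ × X => (p.1, Φ p)) '' W ∈ 𝓝 ((0 : ℝ), (0 : Y)) := by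
    rw [h0] at hmap
    rw [← hmap]
    exact image_mem_map hW
  have h4 : Tendsto (fun b : ℝ => (b, (0 : Y))) (𝓝 0) (𝓝 ((0 : ℝ), (0 : Y))) :=
    (Continuous.prodMk_left (0 : Y)).tendsto 0
  filter_upwards [h4 h3] with b hb
  obtain ⟨⟨b', x⟩, hx, he⟩ := hb
  obtain ⟨rfl, h5⟩ := Prod.mk.inj he
  exact ⟨x, hx, h5⟩

namespace CircleFun

variable {f : ℝ} {u : C(UnitAddCircle, ℝ)}

lemma IsProfile.cosC_nonneg (h : IsProfile f u) (x : UnitAddCircle) : 0 ≤ cosC u x := by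
  refine nonneg_of_half (fun x => ?_) (fun s hs => h.cos_nonneg hs) x
  rw [cosC_apply, cosC_apply, h.isOdd.apply_neg, Real.cos_neg]

lemma IsProfile.cosC_zero (h : IsProfile f u) : cosC u ((0 : ℝ) : UnitAddCircle) = 1 := by
  rw [cosC_apply, h.isOdd.apply_zero, Real.cos_zero]

lemma IsProfile.mean_cos_pos (h : IsProfile f u) : 0 < mean (cosC u) :=
  mean_pos h.cosC_nonneg (by rw [h.cosC_zero]; exact one_pos)

lemma IsProfile.mean_cos_sq_pos (h : IsProfile f u) : 0 < mean (cosC u * cosC u) := by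
  refine mean_pos (fun x => mul_self_nonneg (cosC u x)) (x := ((0 : ℝ) : UnitAddCircle)) ?_
  rw [ContinuousMap.mul_apply, h.cosC_zero]
  norm_num

/-- The multiplier for which the profile solves the limiting equations. -/
def profileMultiplier (f : ℝ) (u : C(UnitAddCircle, ℝ)) : ℝ :=
  f / (mean (cosC u) * mean (cosC u * cosC u))

lemma IsProfile.profileMultiplier_pos (h : IsProfile f u) : 0 < profileMultiplier f u :=
  div_pos h.pos (mul_pos h.mean_cos_pos h.mean_cos_sq_pos)

lemma IsProfile.profileMultiplier_mul (h : IsProfile f u) :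
    profileMultiplier f u * (mean (cosC u) * mean (cosC u * cosC u)) = f :=
  div_mul_cancel₀ _ (mul_pos h.mean_cos_pos h.mean_cos_sq_pos).ne'

lemma IsProfile.expanderMap_eq_zero (h : IsProfile f u) :
    expanderMap (0, u, profileMultiplier f u) = 0 := by
  rw [expanderMap_zero, h.isOdd.odd_eq, h.profileMultiplier_mul, ← h.eq_prim4, h.energy]
  refine Prod.ext (sub_self _) ?_
  change f * (-(3 / 2 * mean (u * sinC u)) + 3 / 2 * mean (u * sinC u)) = 0
  ring

lemma hasDerivAt_sub_smul {A : Type*} [NormedAddCommGroup A] [NormedSpace ℝ A] (p : A →L[ℝ] A)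
    {F : ℝ → ℝ} {S : ℝ → A} {g : ℝ} {S' : A} (u w : A) (hF : HasDerivAt F g 0)
    (hS : HasDerivAt S S' 0) :
    HasDerivAt (fun t : ℝ => u + t • w - p (F t • S t)) (w - p (g • S 0 + F 0 • S')) 0 := by
  have h1 : HasDerivAt (fun t : ℝ => u + t • w) w 0 := by
    simpa using ((hasDerivAt_id (0 : ℝ)).smul_const w).const_add u
  have h2 := p.hasFDerivAt.comp_hasDerivAt (0 : ℝ) (hF.smul hS)
  refine (h1.sub h2).congr_deriv ?_
  rw [add_comm]

lemma hasDerivAt_mean_mul {A : Type*} [NormedCommRing A] [NormedAlgebra ℝ A] (M : A →L[ℝ] ℝ)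
    {S T : ℝ → A} {S' T' : A} (hS : HasDerivAt S S' 0) (hT : HasDerivAt T T' 0) :
    HasDerivAt (fun t : ℝ => M (S t * T t)) (M (S' * T 0 + S 0 * T')) 0 :=
  M.hasFDerivAt.comp_hasDerivAt (0 : ℝ) (hS.mul hT)

lemma hasDerivAt_line {A : Type*} [NormedAddCommGroup A] [NormedSpace ℝ A] (u w : A) :
    HasDerivAt (fun t : ℝ => u + t • w) w 0 := by
  simpa using ((hasDerivAt_id (0 : ℝ)).smul_const w).const_add u

/-- The partial derivative of the expander map at the profile is onto. -/
lemma IsProfile.exists_hasDerivAt (h : IsProfile f u) (y : C(UnitAddCircle, ℝ) × ℝ) :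
    ∃ η : C(UnitAddCircle, ℝ) × ℝ,
      HasDerivAt (fun t : ℝ => expanderMap (0, (u, profileMultiplier f u) + t • η)) y 0 := by
  obtain ⟨y, r⟩ := y
  obtain ⟨w, g, h1, h2⟩ := h.exists_linear_solution y r
  set μ := profileMultiplier f u with hμ
  set z := odd w with hz
  have hsin := hasDerivAt_sinC u z
  have hcos := hasDerivAt_cosC u z
  have hm : HasDerivAt (fun t : ℝ => mean (cosC (u + t • z))) (mean (-(sinC u * z))) 0 :=
    (mean (E := ℝ)).hasFDerivAt.comp_hasDerivAt (0 : ℝ) hcos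
  have hm2 := hasDerivAt_mean_mul (mean (E := ℝ)) hcos hcos
  have hmm := hm.mul hm2
  set ℓ := mean (-(sinC u * z)) * mean (cosC (u + (0 : ℝ) • z) * cosC (u + (0 : ℝ) • z)) +
    mean (cosC (u + (0 : ℝ) • z)) * mean (-(sinC u * z) * cosC (u + (0 : ℝ) • z) +
      cosC (u + (0 : ℝ) • z) * -(sinC u * z)) with hℓ
  have hpos := mul_pos h.mean_cos_pos h.mean_cos_sq_pos
  set M := mean (cosC u) * mean (cosC u * cosC u) with hM
  -- The linear theory prescribes the variation `g` of the product `μ · mean (cos u) · mean (cos²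
  -- u)`. The part `μℓ` comes from the change of angle, and `μ` supplies the rest.
  set ν := (g - μ * ℓ) / M with hν
  have hνM : ν * M = g - μ * ℓ := div_mul_cancel₀ _ hpos.ne'
  have h0 : u + (0 : ℝ) • z = u := by rw [zero_smul, add_zero]
  have hF : HasDerivAt (fun t : ℝ => (μ + t * ν) *
      (mean (cosC (u + t • z)) * mean (cosC (u + t • z) * cosC (u + t • z)))) g 0 := by
    have h3 : HasDerivAt (fun t : ℝ => μ + t * ν) ν 0 := by
      simpa using ((hasDerivAt_id (0 : ℝ)).mul_const ν).const_add μ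
    refine (h3.mul hmm).congr_deriv ?_
    simp only [Pi.mul_apply, h0, zero_mul, add_zero]
    rw [← hM, hνM]
    ring
  refine ⟨(w, ν), ?_⟩
  have hfun : (fun t : ℝ => expanderMap (0, (u, μ) + t • (w, ν))) = fun t : ℝ =>
      (u + t • w - prim4 (((μ + t * ν) *
        (mean (cosC (u + t • z)) * mean (cosC (u + t • z) * cosC (u + t • z)))) •
          sinC (u + t • z)),
        ((μ + t * ν) *
        (mean (cosC (u + t • z)) * mean (cosC (u + t • z) * cosC (u + t • z)))) *
          (-mean (cosC (u + t • z)) + 3 / 2 * mean ((u + t • z) * sinC (u + t • z)))) := by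
    funext t
    have e : odd (u + t • w) = u + t • z := by rw [map_add, map_smul, h.isOdd.odd_eq]
    have := expanderMap_zero (u + t • w) (μ + t * ν)
    rw [e] at this
    exact this
  rw [hfun]
  have hA := hasDerivAt_sub_smul prim4 u w hF hsin
  have hB := hasDerivAt_mean_mul (mean (E := ℝ)) (hasDerivAt_line u z) hsin
  have hC := hF.mul (hm.neg.add (hB.const_mul (3 / 2 : ℝ)))
  refine (hA.prodMk hC).congr_deriv (Prod.ext ?_ ?_)
  · rw [← h1]
    simp only [h0]
    rw [zero_mul, add_zero, ← hM, h.profileMultiplier_mul]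
  · simp only [Pi.add_apply, Pi.neg_apply, h0]
    rw [zero_mul, add_zero, ← hM, h.profileMultiplier_mul, ← h2, h.energy]
    simp only [map_add, map_neg, map_smul, mul_smul_comm, smul_eq_mul, mul_add]
    ring

/-- Solutions of the expander equations near the profile. -/
theorem IsProfile.eventually_exists (h : IsProfile f u)
    {W : Set (ℝ × C(UnitAddCircle, ℝ) × ℝ)} (hW : W ∈ 𝓝 ((0 : ℝ), u, profileMultiplier f u)) :
    ∀ᶠ b in 𝓝 (0 : ℝ), ∃ x, (b, x) ∈ W ∧ expanderMap (b, x) = 0 :=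
  exists_zero_near_of_partial_surj (contDiffAt_expanderMap u _) h.expanderMap_eq_zero
    h.exists_hasDerivAt hW

end CircleFun

/-! ### Reflection symmetry of the solutions. -/

namespace CircleFun

/-- Complex conjugation of functions. -/
def conjC : C(UnitAddCircle, ℂ) →L[ℝ] C(UnitAddCircle, ℂ) :=
  (Complex.conjCLE : ℂ →L[ℝ] ℂ).compLeftContinuous ℝ UnitAddCircle

@[simp] lemma conjC_apply (w : C(UnitAddCircle, ℂ)) (x : UnitAddCircle) :
    conjC w x = conj (w x) := rfl

lemma mean_conjC (w : C(UnitAddCircle, ℂ)) : mean (conjC w) = conj (mean w) := by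
  rw [mean_def, mean_def]
  exact (Complex.conjCLE : ℂ →L[ℝ] ℂ).intervalIntegral_comp_comm (intervalIntegrable w 0 1)

lemma rawPrim_conjC (w : C(UnitAddCircle, ℂ)) : rawPrim (conjC w) = conjC (rawPrim w) := by
  refine ext_real fun s => ?_
  rw [conjC_apply, rawPrim_coe, rawPrim_coe, mean_conjC, map_sub, Complex.real_smul,
    Complex.real_smul, map_mul, Complex.conj_ofReal]
  congr 1
  exact (Complex.conjCLE : ℂ →L[ℝ] ℂ).intervalIntegral_comp_comm (intervalIntegrable w 0 s)

lemma prim_conjC (w : C(UnitAddCircle, ℂ)) : prim (conjC w) = conjC (prim w) := by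
  rw [prim_apply, prim_apply, rawPrim_conjC, mean_conjC, map_sub]
  rfl

/-- The reflection `w ↦ conj (w (-x))`. -/
def conjRefl (w : C(UnitAddCircle, ℂ)) : C(UnitAddCircle, ℂ) := conjC (refl w)

@[simp] lemma conjRefl_apply (w : C(UnitAddCircle, ℂ)) (x : UnitAddCircle) :
    conjRefl w x = conj (w (-x)) := rfl

lemma mean_conjRefl (w : C(UnitAddCircle, ℂ)) : mean (conjRefl w) = conj (mean w) := by
  rw [conjRefl, mean_conjC, mean_refl]

lemma prim_conjRefl (w : C(UnitAddCircle, ℂ)) : prim (conjRefl w) = -conjRefl (prim w) := by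
  rw [conjRefl, prim_conjC, prim_refl, map_neg, conjRefl]

lemma phaseOp_apply (b : ℝ) (z : C(UnitAddCircle, ℂ)) :
    phaseOp b z = z + b • mulI (prim z) := rfl

lemma phaseOp_conjRefl (b : ℝ) (z : C(UnitAddCircle, ℂ)) :
    phaseOp b (conjRefl z) = conjRefl (phaseOp b z) := by
  rw [phaseOp_apply, phaseOp_apply, prim_conjRefl]
  ext x
  simp

/-- Both `prim` and multiplication by `i` anticommute with `conjRefl`, so `phaseOp` commutes with
it, and each term of `slowPrim` contains one further sign. -/
lemma slowPrim_conjRefl {b : ℝ} (hb : IsUnit (phaseOp b)) (w : C(UnitAddCircle, ℂ)) :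
    slowPrim b (conjRefl w) = -conjRefl (slowPrim b w) := by
  have hinv : Ring.inverse (phaseOp b) (conjRefl w) = conjRefl (Ring.inverse (phaseOp b) w) := by
    have h1 (y : C(UnitAddCircle, ℂ)) : phaseOp b (Ring.inverse (phaseOp b) y) = y :=
      congrArg (fun L : C(UnitAddCircle, ℂ) →L[ℝ] C(UnitAddCircle, ℂ) => L y)
        (Ring.mul_inverse_cancel _ hb)
    have h2 (y : C(UnitAddCircle, ℂ)) : Ring.inverse (phaseOp b) (phaseOp b y) = y :=
      congrArg (fun L : C(UnitAddCircle, ℂ) →L[ℝ] C(UnitAddCircle, ℂ) => L y)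
        (Ring.inverse_mul_cancel _ hb)
    rw [← h2 (conjRefl (Ring.inverse (phaseOp b) w)), phaseOp_conjRefl, h1]
  have h3 (y : C(UnitAddCircle, ℂ)) (x : UnitAddCircle) : slowPrim b y x =
      -(Complex.I * mean y) + b * prim (Ring.inverse (phaseOp b) y) x := by
    change -(Complex.I * mean y) + b • prim (Ring.inverse (phaseOp b) y) x = _
    rw [Complex.real_smul]
  ext x
  rw [ContinuousMap.neg_apply, conjRefl_apply, h3, h3, hinv, prim_conjRefl, mean_conjRefl,
    ContinuousMap.neg_apply, conjRefl_apply]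
  simp only [map_add, map_neg, map_mul, Complex.conj_I, Complex.conj_ofReal]
  ring

section Symmetry

variable {b : ℝ} {u : C(UnitAddCircle, ℝ)}

lemma IsOdd.conjRefl_expi (hu : IsOdd u) : conjRefl (expi u) = expi u := by
  ext x
  rw [conjRefl_apply, expi_apply, expi_apply, ← Complex.exp_conj, hu.apply_neg]
  simp

lemma IsOdd.pos_neg (hu : IsOdd u) (hb : IsUnit (phaseOp b)) (x : UnitAddCircle) :
    pos b u (-x) = -conj (pos b u x) := by
  have h := slowPrim_conjRefl hb (expi u)
  rw [hu.conjRefl_expi] at h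
  have h1 := congrArg (fun w : C(UnitAddCircle, ℂ) => w (-x)) h
  rw [ContinuousMap.neg_apply, conjRefl_apply, neg_neg] at h1
  exact h1

lemma IsOdd.frame_neg (hu : IsOdd u) (hb : IsUnit (phaseOp b)) (x : UnitAddCircle) :
    (expi (-u) * pos b u) (-x) = -conj ((expi (-u) * pos b u) x) := by
  have h1 := congrArg (fun w : C(UnitAddCircle, ℂ) => w (-x)) hu.neg.conjRefl_expi
  rw [conjRefl_apply, neg_neg] at h1
  rw [ContinuousMap.mul_apply, ContinuousMap.mul_apply, hu.pos_neg hb, ← h1, map_mul]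
  ring

lemma IsOdd.normalPart_neg (hu : IsOdd u) (hb : IsUnit (phaseOp b)) (x : UnitAddCircle) :
    normalPart b u (-x) = normalPart b u x := by
  rw [normalPart, imC_apply, hu.frame_neg hb, imC_apply, Complex.neg_im, Complex.conj_im, neg_neg]

lemma IsOdd.isOdd_re_frame (hu : IsOdd u) (hb : IsUnit (phaseOp b)) :
    IsOdd (reC (expi (-u) * pos b u)) := by
  ext x
  rw [refl_apply, reC_apply, hu.frame_neg hb, Complex.neg_re, Complex.conj_re]
  rfl

/-- Hence the odd projection in `residual`, which allows working in the space of all continuous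
functions, changes nothing at a zero. -/
lemma IsOdd.isOdd_im_force (hu : IsOdd u) (hb : IsUnit (phaseOp b)) (μ : ℝ) :
    IsOdd (imC (force b u μ)) := by
  set w := ofRealC (normalPart b u) * expi u with hw
  have h0 : conjRefl w = w := by
    ext x
    have h1 := congrArg (fun w : C(UnitAddCircle, ℂ) => w x) hu.conjRefl_expi
    rw [conjRefl_apply] at h1
    rw [conjRefl_apply, hw, ContinuousMap.mul_apply, map_mul, h1, ofRealC_apply,
      hu.normalPart_neg hb, Complex.conj_ofReal]
    rfl
  have h2 := slowPrim_conjRefl hb w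
  rw [h0] at h2
  ext x
  have h3 := congrArg (fun w : C(UnitAddCircle, ℂ) => w (-x)) h2
  have h4 := congrArg (fun w : C(UnitAddCircle, ℂ) => w (-x)) hu.neg.conjRefl_expi
  rw [ContinuousMap.neg_apply, conjRefl_apply, neg_neg] at h3
  rw [conjRefl_apply, neg_neg] at h4
  rw [refl_apply, ContinuousMap.neg_apply, imC_apply, imC_apply, force, ← hw,
    ContinuousMap.smul_apply, mulI_apply, ContinuousMap.mul_apply, ContinuousMap.smul_apply,
    mulI_apply, ContinuousMap.mul_apply, h3, ← h4]
  simp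

end Symmetry

/-- The differential equations for a solution of the expander equations. -/
structure IsSolution (b μ : ℝ) (u : C(UnitAddCircle, ℝ)) : Prop where
  unit : IsUnit (phaseOp b)
  isOdd : IsOdd u
  eq_prim4 : u = prim4 (imC (force b u μ))
  energy : mean (reC (force b u μ)) + 3 / 2 * mean (u * imC (force b u μ)) = 0

lemma isSolution_of_expanderMap_eq_zero {b μ : ℝ} {v : C(UnitAddCircle, ℝ)}
    (hb : IsUnit (phaseOp b)) (h : expanderMap (b, v, μ) = 0) : IsSolution b μ v := by
  have h0 : expanderMap (b, v, μ) = residual v (force b (odd v) μ) := by rw [expanderMap]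
  rw [h0, residual_eq] at h
  obtain ⟨h1, h2⟩ := Prod.mk.inj h
  have hodd : IsOdd v := by
    rw [sub_eq_zero.1 h1]
    exact (isOdd_odd _).prim4
  rw [hodd.odd_eq] at h1 h2
  rw [(hodd.isOdd_im_force hb μ).odd_eq] at h1
  exact ⟨hb, hodd, sub_eq_zero.1 h1, h2⟩

end CircleFun

/-! ### Differential equations, first integral and smoothness of the solutions. -/

lemma contDiff_succ_of_hasDerivAt {F : Type*} [NormedAddCommGroup F] [NormedSpace ℝ F]
    {f f' : ℝ → F} (h : ∀ s, HasDerivAt f (f' s) s) {n : ℕ} (hf' : ContDiff ℝ n f') :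
    ContDiff ℝ (n + 1 : ℕ) f := by
  have hd : deriv f = f' := funext fun s => (h s).deriv
  rw [Nat.cast_add, Nat.cast_one, contDiff_succ_iff_deriv]
  refine ⟨fun s => (h s).differentiableAt, fun hn => ?_, hd ▸ hf'⟩
  exact absurd hn (by simp)

namespace CircleFun

/-- The derivative of the angle of a solution. -/
def angleD1 (b μ : ℝ) (u : C(UnitAddCircle, ℝ)) : C(UnitAddCircle, ℝ) :=
  prim (prim (prim (imC (force b u μ))))

/-- The second derivative of the angle of a solution. -/
def angleD2 (b μ : ℝ) (u : C(UnitAddCircle, ℝ)) : C(UnitAddCircle, ℝ) :=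
  prim (prim (imC (force b u μ)))

/-- The third derivative of the angle of a solution. -/
def angleD3 (b μ : ℝ) (u : C(UnitAddCircle, ℝ)) : C(UnitAddCircle, ℝ) :=
  prim (imC (force b u μ))

lemma hasDerivAt_expi_coe {w : C(UnitAddCircle, ℝ)} {s c : ℝ}
    (h : HasDerivAt (fun s : ℝ => w (s : UnitAddCircle)) c s) :
    HasDerivAt (fun s : ℝ => expi w (s : UnitAddCircle))
      (Complex.I * c * expi w (s : UnitAddCircle)) s := by
  simp only [expi_apply]
  refine (h.ofReal_comp.const_mul Complex.I).cexp.congr_deriv ?_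
  ring

lemma hasDerivAt_expi_neg_coe {w : C(UnitAddCircle, ℝ)} {s c : ℝ}
    (h : HasDerivAt (fun s : ℝ => w (s : UnitAddCircle)) c s) :
    HasDerivAt (fun s : ℝ => expi (-w) (s : UnitAddCircle))
      (-(Complex.I * c) * expi (-w) (s : UnitAddCircle)) s := by
  refine (hasDerivAt_expi_coe (w := -w) h.neg).congr_deriv ?_
  push_cast
  ring

lemma expi_neg_mul_expi (w : C(UnitAddCircle, ℝ)) (x : UnitAddCircle) :
    expi (-w) x * expi w x = 1 := by
  rw [expi_apply, expi_apply, ← Complex.exp_add, ContinuousMap.neg_apply]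
  simp

lemma hasDerivAt_angleD1 (b μ : ℝ) (u : C(UnitAddCircle, ℝ)) (s : ℝ) :
    HasDerivAt (fun s : ℝ => angleD1 b μ u (s : UnitAddCircle))
      (angleD2 b μ u (s : UnitAddCircle)) s := by
  have h1 := hasDerivAt_prim (angleD2 b μ u) s
  have h3 : mean (angleD2 b μ u) = 0 := mean_prim _
  rwa [h3, sub_zero] at h1

lemma hasDerivAt_angleD2 (b μ : ℝ) (u : C(UnitAddCircle, ℝ)) (s : ℝ) :
    HasDerivAt (fun s : ℝ => angleD2 b μ u (s : UnitAddCircle))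
      (angleD3 b μ u (s : UnitAddCircle)) s := by
  have h1 := hasDerivAt_prim (angleD3 b μ u) s
  have h3 : mean (angleD3 b μ u) = 0 := mean_prim _
  rwa [h3, sub_zero] at h1

namespace IsSolution

variable {b μ : ℝ} {u : C(UnitAddCircle, ℝ)}

lemma hasDerivAt_angle (h : IsSolution b μ u) (s : ℝ) :
    HasDerivAt (fun s : ℝ => u (s : UnitAddCircle)) (angleD1 b μ u (s : UnitAddCircle)) s := by
  have h1 := hasDerivAt_prim (angleD1 b μ u) s
  have h2 : prim (angleD1 b μ u) = u := h.eq_prim4.symm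
  have h3 : mean (angleD1 b μ u) = 0 := mean_prim _
  rwa [h2, h3, sub_zero] at h1

lemma hasDerivAt_angleD3 (h : IsSolution b μ u) (s : ℝ) :
    HasDerivAt (fun s : ℝ => angleD3 b μ u (s : UnitAddCircle))
      (force b u μ (s : UnitAddCircle)).im s := by
  have h1 := hasDerivAt_prim (imC (force b u μ)) s
  rwa [(h.isOdd.isOdd_im_force h.unit μ).mean_eq_zero, sub_zero] at h1

lemma hasDerivAt_frame (h : IsSolution b μ u) (s : ℝ) :
    HasDerivAt (fun s : ℝ => (expi (-u) * pos b u) (s : UnitAddCircle))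
      (b - Complex.I * (b + angleD1 b μ u (s : UnitAddCircle)) *
        (expi (-u) * pos b u) (s : UnitAddCircle)) s := by
  refine ((hasDerivAt_expi_neg_coe (h.hasDerivAt_angle s)).mul
    (hasDerivAt_slowPrim h.unit (expi u) s)).congr_deriv ?_
  have h1 := expi_neg_mul_expi u (s : UnitAddCircle)
  rw [ContinuousMap.mul_apply, pos]
  linear_combination (b : ℂ) * h1

lemma hasDerivAt_force (h : IsSolution b μ u) (s : ℝ) :
    HasDerivAt (fun s : ℝ => force b u μ (s : UnitAddCircle))
      (Complex.I * μ * b * normalPart b u (s : UnitAddCircle) -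
        Complex.I * (b + angleD1 b μ u (s : UnitAddCircle)) * force b u μ (s : UnitAddCircle)) s := by
  set w := ofRealC (normalPart b u) * expi u with hw
  have h2 (s : ℝ) : force b u μ (s : UnitAddCircle) = μ * Complex.I *
      (expi (-u) (s : UnitAddCircle) * slowPrim b w (s : UnitAddCircle)) := by
    rw [force, ContinuousMap.smul_apply, Complex.real_smul, mulI_apply, mul_assoc]
    rfl
  simp only [h2]
  refine (((hasDerivAt_expi_neg_coe (h.hasDerivAt_angle s)).mul
    (hasDerivAt_slowPrim h.unit w s)).const_mul ((μ : ℂ) * Complex.I)).congr_deriv ?_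
  have h1 := expi_neg_mul_expi u (s : UnitAddCircle)
  have h3 : w (s : UnitAddCircle) = normalPart b u (s : UnitAddCircle) * expi u (s : UnitAddCircle) :=
    rfl
  rw [h3]
  linear_combination (μ * Complex.I * b * normalPart b u (s : UnitAddCircle) : ℂ) * h1

/-- The first integral of the equations. -/
lemma re_force (h : IsSolution b μ u) (s : ℝ) :
    (force b u μ (s : UnitAddCircle)).re =
      (b + angleD1 b μ u (s : UnitAddCircle)) * angleD3 b μ u (s : UnitAddCircle) -
        1 / 2 * angleD2 b μ u (s : UnitAddCircle) ^ 2 := by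
  set e : C(UnitAddCircle, ℝ) := reC (force b u μ) - (b • angleD3 b μ u +
    angleD1 b μ u * angleD3 b μ u - (1 / 2 : ℝ) • (angleD2 b μ u * angleD2 b μ u)) with he
  -- The equations only show that `e` is constant. The scalar equation `energy` is the statement
  -- that its mean is zero, after integration by parts.
  have hd (s : ℝ) : HasDerivAt (fun s : ℝ => e (s : UnitAddCircle)) 0 s := by
    have h1 := (Complex.reCLM.hasFDerivAt.comp_hasDerivAt s (h.hasDerivAt_force s)).sub
      ((((h.hasDerivAt_angleD3 s).const_mul b).add
        ((hasDerivAt_angleD1 b μ u s).mul (h.hasDerivAt_angleD3 s))).sub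
        (((hasDerivAt_angleD2 b μ u s).mul (hasDerivAt_angleD2 b μ u s)).const_mul (1 / 2 : ℝ)))
    refine h1.congr_deriv ?_
    simp
    ring
  have hconst : e = ContinuousMap.const _ (e ((0 : ℝ) : UnitAddCircle)) :=
    ext_real fun s => eq_of_hasDerivAt_zero hd s 0
  have hmean : mean e = 0 := by
    have h1 : mean (angleD1 b μ u * angleD3 b μ u) = -mean (angleD2 b μ u * angleD2 b μ u) := by
      have := mean_mul_prim (angleD2 b μ u) (angleD3 b μ u)
      change mean (angleD2 b μ u * angleD2 b μ u) = -mean (angleD1 b μ u * angleD3 b μ u) at this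
      rw [this, neg_neg]
    have h2 : mean (u * imC (force b u μ)) = mean (angleD2 b μ u * angleD2 b μ u) := by
      have := mean_mul_prim (angleD1 b μ u) (imC (force b u μ))
      change mean (angleD1 b μ u * angleD3 b μ u) =
        -mean (prim (angleD1 b μ u) * imC (force b u μ)) at this
      have h3 : prim (angleD1 b μ u) = u := h.eq_prim4.symm
      rw [h3, h1] at this
      exact (neg_injective this).symm
    have h4 : mean (angleD3 b μ u) = 0 := mean_prim _
    have h5 := h.energy
    rw [h2] at h5
    rw [he, map_sub, map_sub, map_add, map_smul, map_smul, h1, h4, smul_eq_mul, smul_eq_mul]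
    linarith
  have h0 : e ((0 : ℝ) : UnitAddCircle) = 0 := by rw [hconst, mean_const] at hmean; exact hmean
  have h1 : e (s : UnitAddCircle) = 0 := (eq_of_hasDerivAt_zero hd s 0).trans h0
  have h2 : e (s : UnitAddCircle) = (force b u μ (s : UnitAddCircle)).re -
      (b * angleD3 b μ u (s : UnitAddCircle) + angleD1 b μ u (s : UnitAddCircle) *
        angleD3 b μ u (s : UnitAddCircle) - 1 / 2 * (angleD2 b μ u (s : UnitAddCircle) *
          angleD2 b μ u (s : UnitAddCircle))) := rfl
  linarith

/-- The fifth derivative of the angle. -/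
lemma hasDerivAt_im_force (h : IsSolution b μ u) (s : ℝ) :
    HasDerivAt (fun s : ℝ => (force b u μ (s : UnitAddCircle)).im)
      (μ * b * normalPart b u (s : UnitAddCircle) -
        (b + angleD1 b μ u (s : UnitAddCircle)) * (force b u μ (s : UnitAddCircle)).re) s := by
  refine (Complex.imCLM.hasFDerivAt.comp_hasDerivAt s (h.hasDerivAt_force s)).congr_deriv ?_
  simp

/-- Bootstrapping: the listed functions form a closed system, in which each derivative is a smooth
expression in the others. -/
lemma contDiff_all (h : IsSolution b μ u) (n : ℕ) :
    ContDiff ℝ n (fun s : ℝ => u (s : UnitAddCircle)) ∧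
    ContDiff ℝ n (fun s : ℝ => angleD1 b μ u (s : UnitAddCircle)) ∧
    ContDiff ℝ n (fun s : ℝ => angleD2 b μ u (s : UnitAddCircle)) ∧
    ContDiff ℝ n (fun s : ℝ => angleD3 b μ u (s : UnitAddCircle)) ∧
    ContDiff ℝ n (fun s : ℝ => pos b u (s : UnitAddCircle)) ∧
    ContDiff ℝ n (fun s : ℝ => force b u μ (s : UnitAddCircle)) := by
  induction n with
  | zero => exact ⟨contDiff_zero.2 (continuous_coe _), contDiff_zero.2 (continuous_coe _),
      contDiff_zero.2 (continuous_coe _), contDiff_zero.2 (continuous_coe _),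
      contDiff_zero.2 (continuous_coe _), contDiff_zero.2 (continuous_coe _)⟩
  | succ n ih =>
    obtain ⟨h0, h1, h2, h3, h4, h5⟩ := ih
    have hre (z : ℝ → ℝ) (hz : ContDiff ℝ n z) : ContDiff ℝ n fun s => (z s : ℂ) :=
      Complex.ofRealCLM.contDiff.comp hz
    have he : ContDiff ℝ n (fun s : ℝ => expi u (s : UnitAddCircle)) := by
      simp only [expi_apply]
      exact (contDiff_const.mul (hre _ h0)).cexp
    have he' : ContDiff ℝ n (fun s : ℝ => expi (-u) (s : UnitAddCircle)) := by
      simp only [expi_apply, ContinuousMap.neg_apply]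
      exact (contDiff_const.mul (hre _ h0.neg)).cexp
    have hB : ContDiff ℝ n (fun s : ℝ => normalPart b u (s : UnitAddCircle)) :=
      Complex.imCLM.contDiff.comp (he'.mul h4)
    refine ⟨contDiff_succ_of_hasDerivAt h.hasDerivAt_angle h1,
      contDiff_succ_of_hasDerivAt (hasDerivAt_angleD1 b μ u) h2,
      contDiff_succ_of_hasDerivAt (hasDerivAt_angleD2 b μ u) h3,
      contDiff_succ_of_hasDerivAt h.hasDerivAt_angleD3 (Complex.imCLM.contDiff.comp h5),
      contDiff_succ_of_hasDerivAt (hasDerivAt_slowPrim h.unit (expi u))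
        ((contDiff_const.mul he).sub (contDiff_const.mul h4)),
      contDiff_succ_of_hasDerivAt h.hasDerivAt_force
        ((contDiff_const.mul (hre _ hB)).sub
          ((contDiff_const.mul (contDiff_const.add (hre _ h1))).mul h5))⟩

end IsSolution

end CircleFun

/-! ### The farthest points of a lobe. -/

/-- A strict maximum at `0` that persists under perturbations of the second derivative. -/
lemma exists_robust_strict_max {a₀ c₀ : ℝ → ℝ} (ha : Continuous a₀) (hc : Continuous c₀)
    (hneg : ∀ s ∈ Ioo (0 : ℝ) (1 / 2), a₀ s < 0) (hc0 : c₀ 0 < 0) :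
    ∃ δ > 0, ∀ (a c g : ℝ → ℝ) (b : ℝ), 0 < b → (∀ s, |a s - a₀ s| ≤ δ) →
      (∀ s, |c s - c₀ s| ≤ δ) → a 0 = 0 → (∀ s, HasDerivAt a (c s) s) →
      (∀ s, HasDerivAt g (2 * b * a s) s) → ∀ s ∈ Ioc (0 : ℝ) (1 / 2), g s < g 0 := by
  obtain ⟨ε, hε0, hε1, hε⟩ : ∃ ε > 0, ε < 1 / 2 ∧ ∀ s ∈ Icc (0 : ℝ) ε, c₀ s < c₀ 0 / 2 := by
    have h1 : ∀ᶠ s in 𝓝 (0 : ℝ), c₀ s < c₀ 0 / 2 :=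
      hc.continuousAt.eventually_lt continuousAt_const (by linarith)
    obtain ⟨r, hr, hr'⟩ := Metric.eventually_nhds_iff.1 h1
    refine ⟨min (r / 2) (1 / 4), by positivity, ?_, fun s hs => hr' ?_⟩
    · exact (min_le_right _ _).trans_lt (by norm_num)
    · have := hs.2.trans (min_le_left _ _)
      rw [Real.dist_eq, sub_zero, abs_of_nonneg hs.1]
      linarith
  set A : ℝ → ℝ := fun s => ∫ t in (0 : ℝ)..s, a₀ t with hA
  have hAd (s : ℝ) : HasDerivAt A (a₀ s) s :=
    intervalIntegral.integral_hasDerivAt_right (ha.intervalIntegrable _ _)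
      (ha.stronglyMeasurableAtFilter _ _) ha.continuousAt
  have hA0 : A 0 = 0 := intervalIntegral.integral_same
  have hAc : Continuous A := continuous_iff_continuousAt.2 fun s => (hAd s).continuousAt
  have hAa : StrictAntiOn A (Icc 0 (1 / 2)) := by
    refine strictAntiOn_of_deriv_neg (convex_Icc _ _) hAc.continuousOn fun s hs => ?_
    rw [interior_Icc] at hs
    rw [(hAd s).deriv]
    exact hneg s hs
  have hκ : A ε < 0 := by
    rw [← hA0]
    exact hAa ⟨le_rfl, by norm_num⟩ ⟨hε0.le, hε1.le⟩ hε0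
  -- The first bound keeps `c` negative on `[0, ε]`. The second keeps `A s + δ s` negative on `[ε,
  -- 1/2]`, where `δ s ≤ δ/2`.
  refine ⟨min (-c₀ 0 / 4) (-A ε), lt_min (by linarith) (by linarith),
    fun a c g b hb hda hdc ha0 had hgd s hs => ?_⟩
  set δ := min (-c₀ 0 / 4) (-A ε) with hδ
  have hδ1 : δ ≤ -c₀ 0 / 4 := min_le_left _ _
  have hδ2 : δ ≤ -A ε := min_le_right _ _
  have hδ0 : 0 < δ := lt_min (by linarith) (by linarith)
  have hac : Continuous a := continuous_iff_continuousAt.2 fun s => (had s).continuousAt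
  have hgc : Continuous g := continuous_iff_continuousAt.2 fun s => (hgd s).continuousAt
  rcases le_total s ε with hsε | hsε
  · have h1 : StrictAntiOn a (Icc 0 ε) := by
      refine strictAntiOn_of_deriv_neg (convex_Icc _ _) hac.continuousOn fun t ht => ?_
      rw [interior_Icc] at ht
      rw [(had t).deriv]
      have h2 := hε t ⟨ht.1.le, ht.2.le⟩
      have h3 := (abs_le.1 (hdc t)).2
      linarith
    have h2 : StrictAntiOn g (Icc 0 ε) := by
      refine strictAntiOn_of_deriv_neg (convex_Icc _ _) hgc.continuousOn fun t ht => ?_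
      rw [interior_Icc] at ht
      rw [(hgd t).deriv]
      have h3 := h1 ⟨le_rfl, hε0.le⟩ ⟨ht.1.le, ht.2.le⟩ ht.1
      rw [ha0] at h3
      exact mul_neg_of_pos_of_neg (by positivity) h3
    exact h2 ⟨le_rfl, hε0.le⟩ ⟨hs.1.le, hsε⟩ hs.1
  -- Away from `0` the sign of `a` is not controlled, since `a₀` may vanish at `1/2`; the estimate
  -- uses the integral of `a` instead.
  · have h1 : Antitone fun t => g t - 2 * b * (A t + δ * t) := by
      have h2 (t : ℝ) : HasDerivAt (fun t => g t - 2 * b * (A t + δ * t))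
          (2 * b * a t - 2 * b * (a₀ t + δ * 1)) t :=
        (hgd t).sub (((hAd t).add ((hasDerivAt_id t).const_mul δ)).const_mul (2 * b))
      refine antitone_of_deriv_nonpos (fun t => (h2 t).differentiableAt) fun t => ?_
      rw [(h2 t).deriv]
      have h3 := (abs_le.1 (hda t)).2
      have h4 := mul_nonneg hb.le (sub_nonneg.2 h3)
      linarith
    have h2 := h1 hs.1.le
    have h3 : A s ≤ A ε := hAa.antitoneOn ⟨hε0.le, hε1.le⟩ ⟨hs.1.le, hs.2⟩ hsε
    simp only [hA0, mul_zero, add_zero, sub_zero] at h2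
    have h4 : δ * s ≤ δ * (1 / 2) := mul_le_mul_of_nonneg_left hs.2 hδ0.le
    have h5 : A s + δ * s < 0 := by linarith
    have h6 : 2 * b * (A s + δ * s) < 0 := mul_neg_of_pos_of_neg (by positivity) h5
    linarith

namespace CircleFun

variable {f : ℝ} {u₀ : C(UnitAddCircle, ℝ)}

/-- The tangential part of the position. -/
def tangentPart (b : ℝ) (u : C(UnitAddCircle, ℝ)) : C(UnitAddCircle, ℝ) :=
  reC (expi (-u) * pos b u)

/-- The derivative of the tangential part. -/
def tangentPartDeriv (b μ : ℝ) (u : C(UnitAddCircle, ℝ)) : C(UnitAddCircle, ℝ) :=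
  b • 1 + (b • 1 + angleD1 b μ u) * normalPart b u

lemma IsSolution.hasDerivAt_tangentPart {b μ : ℝ} {u : C(UnitAddCircle, ℝ)}
    (h : IsSolution b μ u) (s : ℝ) :
    HasDerivAt (fun s : ℝ => tangentPart b u (s : UnitAddCircle))
      (tangentPartDeriv b μ u (s : UnitAddCircle)) s := by
  refine (Complex.reCLM.hasFDerivAt.comp_hasDerivAt s (h.hasDerivAt_frame s)).congr_deriv ?_
  have h1 : tangentPartDeriv b μ u (s : UnitAddCircle) = b * 1 +
    (b * 1 + angleD1 b μ u (s : UnitAddCircle)) *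
      ((expi (-u) * pos b u) (s : UnitAddCircle)).im := rfl
  rw [h1]
  set F := (expi (-u) * pos b u) (s : UnitAddCircle)
  simp

lemma norm_frame (b : ℝ) (u : C(UnitAddCircle, ℝ)) (x : UnitAddCircle) :
    ‖(expi (-u) * pos b u) x‖ = ‖pos b u x‖ := by
  rw [ContinuousMap.mul_apply, norm_mul, expi_apply, mul_comm Complex.I,
    Complex.norm_exp_ofReal_mul_I, one_mul]

/-- The rotation term of the frame is orthogonal to the position and does not contribute. -/
lemma IsSolution.hasDerivAt_normSq_pos {b μ : ℝ} {u : C(UnitAddCircle, ℝ)}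
    (h : IsSolution b μ u) (s : ℝ) :
    HasDerivAt (fun s : ℝ => ‖pos b u (s : UnitAddCircle)‖ ^ 2)
      (2 * b * tangentPart b u (s : UnitAddCircle)) s := by
  have h1 := Complex.reCLM.hasFDerivAt.comp_hasDerivAt s (h.hasDerivAt_frame s)
  have h2 := Complex.imCLM.hasFDerivAt.comp_hasDerivAt s (h.hasDerivAt_frame s)
  have h3 : (fun s : ℝ => ‖pos b u (s : UnitAddCircle)‖ ^ 2) = fun s : ℝ =>
      ((expi (-u) * pos b u) (s : UnitAddCircle)).re *
        ((expi (-u) * pos b u) (s : UnitAddCircle)).re +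
      ((expi (-u) * pos b u) (s : UnitAddCircle)).im *
        ((expi (-u) * pos b u) (s : UnitAddCircle)).im := by
    funext s
    rw [← norm_frame, Complex.sq_norm, Complex.normSq_apply]
  rw [h3]
  refine ((h1.mul h1).add (h2.mul h2)).congr_deriv ?_
  have h4 : tangentPart b u (s : UnitAddCircle) =
    ((expi (-u) * pos b u) (s : UnitAddCircle)).re := rfl
  rw [h4]
  simp only [Function.comp_apply]
  set F := (expi (-u) * pos b u) (s : UnitAddCircle)
  simp
  ring

lemma continuousAt_tangentPart (μ₀ : ℝ) : ContinuousAt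
    (fun x : ℝ × C(UnitAddCircle, ℝ) × ℝ => tangentPart x.1 (odd x.2.1)) (0, u₀, μ₀) :=
  reC.continuous.continuousAt.comp (contDiffAt_frame u₀ μ₀).continuousAt

lemma continuousAt_tangentPartDeriv (μ₀ : ℝ) : ContinuousAt
    (fun x : ℝ × C(UnitAddCircle, ℝ) × ℝ => tangentPartDeriv x.1 x.2.2 (odd x.2.1))
    (0, u₀, μ₀) := by
  have h1 : ContinuousAt (fun x : ℝ × C(UnitAddCircle, ℝ) × ℝ => normalPart x.1 (odd x.2.1))
      (0, u₀, μ₀) :=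
    imC.continuous.continuousAt.comp (contDiffAt_frame u₀ μ₀).continuousAt
  have h2 : ContinuousAt
      (fun x : ℝ × C(UnitAddCircle, ℝ) × ℝ => angleD1 x.1 x.2.2 (odd x.2.1)) (0, u₀, μ₀) :=
    (prim ∘L prim ∘L prim ∘L imC).continuous.continuousAt.comp
      (contDiffAt_force u₀ μ₀).continuousAt
  have h3 : ContinuousAt (fun x : ℝ × C(UnitAddCircle, ℝ) × ℝ =>
      x.1 • (1 : C(UnitAddCircle, ℝ))) (0, u₀, μ₀) :=
    (continuous_fst.smul continuous_const).continuousAt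
  exact h3.add ((h3.add h2).mul h1)

lemma IsProfile.tangentPart_zero (h : IsProfile f u₀) :
    tangentPart 0 u₀ = -(mean (cosC u₀)) • sinC u₀ := by
  ext x
  rw [tangentPart, reC_apply, frame_zero h.isOdd, Complex.add_re, Complex.ofReal_re,
    Complex.re_ofReal_mul, Complex.I_re, mul_zero, add_zero, ContinuousMap.smul_apply, sinC_apply,
    smul_eq_mul, neg_mul]

/-- At the end of the lobe the value is `-u₀'(0) mean (cos u₀)`, so the positive slope of the
profile makes the maximum nondegenerate. -/
lemma IsProfile.tangentPartDeriv_zero_neg (h : IsProfile f u₀) :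
    tangentPartDeriv 0 (profileMultiplier f u₀) u₀ ((0 : ℝ) : UnitAddCircle) < 0 := by
  have h1 : imC (force 0 u₀ (profileMultiplier f u₀)) = f • sinC u₀ := by
    rw [force_zero h.isOdd, h.profileMultiplier_mul, map_neg, map_smul, imC_expi]
    ext x
    simp
  have h2 : tangentPartDeriv 0 (profileMultiplier f u₀) u₀ ((0 : ℝ) : UnitAddCircle) =
      prim (prim (prim (f • sinC u₀))) ((0 : ℝ) : UnitAddCircle) * -mean (cosC u₀) := by
    rw [tangentPartDeriv, zero_smul, zero_add, zero_add, angleD1, h1, normalPart_zero h.isOdd,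
      ContinuousMap.mul_apply, ContinuousMap.smul_apply, h.cosC_zero, smul_eq_mul, mul_one]
  rw [h2]
  exact mul_neg_of_pos_of_neg h.slope (by linarith [h.mean_cos_pos])

/-- For every small rotation number there is a solution whose distance to the origin has its only
maximum at the ends of the lobes. -/
theorem exists_isSolution : ∃ b₀ > 0, ∀ b ∈ Ioo (0 : ℝ) b₀, ∃ (μ : ℝ) (u : C(UnitAddCircle, ℝ)),
    0 < μ ∧ IsSolution b μ u ∧ ∀ s ∈ Ioc (0 : ℝ) (1 / 2),
      ‖pos b u (s : UnitAddCircle)‖ < ‖pos b u ((0 : ℝ) : UnitAddCircle)‖ := by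
  obtain ⟨f, u₀, h⟩ := exists_isProfile
  set μ₀ := profileMultiplier f u₀ with hμ₀
  have hpi := Real.pi_pos
  obtain ⟨δ, hδ, hmax⟩ := exists_robust_strict_max (continuous_coe (tangentPart 0 u₀))
    (continuous_coe (tangentPartDeriv 0 μ₀ u₀)) (fun s hs => by
      have h1 := h.bound s hs
      rw [h.tangentPart_zero, ContinuousMap.smul_apply, smul_eq_mul, sinC_apply]
      exact mul_neg_of_neg_of_pos (by linarith [h.mean_cos_pos])
        (Real.sin_pos_of_pos_of_lt_pi h1.1 (by linarith))) h.tangentPartDeriv_zero_neg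
  have h1 : ∀ᶠ x : ℝ × C(UnitAddCircle, ℝ) × ℝ in 𝓝 (0, u₀, μ₀),
      ‖tangentPart x.1 (odd x.2.1) - tangentPart 0 u₀‖ < δ := by
    have := (continuousAt_tangentPart (u₀ := u₀) μ₀).eventually (Metric.ball_mem_nhds _ hδ)
    filter_upwards [this] with x hx
    rw [dist_eq_norm] at hx
    rwa [h.isOdd.odd_eq] at hx
  have h2 : ∀ᶠ x : ℝ × C(UnitAddCircle, ℝ) × ℝ in 𝓝 (0, u₀, μ₀),
      ‖tangentPartDeriv x.1 x.2.2 (odd x.2.1) - tangentPartDeriv 0 μ₀ u₀‖ < δ := by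
    have := (continuousAt_tangentPartDeriv (u₀ := u₀) μ₀).eventually (Metric.ball_mem_nhds _ hδ)
    filter_upwards [this] with x hx
    rw [dist_eq_norm] at hx
    rwa [h.isOdd.odd_eq] at hx
  have h3 : ∀ᶠ x : ℝ × C(UnitAddCircle, ℝ) × ℝ in 𝓝 (0, u₀, μ₀), 0 < x.2.2 :=
    continuous_snd.snd.continuousAt.eventually (lt_mem_nhds h.profileMultiplier_pos)
  obtain ⟨b₀, hb₀, hb⟩ := Metric.eventually_nhds_iff.1
    ((h.eventually_exists (h1.and (h2.and h3))).and eventually_isUnit_phaseOp)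
  refine ⟨b₀, hb₀, fun b hbb => ?_⟩
  obtain ⟨⟨⟨u, μ⟩, ⟨hx1, hx2, hx3⟩, hx⟩, hunit⟩ := hb (y := b) (by
    rw [Real.dist_eq, sub_zero, abs_of_pos hbb.1]; exact hbb.2)
  have hsol := isSolution_of_expanderMap_eq_zero hunit hx
  simp only [hsol.isOdd.odd_eq] at hx1 hx2
  refine ⟨μ, u, hx3, hsol, fun s hs => ?_⟩
  have hsq := hmax (fun s : ℝ => tangentPart b u (s : UnitAddCircle))
    (fun s : ℝ => tangentPartDeriv b μ u (s : UnitAddCircle))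
    (fun s : ℝ => ‖pos b u (s : UnitAddCircle)‖ ^ 2) b hbb.1
    (fun s => (norm_apply_le (tangentPart b u - tangentPart 0 u₀) s).trans hx1.le)
    (fun s => (norm_apply_le (tangentPartDeriv b μ u - tangentPartDeriv 0 μ₀ u₀) s).trans hx2.le)
    (hsol.isOdd.isOdd_re_frame hunit).apply_zero hsol.hasDerivAt_tangentPart
    hsol.hasDerivAt_normSq_pos s hs
  exact lt_of_pow_lt_pow_left₀ 2 (norm_nonneg _) hsq

end CircleFun

/-! ### The flow of dilations and the profile equation in terms of the angle. -/

namespace PlaneCurve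

/-- `γ` has unit speed and the angle `θ`, and `k`, …, `k₄` are its curvature and the
derivatives of its curvature. -/
structure HasAngle (γ : ℝ → ℂ) (θ k k₁ k₂ k₃ k₄ : ℝ → ℝ) : Prop where
  curve : ∀ s, HasDerivAt γ (Complex.exp (Complex.I * θ s)) s
  angle : ∀ s, HasDerivAt θ (k s) s
  curv : ∀ s, HasDerivAt k (k₁ s) s
  curv₁ : ∀ s, HasDerivAt k₁ (k₂ s) s
  curv₂ : ∀ s, HasDerivAt k₂ (k₃ s) s
  curv₃ : ∀ s, HasDerivAt k₃ (k₄ s) s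

namespace HasAngle

variable {γ : ℝ → ℂ} {θ k k₁ k₂ k₃ k₄ : ℝ → ℝ}

lemma norm_deriv (h : HasAngle γ θ k k₁ k₂ k₃ k₄) (s : ℝ) : ‖deriv γ s‖ = 1 := by
  rw [(h.curve s).deriv, mul_comm, Complex.norm_exp_ofReal_mul_I]

variable {r : ℝ}

lemma arcDeriv_smul (h : HasAngle γ θ k k₁ k₂ k₃ k₄) (hr : 0 < r) {E : Type*}
    [NormedAddCommGroup E] [NormedSpace ℝ E] {f f' : ℝ → E} (hf : ∀ s, HasDerivAt f (f' s) s) :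
    arcDeriv (fun u => r • γ u) f = fun s => r⁻¹ • f' s := by
  funext s
  have h1 : deriv (fun u => r • γ u) s = r • deriv γ s :=
    ((h.curve s).differentiableAt.hasDerivAt.const_smul r).deriv
  rw [arcDeriv, h1, norm_smul, h.norm_deriv, mul_one, Real.norm_of_nonneg hr.le, (hf s).deriv]

lemma tangent_smul (h : HasAngle γ θ k k₁ k₂ k₃ k₄) (hr : 0 < r) :
    tangent (fun u => r • γ u) = fun s => Complex.exp (Complex.I * θ s) := by
  have h1 := h.arcDeriv_smul hr (f := fun u => r • γ u) fun s => (h.curve s).const_smul r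
  rw [tangent, h1]
  funext s
  rw [smul_smul, inv_mul_cancel₀ hr.ne', one_smul]

lemma normal_smul (h : HasAngle γ θ k k₁ k₂ k₃ k₄) (hr : 0 < r) :
    normal (fun u => r • γ u) = fun s => Complex.I * Complex.exp (Complex.I * θ s) := by
  funext s
  rw [normal, h.tangent_smul hr]

lemma curvature_smul (h : HasAngle γ θ k k₁ k₂ k₃ k₄) (hr : 0 < r) :
    curvature (fun u => r • γ u) = fun s => r⁻¹ * k s := by
  have h1 (s : ℝ) : HasDerivAt (fun s => Complex.exp (Complex.I * θ s))
      (k s • (Complex.I * Complex.exp (Complex.I * θ s))) s := by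
    refine ((h.angle s).ofReal_comp.const_mul Complex.I).cexp.congr_deriv ?_
    rw [Complex.real_smul]
    ring
  funext s
  rw [curvature, h.tangent_smul hr, h.arcDeriv_smul hr h1, h.normal_smul hr, inner_smul_left,
    inner_smul_left, real_inner_self_eq_norm_sq, norm_mul, Complex.norm_I, mul_comm Complex.I,
    Complex.norm_exp_ofReal_mul_I]
  simp

/-- The curvature and every arc-length derivative contribute a factor `r⁻¹`, so the gradient is
homogeneous of degree `-5`. -/
lemma idealGradient_smul (h : HasAngle γ θ k k₁ k₂ k₃ k₄) (hr : 0 < r) (s : ℝ) :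
    idealGradient (fun u => r • γ u) s =
      -(r⁻¹ ^ 5 * (k₄ s + k s ^ 2 * k₂ s - 1 / 2 * k s * k₁ s ^ 2)) := by
  have j1 : curvatureJet (fun u => r • γ u) 1 = fun s => r⁻¹ * (r⁻¹ * k₁ s) := by
    change arcDeriv _ (curvature _) = _
    rw [h.curvature_smul hr, h.arcDeriv_smul hr fun s => (h.curv s).const_mul r⁻¹]
    rfl
  have j2 : curvatureJet (fun u => r • γ u) 2 = fun s => r⁻¹ * (r⁻¹ * (r⁻¹ * k₂ s)) := by
    change arcDeriv _ (curvatureJet _ 1) = _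
    rw [j1, h.arcDeriv_smul hr fun s => ((h.curv₁ s).const_mul r⁻¹).const_mul r⁻¹]
    rfl
  have j3 : curvatureJet (fun u => r • γ u) 3 = fun s => r⁻¹ * (r⁻¹ * (r⁻¹ * (r⁻¹ * k₃ s))) := by
    have e : curvatureJet (fun u => r • γ u) 3 =
        arcDeriv (fun u => r • γ u) (curvatureJet (fun u => r • γ u) 2) :=
      Function.iterate_succ_apply' _ 2 _
    rw [e, j2, h.arcDeriv_smul hr fun s =>
      (((h.curv₂ s).const_mul r⁻¹).const_mul r⁻¹).const_mul r⁻¹]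
    rfl
  have j4 : curvatureJet (fun u => r • γ u) 4 s = r⁻¹ * (r⁻¹ * (r⁻¹ * (r⁻¹ * (r⁻¹ * k₄ s)))) := by
    have e : curvatureJet (fun u => r • γ u) 4 =
        arcDeriv (fun u => r • γ u) (curvatureJet (fun u => r • γ u) 3) :=
      Function.iterate_succ_apply' _ 3 _
    rw [e, j3, h.arcDeriv_smul hr fun s =>
      ((((h.curv₃ s).const_mul r⁻¹).const_mul r⁻¹).const_mul r⁻¹).const_mul r⁻¹]
    rfl
  rw [idealGradient, j4, j2, j1, h.curvature_smul hr]
  ring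

/-- A unit speed solution of the profile equation is a homothetic expander. -/
theorem isHomotheticExpander (h : HasAngle γ θ k k₁ k₂ k₃ k₄) {σ : ℝ} (hσ : 0 < σ)
    (he : ∀ s, k₄ s + k s ^ 2 * k₂ s - 1 / 2 * k s * k₁ s ^ 2 =
      σ * inner ℝ (γ s) (Complex.I * Complex.exp (Complex.I * θ s))) :
    IsHomotheticExpander γ := by
  have hone : (fun u => (1 : ℝ) • γ u) = γ := funext fun u => one_smul ℝ _
  -- By homogeneity the dilation factor must solve `ρ' = σ ρ⁻⁵`, `ρ(0) = 1`.
  refine ⟨⟨σ, hσ, fun s => ?_⟩, fun t => (1 + 6 * σ * t) ^ (1 / 6 : ℝ), ?_, ?_, ?_, ?_⟩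
  · have h1 := h.idealGradient_smul one_pos s
    have h2 := congrFun (h.normal_smul one_pos) s
    rw [hone] at h1 h2
    rw [h1, h2, he]
    ring
  · simp
  · intro x hx y hy hxy
    have hx' : 0 ≤ 6 * σ * x := mul_nonneg (by positivity) hx
    refine Real.rpow_lt_rpow (by linarith) ?_ (by norm_num)
    have := mul_lt_mul_of_pos_left hxy (show 0 < 6 * σ by positivity)
    linarith
  · refine (tendsto_rpow_atTop (by norm_num)).comp ?_
    exact tendsto_atTop_add_const_left _ _ (tendsto_id.const_mul_atTop (by positivity))
  · intro t ht s
    have ht' : 0 ≤ 6 * σ * t := mul_nonneg (by positivity) ht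
    have hp : 0 < 1 + 6 * σ * t := by linarith
    set ρ := (1 + 6 * σ * t) ^ (1 / 6 : ℝ) with hρ
    have hρ0 : 0 < ρ := Real.rpow_pos_of_pos hp _
    have hd : HasDerivAt (fun r : ℝ => (1 + 6 * σ * r) ^ (1 / 6 : ℝ)) (σ * ρ⁻¹ ^ 5) t := by
      have h1 : HasDerivAt (fun r : ℝ => 1 + 6 * σ * r) (6 * σ) t := by
        simpa using ((hasDerivAt_id t).const_mul (6 * σ)).const_add 1
      refine (h1.rpow_const (p := 1 / 6) (Or.inl hp.ne')).congr_deriv ?_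
      have h2 : ρ⁻¹ ^ 5 = (1 + 6 * σ * t) ^ ((1 / 6 : ℝ) - 1) := by
        rw [hρ, ← Real.rpow_neg hp.le, ← Real.rpow_natCast, ← Real.rpow_mul hp.le]
        norm_num
      rw [h2]
      ring
    have hd' := hd.smul_const (γ s)
    refine ⟨hd'.differentiableAt, ?_⟩
    rw [hd'.deriv, h.idealGradient_smul hρ0, h.normal_smul hρ0, he, inner_smul_left]
    simp only [conj_trivial]
    ring

end HasAngle

end PlaneCurve

/-! ### From solutions on the circle to lobed curves. -/

namespace CircleFun

/-- The curve that belongs to a solution. -/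
def lobeCurve (b : ℝ) (u : C(UnitAddCircle, ℝ)) (s : ℝ) : ℂ :=
  (b : ℂ)⁻¹ * Complex.exp (Complex.I * (b * s : ℝ)) * pos b u (s : UnitAddCircle)

variable {b μ : ℝ} {u : C(UnitAddCircle, ℝ)}

lemma IsSolution.hasAngle (h : IsSolution b μ u) (hb : 0 < b) :
    PlaneCurve.HasAngle (lobeCurve b u) (fun s => b * s + u (s : UnitAddCircle))
      (fun s => b + angleD1 b μ u (s : UnitAddCircle)) (fun s => angleD2 b μ u (s : UnitAddCircle))
      (fun s => angleD3 b μ u (s : UnitAddCircle)) (fun s => (force b u μ (s : UnitAddCircle)).im)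
      (fun s => μ * b * normalPart b u (s : UnitAddCircle) -
        (b + angleD1 b μ u (s : UnitAddCircle)) * (force b u μ (s : UnitAddCircle)).re) where
  curve s := by
    have hbs : HasDerivAt (fun s : ℝ => b * s) b s := by
      simpa using (hasDerivAt_id s).const_mul b
    have h1 := (hbs.ofReal_comp.const_mul Complex.I).cexp
    refine ((h1.const_mul (b : ℂ)⁻¹).mul (hasDerivAt_slowPrim h.unit (expi u) s)).congr_deriv ?_
    have hb' : (b : ℂ) ≠ 0 := Complex.ofReal_ne_zero.2 hb.ne'
    rw [Complex.ofReal_add, mul_add, Complex.exp_add, expi_apply]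
    field_simp
    ring
  angle s := by
    have hbs : HasDerivAt (fun s : ℝ => b * s) b s := by
      simpa using (hasDerivAt_id s).const_mul b
    exact hbs.add (h.hasDerivAt_angle s)
  curv s := (hasDerivAt_angleD1 b μ u s).const_add b
  curv₁ s := hasDerivAt_angleD2 b μ u s
  curv₂ s := h.hasDerivAt_angleD3 s
  curv₃ s := h.hasDerivAt_im_force s

lemma inner_lobeCurve (b : ℝ) (u : C(UnitAddCircle, ℝ)) (s : ℝ) :
    inner ℝ (lobeCurve b u s)
      (Complex.I * Complex.exp (Complex.I * (b * s + u (s : UnitAddCircle) : ℝ))) =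
    b⁻¹ * normalPart b u (s : UnitAddCircle) := by
  have h1 : conj (lobeCurve b u s) *
      (Complex.I * Complex.exp (Complex.I * (b * s + u (s : UnitAddCircle) : ℝ))) =
      (b⁻¹ : ℝ) * (Complex.I * conj ((expi (-u) * pos b u) (s : UnitAddCircle))) := by
    have h2 : conj (Complex.exp (Complex.I * (b * s : ℝ))) * Complex.exp (Complex.I * (b * s : ℝ)) =
        1 := by
      rw [← Complex.exp_conj, ← Complex.exp_add]
      simp
    rw [lobeCurve, Complex.ofReal_add, mul_add, Complex.exp_add, ContinuousMap.mul_apply, map_mul,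
      map_mul, map_mul, expi_apply (-u), ← Complex.exp_conj (Complex.I * _)]
    rw [← Complex.exp_conj] at h2
    have h3 : conj (Complex.I * ((-u) (s : UnitAddCircle) : ℝ)) =
        Complex.I * (u (s : UnitAddCircle) : ℝ) := by simp
    rw [← Complex.exp_conj (Complex.I * (((-u) (s : UnitAddCircle) : ℝ) : ℂ)), h3, map_inv₀,
      Complex.conj_ofReal, Complex.ofReal_inv]
    linear_combination ((b : ℂ)⁻¹ * conj (pos b u (s : UnitAddCircle)) * Complex.I *
      Complex.exp (Complex.I * (u (s : UnitAddCircle) : ℝ))) * h2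
  rw [Complex.inner, mul_comm, h1, Complex.re_ofReal_mul]
  simp [normalPart, add_comm]

/-- The first integral replaces `Re N` in the fifth derivative of the angle by `k k₂ - k₁²/2`, which
leaves `μ b` times `normalPart`. Since `⟨γ,ν⟩` is `normalPart / b`, the constant is `σ = μb²`. -/
lemma IsSolution.isHomotheticExpander (h : IsSolution b μ u) (hb : 0 < b) (hμ : 0 < μ) :
    PlaneCurve.IsHomotheticExpander (lobeCurve b u) := by
  refine (h.hasAngle hb).isHomotheticExpander (σ := μ * b ^ 2) (by positivity) fun s => ?_
  rw [inner_lobeCurve, h.re_force]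
  field_simp
  ring

lemma IsSolution.contDiff_lobeCurve (h : IsSolution b μ u) : ContDiff ℝ ∞ (lobeCurve b u) := by
  refine contDiff_infty.2 fun n => ?_
  have h1 : ContDiff ℝ n (fun s : ℝ => ((b * s : ℝ) : ℂ)) :=
    Complex.ofRealCLM.contDiff.comp (contDiff_const.mul contDiff_id)
  exact (contDiff_const.mul (contDiff_const.mul h1).cexp).mul (h.contDiff_all n).2.2.2.2.1

lemma lobeCurve_add_one (b : ℝ) (u : C(UnitAddCircle, ℝ)) (s : ℝ) :
    lobeCurve b u (s + 1) = Complex.exp (Complex.I * b) * lobeCurve b u s := by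
  rw [lobeCurve, lobeCurve, coe_add_one, mul_add, mul_one, Complex.ofReal_add, mul_add,
    Complex.exp_add]
  ring

lemma IsSolution.lobeCurve_neg (h : IsSolution b μ u) (s : ℝ) :
    lobeCurve b u (-s) = -conj (lobeCurve b u s) := by
  have h1 : conj (Complex.I * ((b * s : ℝ) : ℂ)) = Complex.I * ((b * -s : ℝ) : ℂ) := by
    simp
  rw [lobeCurve, lobeCurve, AddCircle.coe_neg, h.isOdd.pos_neg h.unit, map_mul, map_mul, map_inv₀,
    Complex.conj_ofReal, ← Complex.exp_conj, h1]
  ring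

lemma norm_lobeCurve (b : ℝ) (u : C(UnitAddCircle, ℝ)) (s : ℝ) :
    ‖lobeCurve b u s‖ = ‖(b : ℂ)⁻¹‖ * ‖pos b u (s : UnitAddCircle)‖ := by
  rw [lobeCurve, norm_mul, norm_mul, mul_comm Complex.I, Complex.norm_exp_ofReal_mul_I, mul_one]

end CircleFun

/-! ### Lobed curves: exact symmetry group and non-similarity. -/

namespace PlaneCurve

/-- A unit speed curve that consists of lobes of length `1`. Consecutive lobes are mapped to each
other by the rotation by the angle `b`, and each lobe has an axis of symmetry through `0`; the points
farthest from `0` are the ends of the lobes. -/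
structure IsLobed (b : ℝ) (γ : ℝ → ℂ) : Prop where
  smooth : ContDiff ℝ ∞ γ
  norm_deriv : ∀ s, ‖deriv γ s‖ = 1
  add_one : ∀ s, γ (s + 1) = Complex.exp (Complex.I * b) * γ s
  neg : ∀ s, γ (-s) = -conj (γ s)
  norm_lt : ∀ s ∈ Ioc (0 : ℝ) (1 / 2), ‖γ s‖ < ‖γ 0‖

theorem exists_isLobed : ∃ b₀ > 0, ∀ b ∈ Ioo (0 : ℝ) b₀, ∃ γ : ℝ → ℂ,
    IsHomotheticExpander γ ∧ IsLobed b γ := by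
  obtain ⟨b₀, hb₀, h⟩ := CircleFun.exists_isSolution
  refine ⟨b₀, hb₀, fun b hb => ?_⟩
  obtain ⟨μ, u, hμ, hs, hmax⟩ := h b hb
  refine ⟨CircleFun.lobeCurve b u, hs.isHomotheticExpander hb.1 hμ, hs.contDiff_lobeCurve,
    (hs.hasAngle hb.1).norm_deriv, CircleFun.lobeCurve_add_one b u, hs.lobeCurve_neg,
    fun s hs => ?_⟩
  rw [CircleFun.norm_lobeCurve, CircleFun.norm_lobeCurve]
  have hb' : (b : ℂ)⁻¹ ≠ 0 := inv_ne_zero (Complex.ofReal_ne_zero.2 hb.1.ne')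
  exact mul_lt_mul_of_pos_left (hmax s hs) (norm_pos_iff.2 hb')

end PlaneCurve

namespace PlaneCurve

/-- The angle between consecutive lobes of a curve with `m` lobes. -/
def lobeAngle (m : ℕ) : ℝ := 2 * Real.pi / m

lemma isPrimitiveRoot_lobeAngle {m : ℕ} (hm : m ≠ 0) :
    IsPrimitiveRoot (Complex.exp (Complex.I * lobeAngle m)) m := by
  have h := Complex.isPrimitiveRoot_exp m hm
  have e : Complex.I * (lobeAngle m : ℝ) = 2 * Real.pi * Complex.I / m := by
    rw [lobeAngle]
    push_cast
    ring
  rwa [e]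

namespace IsLobed

variable {b : ℝ} {γ : ℝ → ℂ}

lemma add_nat (h : IsLobed b γ) (j : ℕ) (s : ℝ) :
    γ (s + j) = Complex.exp (Complex.I * b) ^ j * γ s := by
  induction j with
  | zero => simp
  | succ j ih => rw [Nat.cast_succ, ← add_assoc, h.add_one, ih, pow_succ]; ring

lemma norm_rot (b : ℝ) : ‖Complex.exp (Complex.I * b)‖ = 1 := by
  rw [mul_comm, Complex.norm_exp_ofReal_mul_I]

lemma norm_periodic (h : IsLobed b γ) : Function.Periodic (fun s => ‖γ s‖) 1 := fun s => by
  simp only [h.add_one, norm_mul, norm_rot, one_mul]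

lemma norm_neg (h : IsLobed b γ) (s : ℝ) : ‖γ (-s)‖ = ‖γ s‖ := by
  rw [h.neg, _root_.norm_neg, RCLike.norm_conj]

/-- Rotation and reflection reduce `s` to its distance from the nearest integer, which lies in `[0,
1/2]`. -/
lemma norm_lt_of_ne (h : IsLobed b γ) (s : ℝ) : (∃ j : ℤ, s = j) ∨ ‖γ s‖ < ‖γ 0‖ := by
  by_cases hs : s = round s
  · exact Or.inl ⟨_, hs⟩
  right
  have h1 : ‖γ (s - round s)‖ = ‖γ s‖ := by
    simpa using h.norm_periodic.sub_zsmul_eq (round s) (x := s)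
  have h2 : ‖γ |s - round s|‖ = ‖γ (s - round s)‖ := by
    rcases abs_choice (s - round s) with e | e
    · rw [e]
    · rw [e, h.norm_neg]
  rw [← h1, ← h2]
  exact h.norm_lt _ ⟨abs_pos.2 (sub_ne_zero.2 hs), abs_sub_round s⟩

lemma norm_le (h : IsLobed b γ) (s : ℝ) : ‖γ s‖ ≤ ‖γ 0‖ := by
  rcases h.norm_lt_of_ne s with ⟨j, rfl⟩ | hs
  · have := h.norm_periodic.int_mul_eq j
    simp only [mul_one] at this
    exact this.le
  · exact hs.le

lemma apply_zero_ne (h : IsLobed b γ) : γ 0 ≠ 0 :=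
  norm_pos_iff.1 ((norm_nonneg _).trans_lt (h.norm_lt (1 / 2) ⟨by norm_num, le_rfl⟩))

lemma conj_apply_zero (h : IsLobed b γ) : conj (γ 0) = -γ 0 := by
  have := h.neg 0
  rw [neg_zero] at this
  rw [eq_neg_iff_add_eq_zero]
  nth_rewrite 2 [this]
  ring

variable {m : ℕ}

lemma periodic (h : IsLobed (lobeAngle m) γ) (hm : m ≠ 0) : Function.Periodic γ m := fun s => by
  rw [h.add_nat, (isPrimitiveRoot_lobeAngle hm).pow_eq_one, one_mul]

lemma isClosedImmersed (h : IsLobed (lobeAngle m) γ) (hm : m ≠ 0) : IsClosedImmersed γ m where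
  period_pos := by exact_mod_cast Nat.pos_of_ne_zero hm
  periodic := h.periodic hm
  smooth := h.smooth
  immersed s hs := by simpa [hs] using h.norm_deriv s

/-- The points of maximal distance from `0`. -/
lemma exists_pow_of_norm_eq (h : IsLobed (lobeAngle m) γ) (hm : m ≠ 0) {z : ℂ} (hz : z ∈ range γ)
    (hn : ‖z‖ = ‖γ 0‖) : ∃ ζ : ℂ, ζ ^ m = 1 ∧ z = ζ * γ 0 := by
  obtain ⟨s, rfl⟩ := hz
  rcases h.norm_lt_of_ne s with ⟨j, rfl⟩ | hs
  · have h1 : γ ((j % m : ℤ) : ℝ) = γ j := by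
      have h2 := (h.periodic hm).int_mul (j / m) ((j % m : ℤ) : ℝ)
      rw [← h2]
      congr 1
      have := Int.emod_add_mul_ediv j m
      have h3 : ((j % m : ℤ) : ℝ) + m * ((j / m : ℤ) : ℝ) = j := by exact_mod_cast this
      rw [← h3]
      ring
    obtain ⟨i, hi⟩ := Int.eq_ofNat_of_zero_le (Int.emod_nonneg j (by exact_mod_cast hm : (m : ℤ) ≠ 0))
    refine ⟨Complex.exp (Complex.I * lobeAngle m) ^ i, ?_, ?_⟩
    · rw [pow_right_comm, (isPrimitiveRoot_lobeAngle hm).pow_eq_one, one_pow]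
    · rw [← h1, hi, ← h.add_nat, zero_add]
      rfl
  · exact absurd hn hs.ne

lemma exists_nat_of_pow_eq_one (h : IsLobed (lobeAngle m) γ) (hm : m ≠ 0) {ζ : ℂ} (hζ : ζ ^ m = 1) :
    ∃ j : ℕ, ∀ s, ζ * γ s = γ (s + j) := by
  have : NeZero m := ⟨hm⟩
  obtain ⟨j, -, hj⟩ := (isPrimitiveRoot_lobeAngle hm).eq_pow_of_pow_eq_one hζ
  exact ⟨j, fun s => by rw [h.add_nat, hj]⟩

lemma isSymmetry (h : IsLobed (lobeAngle m) γ) (hm : m ≠ 0) {g : ℂ ≃ᵢ ℂ} (hg : IsDihedral m (-1) g) :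
    IsSymmetry γ m g := by
  obtain ⟨ζ, hζ, hg | hg⟩ := hg
  · obtain ⟨j, hj⟩ := h.exists_nat_of_pow_eq_one hm hζ
    refine ⟨fun u => u + j, contDiff_id.add contDiff_const, fun u => ?_, Or.inl fun u => by ring,
      fun u => by rw [hg, hj]⟩
    rw [((hasDerivAt_id' u).add_const (j : ℝ)).deriv]
    exact one_ne_zero
  · obtain ⟨j, hj⟩ := h.exists_nat_of_pow_eq_one hm hζ
    refine ⟨fun u => -u + j, contDiff_id.neg.add contDiff_const, fun u => ?_,
      Or.inr fun u => by ring, fun u => by rw [hg, ← hj, h.neg]; ring⟩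
    rw [((hasDerivAt_neg u).add_const (j : ℝ)).deriv]
    exact neg_ne_zero.2 one_ne_zero

/-- An isometry that preserves the trace fixes the centre. -/
lemma isometry_zero (h : IsLobed (lobeAngle m) γ) (hm : 1 < m) {g : ℂ ≃ᵢ ℂ}
    (hg : g '' range γ = range γ) : g 0 = 0 := by
  set L := g.toRealLinearIsometryEquiv with hL
  have hgL (z : ℂ) : g z = L z + g 0 := by
    rw [hL, IsometryEquiv.toRealLinearIsometryEquiv_apply, sub_add_cancel]
  set q := Complex.exp (Complex.I * lobeAngle m) with hq
  have hq1 : ‖q‖ = 1 := norm_rot _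
  -- The images of the lobe ends stay in the disc of radius `‖γ 0‖`. Summing over `j` removes the
  -- inner products, since the `m`-th roots of unity add up to zero, and leaves `m ‖g 0‖² ≤ 0`.
  have hle (j : ℕ) : 2 * inner ℝ (L (q ^ j * γ 0)) (g 0) + ‖g 0‖ ^ 2 ≤ 0 := by
    have h1 : g (γ ((0 : ℝ) + j)) ∈ range γ := hg ▸ mem_image_of_mem g (mem_range_self _)
    obtain ⟨s, hs⟩ := h1
    have h2 := h.norm_le s
    rw [hs, hgL, h.add_nat, ← hq] at h2
    have h3 := norm_add_sq_real (L (q ^ j * γ 0)) (g 0)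
    rw [L.norm_map, norm_mul, norm_pow, hq1, one_pow, one_mul] at h3
    have h4 := pow_le_pow_left₀ (norm_nonneg _) h2 2
    linarith
  have hsum : ∑ j ∈ Finset.range m, L (q ^ j * γ 0) = 0 := by
    rw [← map_sum, ← Finset.sum_mul, (isPrimitiveRoot_lobeAngle (by lia)).geom_sum_eq_zero hm,
      zero_mul, map_zero]
  have h1 := Finset.sum_nonpos fun j (_ : j ∈ Finset.range m) => hle j
  rw [Finset.sum_add_distrib, ← Finset.mul_sum, ← sum_inner, hsum, inner_zero_left, mul_zero,
    zero_add, Finset.sum_const, Finset.card_range, nsmul_eq_mul] at h1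
  have hm' : (0 : ℝ) < m := by exact_mod_cast (by lia : 0 < m)
  have h2 : ‖g 0‖ ^ 2 ≤ 0 := nonpos_of_mul_nonpos_right h1 hm'
  exact norm_eq_zero.1 (pow_eq_zero_iff two_ne_zero |>.1 (le_antisymm h2 (sq_nonneg _)))

/-- A linear isometry of the plane is `z ↦ cz` or `z ↦ c z̄`, and the image of one farthest point
determines `c`. The reflections have `a = -1` because `γ 0` is purely imaginary. -/
lemma isDihedral_of_image_eq (h : IsLobed (lobeAngle m) γ) (hm : 1 < m) {g : ℂ ≃ᵢ ℂ}
    (hg : g '' range γ = range γ) : IsDihedral m (-1) g := by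
  have h0 := h.isometry_zero hm hg
  have hgL (z : ℂ) : g z = g.toRealLinearIsometryEquiv z := by
    rw [IsometryEquiv.toRealLinearIsometryEquiv_apply, h0, sub_zero]
  have hmem : g (γ 0) ∈ range γ := hg ▸ mem_image_of_mem g (mem_range_self _)
  have hnorm : ‖g (γ 0)‖ = ‖γ 0‖ := by rw [hgL, LinearIsometryEquiv.norm_map]
  obtain ⟨ζ, hζ, hz⟩ := h.exists_pow_of_norm_eq (by lia) hmem hnorm
  refine ⟨ζ, hζ, ?_⟩
  obtain ⟨c, hc | hc⟩ := linear_isometry_complex g.toRealLinearIsometryEquiv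
  · left
    have h1 (z : ℂ) : g z = c * z := by rw [hgL, hc, rotation_apply]
    rw [h1] at hz
    intro z
    rw [h1, mul_right_cancel₀ h.apply_zero_ne hz]
  · right
    have h1 (z : ℂ) : g z = c * conj z := by
      rw [hgL, hc, LinearIsometryEquiv.trans_apply, rotation_apply, Complex.conjLIE_apply]
    rw [h1, h.conj_apply_zero, mul_neg, ← neg_mul] at hz
    intro z
    rw [h1, ← mul_right_cancel₀ h.apply_zero_ne hz]
    ring

lemma hasDihedralSymmetry (h : IsLobed (lobeAngle m) γ) (hm : 1 < m) :
    HasDihedralSymmetry γ m m :=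
  ⟨-1, by simp, fun _ hg => h.isSymmetry (by lia) hg, fun _ hg => h.isDihedral_of_image_eq hm hg⟩

lemma image_rot (h : IsLobed b γ) : (fun z => Complex.exp (Complex.I * b) * z) '' range γ = range γ := by
  ext z
  constructor
  · rintro ⟨_, ⟨s, rfl⟩, rfl⟩
    exact ⟨s + 1, h.add_one s⟩
  · rintro ⟨s, rfl⟩
    refine ⟨γ (s - 1), mem_range_self _, ?_⟩
    have := h.add_one (s - 1)
    rw [sub_add_cancel] at this
    exact this.symm

/-- The conjugate of a rotation about the origin by a similarity transformation. -/
def conjRotation (Φ : ℂ ≃ᵈ ℂ) (c : Circle) : ℂ ≃ᵢ ℂ where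
  toEquiv := Φ.symm.toEquiv.trans ((rotation c).toLinearEquiv.toEquiv.trans Φ.toEquiv)
  isometry_toFun x y := by
    change edist (Φ (rotation c (Φ.symm x))) (Φ (rotation c (Φ.symm y))) = edist x y
    rw [Dilation.edist_eq Φ, (rotation c).isometry.edist_eq, ← Dilation.edist_eq Φ, Φ.apply_symm_apply,
      Φ.apply_symm_apply]

lemma conjRotation_apply (Φ : ℂ ≃ᵈ ℂ) (c : Circle) (z : ℂ) :
    conjRotation Φ c (Φ z) = Φ (c * z) := by
  change Φ (rotation c (Φ.symm (Φ z))) = _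
  rw [Φ.symm_apply_apply, rotation_apply]

/-- Conjugating the rotation of order `m` by the similarity gives an isometry of order `m` that
preserves the other trace, so it lies in `D_n`. As a rotation it has order dividing `n`; as a
reflection it would have order dividing 2, against `m > 2`. -/
lemma dvd_of_similar (h : IsLobed (lobeAngle m) γ) (hm : 2 < m) {n : ℕ} {η : ℝ → ℂ}
    (hη : IsLobed (lobeAngle n) η) (hn : 1 < n) (hs : Similar γ η) : m ∣ n := by
  obtain ⟨Φ, hΦ⟩ := hs
  have hq := isPrimitiveRoot_lobeAngle (m := m) (by lia)
  have hR := h.image_rot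
  set q := Complex.exp (Complex.I * lobeAngle m) with hqd
  set c : Circle := ⟨q, mem_sphere_zero_iff_norm.2 (norm_rot _)⟩ with hc
  set g := conjRotation Φ c with hg
  have hgΦ (z : ℂ) : g (Φ z) = Φ (q * z) := conjRotation_apply Φ c z
  have himg : g '' range η = range η := by
    have h1 : g '' (Φ '' range γ) = Φ '' ((fun z => q * z) '' range γ) := by
      simp only [image_image, hgΦ]
    rw [← hΦ, h1, hR]
  have hiter (j : ℕ) (z : ℂ) : g^[j] (Φ z) = Φ (q ^ j * z) := by
    induction j with
    | zero => simp
    | succ j ih => rw [Function.iterate_succ_apply', ih, hgΦ, pow_succ]; ring_nf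
  have hdvd (j : ℕ) (hj : ∀ z, g^[j] z = z) : m ∣ j := by
    have h1 : Φ (q ^ j * 1) = Φ 1 := by rw [← hiter, hj]
    have h2 := Φ.injective h1
    rw [mul_one] at h2
    exact hq.dvd_of_pow_eq_one j h2
  obtain ⟨ζ, hζ, hz | hz⟩ := hη.isDihedral_of_image_eq hn himg
  · refine hdvd n fun z => ?_
    have h1 (j : ℕ) : g^[j] z = ζ ^ j * z := by
      induction j with
      | zero => simp
      | succ j ih => rw [Function.iterate_succ_apply', ih, hz, pow_succ]; ring
    rw [h1, hζ, one_mul]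
  · have hζ1 : ζ * conj ζ = 1 := by
      rw [Complex.mul_conj, Complex.normSq_eq_norm_sq, Complex.norm_eq_one_of_pow_eq_one hζ (by lia)]
      simp
    have h2 := hdvd 2 fun z => by
      rw [Function.iterate_succ_apply', Function.iterate_one, hz, hz]
      simp only [map_mul, map_neg, map_one, Complex.conj_conj]
      linear_combination z * hζ1
    exact absurd (Nat.le_of_dvd two_pos h2) (by lia)

lemma not_similar (h : IsLobed (lobeAngle m) γ) (hm : 2 < m) {n : ℕ} {η : ℝ → ℂ}
    (hη : IsLobed (lobeAngle n) η) (hn : 2 < n) (hne : m ≠ n) : ¬ Similar γ η := fun hs => by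
  have hs' : Similar η γ := by
    obtain ⟨Φ, hΦ⟩ := hs
    refine ⟨Φ.symm, ?_⟩
    rw [← hΦ, image_image]
    simp
  exact hne (Nat.dvd_antisymm (h.dvd_of_similar hm hη (by lia) hs)
    (hη.dvd_of_similar hn h (by lia) hs'))

end IsLobed

end PlaneCurve

end


/-! ### Choice of `m₀`. -/

theorem theorem3 :
    ∃ (m₀ : ℕ) (γ : ℕ → ℝ → ℂ),
      (∀ m : ℕ, m₀ < m →
        PlaneCurve.IsHomotheticExpander (γ m) ∧
        ∃ T : ℝ, PlaneCurve.IsClosedImmersed (γ m) T ∧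
          PlaneCurve.HasDihedralSymmetry (γ m) T m) ∧
      ∀ m n : ℕ, m₀ < m → m₀ < n → m ≠ n → ¬ PlaneCurve.Similar (γ m) (γ n) := by
  obtain ⟨b₀, hb₀, h⟩ := PlaneCurve.exists_isLobed
  choose! c hc using h
  have hpi := Real.pi_pos
  obtain ⟨M, hM⟩ := exists_nat_gt (2 * Real.pi / b₀)
  have hmem (m : ℕ) (hm : M + 2 < m) : PlaneCurve.lobeAngle m ∈ Ioo (0 : ℝ) b₀ := by
    have hm0 : (0 : ℝ) < m := by exact_mod_cast (by lia : 0 < m)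
    have hMm : (M : ℝ) < m := by exact_mod_cast (by lia : M < m)
    refine ⟨div_pos (by linarith) hm0, ?_⟩
    rw [PlaneCurve.lobeAngle, div_lt_comm₀ hm0 hb₀]
    exact hM.trans hMm
  -- `M` makes the angle `2π/m` smaller than `b₀`; the extra 2 ensures `m > 2`, as the
  -- non-similarity argument requires.
  refine ⟨M + 2, fun m => c (PlaneCurve.lobeAngle m), fun m hm => ?_, fun m n hm hn hne => ?_⟩
  · obtain ⟨h1, h2⟩ := hc _ (hmem m hm)
    exact ⟨h1, m, h2.isClosedImmersed (by lia), h2.hasDihedralSymmetry (by lia)⟩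
  · exact (hc _ (hmem m hm)).2.not_similar (by lia) (hc _ (hmem n hn)).2 (by lia) hne
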